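/- Let $d\ge 2$, let $\mathcal U^d$ be the uniform distribution on the unit sphere $\mathbb S^{d-1}\subset\mathbb R^d$, let $\mathbf\Sigma\in\mathbb R^{d\times d}$ be symmetric positive definite, and let $L,\sigma>0$. Covariates are distributed as $D_{\mathbf x}=\mathbf\Sigma^{-1/2}\,\mathcal U^d$. A random task is either (Case 1, affine) $f(\mathbf x)=l\,\mathbf w^\top\mathbf x+b$, or (Case 2, two-piece ReLU) $f(\mathbf x)=l_1(\mathbf w^\top\mathbf x)_++l_2(-\mathbf w^\top\mathbf x)_++b$, where $(z)_+=\max(z,0)$, with $\mathbf w\sim\mathbf\Sigma^{1/2}\,\mathcal U^d$ and $b,l,l_1,l_2$ uniform on $[-L,L]$, all independent. Let $\mathbf x_1,\dots,\mathbf x_{n+1}$ be i.i.d. from $D_{\mathbf x}$ and let $\epsilon_1,\dots,\epsilon_n$ be i.i.d. from any distribution on $\mathbb R$ with mean $0$ and variance $\sigma^2$, with the task, the covariates and the noise independent. The softmax in-context-learning pretraining loss of $\mathbf M\in\mathbb R^{d\times d}$ is $$\mathcal L(\mathbf M)=\mathbb E_{f,\{\mathbf x_i\},\{\epsilon_i\}}\left(\frac{\sum_{i=1}^n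 (f(\mathbf x_i)+\epsilon_i)\,e^{\mathbf x_i^\top\mathbf M\mathbf x_{n+1}}}{\sum_{i=1}^n e^{\mathbf x_i^\top\mathbf M\mathbf x_{n+1}}}-f(\mathbf x_{n+1})\right)^2 .$$ Put $\Lambda=nL^2/\sigma^2$, $\alpha=\frac1{d+4}$, $\beta=\frac1{d+2}$. For all constants $\kappa,K>0$ there are $n_0\in\mathbb N$ and $c,C>0$, depending only on $d,\kappa,K$, such that for all $n\ge n_0$, all $L,\sigma>0$ with $\sigma^2\le K\,nL^2$, all $\mathbf\Sigma$ and all noise distributions as above: (Case 1) if the tasks are affine and $\sigma^2\ge\kappa L^2 n^{-2/(d+2)}$, then every minimizer $\mathbf M^*$ of $\mathcal L$ over $\mathbb R^{d\times d}$ has the form $\mathbf M^*=w_{KQ}\mathbf\Sigma$ with $w_{KQ}\in\mathbb R$ and $c\,\Lambda^{\alpha}\le|w_{KQ}|\le C\,\Lambda^{2\alpha/(1-\beta)}$; (Case 2) if the tasks are two-piece ReLU and $\sigma^2\ge\kappa L^2 n^{-2/d}$, then every minimizer $\mathbf M^*$ of $\mathcal L$ over $\mathbb R^{d\times d}$ has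 the form $\mathbf M^*=w_{KQ}\mathbf\Sigma$ with $w_{KQ}\in\mathbb R$ and $c\,\Lambda^{\beta}\le|w_{KQ}|\le C\,\Lambda^{2\beta}$. -/

import Mathlib

open MeasureTheory ProbabilityTheory
open scoped Matrix MatrixOrder

noncomputable section

namespace SoftmaxICL

/-- Covariate space `ℝ^d` with the Euclidean norm. -/
abbrev Vec (d : ℕ) : Type := EuclideanSpace ℝ (Fin d)

/-- The uniform probability distribution on the unit sphere of `ℝ^d`, as a measure on `ℝ^d`:
normalized surface measure. -/
def sphereUniform (d : ℕ) : Measure (Vec d) :=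
  let μ : Measure (Metric.sphere (0 : Vec d) 1) := (volume : Measure (Vec d)).toSphere
  ((μ Set.univ)⁻¹ • μ).map Subtype.val

/-- The law of `A u`, where `u` is uniform on the unit sphere. -/
def linearSphere {d : ℕ} (A : Matrix (Fin d) (Fin d) ℝ) : Measure (Vec d) :=
  (sphereUniform d).map (fun u => Matrix.toEuclideanLin A u)

/-- Covariate distribution `Σ^{-1/2} U^d`. -/
def covariateLaw {d : ℕ} (S : Matrix (Fin d) (Fin d) ℝ) : Measure (Vec d) :=
  linearSphere (CFC.sqrt S)⁻¹

/-- Direction distribution `Σ^{1/2} U^d` of the random tasks. -/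
def directionLaw {d : ℕ} (S : Matrix (Fin d) (Fin d) ℝ) : Measure (Vec d) :=
  linearSphere (CFC.sqrt S)

/-- The uniform distribution on the interval `[-L, L]`. -/
def unifInterval (L : ℝ) : Measure ℝ :=
  ProbabilityTheory.cond volume (Set.Icc (-L) L)

/-- The affine task with parameters `(w, l, b)`: `x ↦ l wᵀx + b`. -/
def affineTask {d : ℕ} (θ : Vec d × ℝ × ℝ) (x : Vec d) : ℝ :=
  θ.2.1 * (θ.1 ⬝ᵥ x) + θ.2.2

/-- The law of the parameters `(w, l, b)` of a random affine task. -/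
def affineLaw {d : ℕ} (S : Matrix (Fin d) (Fin d) ℝ) (L : ℝ) : Measure (Vec d × ℝ × ℝ) :=
  (directionLaw S).prod ((unifInterval L).prod (unifInterval L))

/-- The two-piece ReLU task with parameters `(w, l₁, l₂, b)`:
`x ↦ l₁ (wᵀx)₊ + l₂ (-wᵀx)₊ + b`. -/
def reluTask {d : ℕ} (θ : Vec d × ℝ × ℝ × ℝ) (x : Vec d) : ℝ :=
  θ.2.1 * max (θ.1 ⬝ᵥ x) 0 + θ.2.2.1 * max (-(θ.1 ⬝ᵥ x)) 0 + θ.2.2.2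

/-- The law of the parameters `(w, l₁, l₂, b)` of a random two-piece ReLU task. -/
def reluLaw {d : ℕ} (S : Matrix (Fin d) (Fin d) ℝ) (L : ℝ) : Measure (Vec d × ℝ × ℝ × ℝ) :=
  (directionLaw S).prod ((unifInterval L).prod ((unifInterval L).prod (unifInterval L)))

/-- The softmax attention prediction at the query `q` from the context `(x i, y i)`. -/
def softmaxPrediction {d n : ℕ} (M : Matrix (Fin d) (Fin d) ℝ)
    (x : Fin n → Vec d) (y : Fin n → ℝ) (q : Vec d) : ℝ :=
  (∑ i, y i * Real.exp (x i ⬝ᵥ M *ᵥ q)) / ∑ i, Real.exp (x i ⬝ᵥ M *ᵥ q)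

/-- The population ICL pretraining loss of `M`: the task is `task θ` with `θ ∼ P`, the `n` context
covariates and the query are i.i.d. from `Dx`, the `n` label noises are i.i.d. from `Dε`, and
the task, the covariates and the noise are independent. -/
def iclLoss {Θ : Type} [MeasurableSpace Θ] {d : ℕ} (P : Measure Θ) (task : Θ → Vec d → ℝ)
    (Dx : Measure (Vec d)) (Dε : Measure ℝ) (n : ℕ) (M : Matrix (Fin d) (Fin d) ℝ) : ℝ :=
  ∫ z : Θ × (Fin n → Vec d) × Vec d × (Fin n → ℝ),
    (softmaxPrediction M z.2.1 (fun i => task z.1 (z.2.1 i) + z.2.2.2 i) z.2.2.1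
      - task z.1 z.2.2.1) ^ 2
    ∂(P.prod ((Measure.pi fun _ => Dx).prod (Dx.prod (Measure.pi fun _ => Dε))))

end SoftmaxICL

end

noncomputable section

open scoped InnerProductSpace Pointwise

set_option linter.unusedSectionVars false

namespace SoftmaxICL

/-! ### Uniform measure on the sphere, rotation invariance and second moments. -/

variable {d : ℕ}

/-! Write `k = (d-1)/2`.

Reduction. In whitened coordinates the covariates and the task direction are uniform on the sphere,
and the attention matrix becomes `A = Σ^{-1/2} M Σ^{-1/2}`. Softmax weights sum to one, so the
intercept cancels, and the error is a sum of terms with uncorrelated random coefficients: the slopes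
and the label noises. The loss is therefore the average over the query `q` of `a * bias + s *
noise`, with `s = σ²` and noise the mean sum of squared weights (`iclLoss_affine`, `iclLoss_relu`).
The two ReLU slopes contribute equally, by the symmetry `v ↦ -v`, so `a` is `L²/3` for affine and
`2L²/3` for ReLU tasks.

Form of the minimizer. The noise depends only on `‖A q‖`, while for a given norm the bias is
strictly smallest when `A q` points along `q`; this is a rearrangement argument with the reflection
swapping two unit vectors (`cross_term_pos`, `biasAt_aligned_lt`). A minimizer thus has every vector
as an eigenvector, with eigenvalue `w ≥ 0`.

Size of `w`. The weights are proportional to `exp (-w * gap)`, so attention lives on a cap of height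
`1/w` and measure of order `w^(-k)`. The noise is of order `w^k / n` and increases with `w`. The
bias is at least `c / (1+w)²`, and at most `C * w^(-γ)` as long as `w^(k+γ-1) ≲ n`. In the affine
case `γ = 2`: tangential deviations cancel by reflection, leaving a mean deviation of order `1/w`.
In the ReLU case `γ = 3/2`: with probability of order `w^(-1/2)` the query is so close to the kink
that the mean deviation is of order `w^(-1/2)`.

The two terms balance at `w₀ = x^(1/(k+γ))`, with `x` a multiple of `Λ`. The loss at a minimizer is
at most that at `w₀`, so the noise lower bound forces `w ≲ w₀`, and the bias lower bound forces
`(1+w)² ≳ w₀^γ`. The summand `1` is harmless because `w` stays away from zero: at `w = 0` the bias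
has negative slope and the noise changes only to second order (`exists_le_of_isMin`). The lower
bound on `σ²` supplies `w₀^(k+γ-1) ≲ n`, the upper bound supplies `x ≥ 1`. -/

/-- The unit sphere of `ℝ^d` as a type. -/
abbrev Sph (d : ℕ) : Type := Metric.sphere (0 : Vec d) 1

/-- Normalized surface measure on the unit sphere. -/
def sphMeasure (d : ℕ) : Measure (Sph d) :=
  ((volume : Measure (Vec d)).toSphere Set.univ)⁻¹ • (volume : Measure (Vec d)).toSphere

theorem sphereUniform_eq_map : sphereUniform d = (sphMeasure d).map Subtype.val := rfl

section
variable [NeZero d]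

instance nontrivialVec : Nontrivial (Vec d) := by
  have : Nonempty (Fin d) := ⟨0⟩
  infer_instance

theorem toSphere_univ_ne_zero : (volume : Measure (Vec d)).toSphere Set.univ ≠ 0 := by
  rw [Ne, Measure.measure_univ_eq_zero]
  exact Measure.toSphere_ne_zero _

instance isProbabilityMeasure_sphMeasure : IsProbabilityMeasure (sphMeasure d) where
  measure_univ := by
    rw [sphMeasure, Measure.smul_apply, smul_eq_mul]
    exact ENNReal.inv_mul_cancel toSphere_univ_ne_zero (measure_ne_top _ _)

instance isOpenPosMeasure_sphMeasure : (sphMeasure d).IsOpenPosMeasure where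
  open_pos U hU hne := by
    rw [sphMeasure, Measure.smul_apply, smul_eq_mul]
    exact mul_ne_zero (ENNReal.inv_ne_zero.2 (measure_ne_top _ _)) (hU.measure_ne_zero _ hne)

instance nonemptySph : Nonempty (Sph d) := by
  have := (NormedSpace.sphere_nonempty (x := (0 : Vec d)) (r := 1)).2 zero_le_one
  exact this.to_subtype

end

theorem norm_sph (u : Sph d) : ‖(u : Vec d)‖ = 1 := by simp

theorem inner_sph_self (u : Sph d) : ⟪(u : Vec d), (u : Vec d)⟫_ℝ = 1 := by
  rw [real_inner_self_eq_norm_sq, norm_sph, one_pow]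

theorem abs_inner_sph_le (u v : Sph d) : |⟪(u : Vec d), (v : Vec d)⟫_ℝ| ≤ 1 := by
  simpa using abs_real_inner_le_norm (u : Vec d) (v : Vec d)

/-- The action of a linear isometry on the unit sphere. -/
def rot (O : Vec d ≃ₗᵢ[ℝ] Vec d) (u : Sph d) : Sph d :=
  ⟨O u, by simp⟩

@[simp] theorem coe_rot (O : Vec d ≃ₗᵢ[ℝ] Vec d) (u : Sph d) : (rot O u : Vec d) = O u := rfl

@[fun_prop] theorem continuous_rot (O : Vec d ≃ₗᵢ[ℝ] Vec d) : Continuous (rot O) :=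
  (O.continuous.comp continuous_subtype_val).subtype_mk _

/-- Surface measure is defined through the volume of cones, and an isometry maps cones to cones and
preserves volume. -/
theorem measurePreserving_rot (O : Vec d ≃ₗᵢ[ℝ] Vec d) :
    MeasurePreserving (rot O) (sphMeasure d) (sphMeasure d) := by
  refine ⟨(continuous_rot O).measurable, ?_⟩
  ext s hs
  rw [Measure.map_apply (continuous_rot O).measurable hs]
  have hs' := (continuous_rot O).measurable hs
  simp only [sphMeasure, Measure.smul_apply, smul_eq_mul]
  rw [Measure.toSphere_apply' _ hs, Measure.toSphere_apply' _ hs']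
  congr 2
  refine Eq.trans ?_ (O.measurePreserving.measure_preimage_emb
    O.toHomeomorph.measurableEmbedding _)
  congr 1
  ext x
  simp only [Set.mem_smul, Set.mem_image, Set.mem_preimage]
  constructor
  · rintro ⟨r, hr, y, ⟨u, hu, rfl⟩, rfl⟩
    exact ⟨r, hr, _, ⟨rot O u, hu, rfl⟩, by simp⟩
  · rintro ⟨r, hr, y, ⟨u, hu, rfl⟩, h⟩
    refine ⟨r, hr, _, ⟨rot O.symm u, ?_, rfl⟩, ?_⟩
    · have : rot O (rot O.symm u) = u := by ext1; simp
      rwa [this]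
    · apply O.injective
      simpa using h

theorem integrable_of_continuous {X : Type*} [TopologicalSpace X] [CompactSpace X]
    [MeasurableSpace X] [OpensMeasurableSpace X] {μ : Measure X} [IsFiniteMeasure μ]
    {f : X → ℝ} (hf : Continuous f) : Integrable f μ :=
  hf.integrable_of_hasCompactSupport (HasCompactSupport.of_compactSpace f)

theorem integral_pos_of_continuous {X : Type*} [TopologicalSpace X] [CompactSpace X]
    [MeasurableSpace X] [OpensMeasurableSpace X] {μ : Measure X} [IsFiniteMeasure μ]
    [μ.IsOpenPosMeasure] {f : X → ℝ} (hf : Continuous f) (h0 : ∀ x, 0 ≤ f x) {x : X}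
    (hx : f x ≠ 0) : 0 < ∫ x, f x ∂μ :=
  hf.integral_pos_of_hasCompactSupport_nonneg_nonzero (HasCompactSupport.of_compactSpace f) h0 hx

/-- The product of `n` copies of the uniform law on the sphere. -/
def sphPi (d n : ℕ) : Measure (Fin n → Sph d) := Measure.pi fun _ => sphMeasure d

section
variable [NeZero d] {n : ℕ}

instance isProbabilityMeasure_sphPi : IsProbabilityMeasure (sphPi d n) := by
  unfold sphPi; infer_instance

instance isOpenPosMeasure_sphPi : (sphPi d n).IsOpenPosMeasure := by
  unfold sphPi
  exact Measure.pi.isOpenPosMeasure (fun _ : Fin n => sphMeasure d)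

theorem measurePreserving_sphPi {f : Fin n → Sph d → Sph d}
    (hf : ∀ i, MeasurePreserving (f i) (sphMeasure d) (sphMeasure d)) :
    MeasurePreserving (fun u i => f i (u i)) (sphPi d n) (sphPi d n) :=
  measurePreserving_pi _ _ hf

theorem integral_sphPi_eval {f : Sph d → ℝ} (hf : Continuous f) (i : Fin n) :
    ∫ u, f (u i) ∂(sphPi d n) = ∫ x, f x ∂(sphMeasure d) :=
  integral_comp_eval hf.aestronglyMeasurable

end

theorem integral_comp_of_continuous {X Y : Type*} [TopologicalSpace Y]
    [MeasurableSpace X] [MeasurableSpace Y] [OpensMeasurableSpace Y]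
    {μ : Measure X} {ν : Measure Y} {φ : X → Y}
    (hφ : MeasurePreserving φ μ ν) {f : Y → ℝ} (hf : Continuous f) :
    ∫ x, f (φ x) ∂μ = ∫ y, f y ∂ν := by
  rw [← hφ.map_eq, integral_map hφ.measurable.aemeasurable hf.aestronglyMeasurable]

theorem integral_rot {f : Sph d → ℝ} (hf : Continuous f) (O : Vec d ≃ₗᵢ[ℝ] Vec d) :
    ∫ x, f (rot O x) ∂(sphMeasure d) = ∫ x, f x ∂(sphMeasure d) :=
  integral_comp_of_continuous (measurePreserving_rot O) hf

/-- The reflection that swaps two vectors of the same norm. -/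
def swapRefl (a b : Vec d) : Vec d ≃ₗᵢ[ℝ] Vec d := (ℝ ∙ (a - b))ᗮ.reflection

theorem swapRefl_swapRefl (a b x : Vec d) : swapRefl a b (swapRefl a b x) = x :=
  Submodule.reflection_reflection _ x

theorem swapRefl_left {a b : Vec d} (h : ‖a‖ = ‖b‖) : swapRefl a b a = b :=
  Submodule.reflection_sub h

theorem swapRefl_right {a b : Vec d} (h : ‖a‖ = ‖b‖) : swapRefl a b b = a := by
  have := congrArg (swapRefl a b) (swapRefl_left h)
  rw [swapRefl_swapRefl] at this
  exact this.symm

theorem inner_swapRefl (a b x y : Vec d) : ⟪swapRefl a b x, y⟫_ℝ = ⟪x, swapRefl a b y⟫_ℝ := by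
  conv_lhs => rw [← swapRefl_swapRefl a b y]
  exact (swapRefl a b).inner_map_map _ _

theorem swapRefl_apply (a b x : Vec d) :
    swapRefl a b x = x - (2 * (⟪a - b, x⟫_ℝ / ‖a - b‖ ^ 2)) • (a - b) := by
  rw [swapRefl, Submodule.reflection_orthogonal_apply, Submodule.reflection_singleton_apply]
  simp only [neg_sub, RCLike.ofReal_real_eq_id, id, mul_smul, two_smul ℝ, two_smul ℕ]

/-- Only the sign of the right side matters later: it tells how swapping `a` and `b` moves an inner
product. -/
theorem inner_sub_inner_swapRefl (a b x y : Vec d) :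
    ⟪x, y⟫_ℝ - ⟪x, swapRefl a b y⟫_ℝ = 2 * (⟪a - b, x⟫_ℝ * ⟪a - b, y⟫_ℝ) / ‖a - b‖ ^ 2 := by
  rw [swapRefl_apply, inner_sub_right, inner_smul_right, real_inner_comm x (a - b)]
  ring

theorem exists_rot_eq (a b : Sph d) : ∃ O : Vec d ≃ₗᵢ[ℝ] Vec d, rot O a = b :=
  ⟨swapRefl a b, by ext1; exact swapRefl_left (by simp)⟩

/-- The second moment of a coordinate of a uniform point on the unit sphere. -/
def secondMoment (d : ℕ) [NeZero d] : ℝ :=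
  ∫ u : Sph d, ⟪(u : Vec d), (Classical.arbitrary (Sph d) : Vec d)⟫_ℝ ^ 2 ∂(sphMeasure d)

/-- Integrals of functions of one coordinate do not depend on the coordinate. -/
theorem integral_inner_congr {f : ℝ → ℝ} (hf : Continuous f) (p q : Sph d) :
    ∫ u : Sph d, f ⟪(u : Vec d), (p : Vec d)⟫_ℝ ∂(sphMeasure d)
      = ∫ u : Sph d, f ⟪(u : Vec d), (q : Vec d)⟫_ℝ ∂(sphMeasure d) := by
  obtain ⟨O, rfl⟩ := exists_rot_eq p q
  rw [← integral_rot (f := fun u : Sph d => f ⟪(u : Vec d), (rot O p : Vec d)⟫_ℝ)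
    (by fun_prop) O]
  simp

section
variable [NeZero d]

theorem secondMoment_pos : 0 < secondMoment d := by
  refine integral_pos_of_continuous (by fun_prop) (fun x => sq_nonneg _)
    (x := Classical.arbitrary (Sph d)) ?_
  rw [inner_sph_self]; norm_num

theorem integral_inner_sq (y : Vec d) :
    ∫ u : Sph d, ⟪(u : Vec d), y⟫_ℝ ^ 2 ∂(sphMeasure d) = secondMoment d * ‖y‖ ^ 2 := by
  by_cases hy : y = 0
  · simp [hy]
  have hy' : ‖y‖ ≠ 0 := norm_ne_zero_iff.2 hy
  have e : ∀ u : Sph d, ⟪(u : Vec d), y⟫_ℝ ^ 2 = ⟪(u : Vec d), (‖y‖⁻¹ • y)⟫_ℝ ^ 2 * ‖y‖ ^ 2 := by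
    intro u
    rw [inner_smul_right]; field_simp
  simp_rw [e]
  rw [integral_mul_const]
  congr 1
  exact integral_inner_congr (f := fun t => t ^ 2) (by fun_prop)
    ⟨‖y‖⁻¹ • y, by simp [norm_smul, hy']⟩ _

/-- Polarization of `integral_inner_sq`. -/
theorem integral_inner_mul_inner (y z : Vec d) :
    ∫ u : Sph d, ⟪(u : Vec d), y⟫_ℝ * ⟪(u : Vec d), z⟫_ℝ ∂(sphMeasure d)
      = secondMoment d * ⟪y, z⟫_ℝ := by
  have e : ∀ u : Sph d, ⟪(u : Vec d), y⟫_ℝ * ⟪(u : Vec d), z⟫_ℝ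
      = (1 / 4) * (⟪(u : Vec d), y + z⟫_ℝ ^ 2 - ⟪(u : Vec d), y - z⟫_ℝ ^ 2) := by
    intro u
    rw [inner_add_right, inner_sub_right]; ring
  simp_rw [e]
  rw [integral_const_mul, integral_sub, integral_inner_sq, integral_inner_sq,
    norm_add_sq_real, norm_sub_sq_real]
  · ring
  all_goals exact integrable_of_continuous (by fun_prop)

end

/-! ### Measures of spherical caps and equatorial bands, by comparing cones with boxes. -/

section
variable [NeZero d]

/-- The cone over a subset of the sphere, truncated at radius one. -/
def sphCone (s : Set (Sph d)) : Set (Vec d) := Set.Ioo (0 : ℝ) 1 • (((↑) : Sph d → Vec d) '' s)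

theorem sphMeasure_real_eq {s : Set (Sph d)} (hs : MeasurableSet s) :
    (sphMeasure d).real s = volume.real (sphCone s) / volume.real (Metric.ball (0 : Vec d) 1) := by
  have hd : ((d : ℕ) : ℝ) ≠ 0 := Nat.cast_ne_zero.2 (NeZero.ne d)
  rw [sphMeasure, measureReal_ennreal_smul_apply, measureReal_def _ s, Measure.toSphere_apply' _ hs,
    Measure.toSphere_apply_univ, sphCone]
  simp only [finrank_euclideanSpace, Fintype.card_fin, ENNReal.toReal_inv, ENNReal.toReal_mul,
    ENNReal.toReal_natCast, measureReal_def]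
  field_simp

theorem volume_ball_pos : 0 < volume.real (Metric.ball (0 : Vec d) 1) :=
  ENNReal.toReal_pos (Metric.measure_ball_pos _ _ one_pos).ne' measure_ball_lt_top.ne

/-- The box `[l, r] × [-ρ, ρ]^(d-1)`. -/
def slabBox (d : ℕ) [NeZero d] (l r ρ : ℝ) : Set (Vec d) :=
  {x | x 0 ∈ Set.Icc l r ∧ ∀ j, j ≠ 0 → |x j| ≤ ρ}

theorem slabBox_eq (l r ρ : ℝ) : slabBox d l r ρ = (WithLp.ofLp : Vec d → Fin d → ℝ) ⁻¹'
    (Set.Icc (fun j => if j = 0 then l else -ρ) (fun j => if j = 0 then r else ρ)) := by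
  ext x
  simp only [slabBox, Set.mem_ofPred_eq, Set.mem_preimage, Set.mem_Icc, Pi.le_def, abs_le]
  constructor
  · rintro ⟨h0, h⟩
    refine ⟨fun j => ?_, fun j => ?_⟩ <;> by_cases hj : j = 0
    · subst hj; simpa using h0.1
    · simpa [hj] using (h j hj).1
    · subst hj; simpa using h0.2
    · simpa [hj] using (h j hj).2
  · rintro ⟨h1, h2⟩
    refine ⟨⟨by simpa using h1 0, by simpa using h2 0⟩, fun j hj => ⟨?_, ?_⟩⟩
    · simpa [hj] using h1 j
    · simpa [hj] using h2 j

theorem volume_slabBox {l r ρ : ℝ} (hlr : l ≤ r) (hρ : 0 ≤ ρ) :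
    volume.real (slabBox d l r ρ) = (r - l) * (2 * ρ) ^ (d - 1) := by
  rw [slabBox_eq, measureReal_def, (PiLp.volume_preserving_ofLp (Fin d)).measure_preimage
    measurableSet_Icc.nullMeasurableSet, Real.volume_Icc_pi_toReal,
    Fintype.prod_eq_mul_prod_compl 0]
  · simp only [if_true]
    congr 1
    rw [Finset.prod_congr rfl (g := fun _ => 2 * ρ)]
    · simp [Finset.card_compl]
    · intro j hj
      have : j ≠ 0 := by simpa using hj
      simp [this]; ring
  · intro j
    by_cases hj : j = 0
    · simp [hj, hlr]
    · simp [hj]; linarith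

theorem volume_slabBox_ne_top (l r ρ : ℝ) : volume (slabBox d l r ρ) ≠ ⊤ := by
  rw [slabBox_eq, (PiLp.volume_preserving_ofLp (Fin d)).measure_preimage
    measurableSet_Icc.nullMeasurableSet]
  exact isCompact_Icc.measure_lt_top.ne

theorem sphCone_subset_ball (s : Set (Sph d)) : sphCone s ⊆ Metric.ball 0 1 := by
  rintro x ⟨r, hr, _, ⟨u, _, rfl⟩, rfl⟩
  simp [norm_smul, abs_of_pos hr.1, hr.2]

/-- The first coordinate vector as a point of the sphere. -/
def sphPole (d : ℕ) [NeZero d] : Sph d := ⟨EuclideanSpace.single 0 1, by simp⟩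

theorem inner_sphPole (x : Vec d) : ⟪x, (sphPole d : Vec d)⟫_ℝ = x 0 := by
  simp [sphPole, EuclideanSpace.inner_single_right]

theorem measurableSet_inner_mem {A : Set ℝ} (hA : MeasurableSet A) (y : Vec d) :
    MeasurableSet {u : Sph d | ⟪(u : Vec d), y⟫_ℝ ∈ A} :=
  (by fun_prop : Continuous fun u : Sph d => ⟪(u : Vec d), y⟫_ℝ).measurable hA

theorem sphMeasure_inner_congr {A : Set ℝ} (hA : MeasurableSet A) (p q : Sph d) :
    (sphMeasure d).real {u | ⟪(u : Vec d), (p : Vec d)⟫_ℝ ∈ A}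
      = (sphMeasure d).real {u | ⟪(u : Vec d), (q : Vec d)⟫_ℝ ∈ A} := by
  obtain ⟨O, rfl⟩ := exists_rot_eq p q
  have hm := measurableSet_inner_mem hA (rot O p : Vec d)
  rw [measureReal_def, measureReal_def,
    ← (measurePreserving_rot O).measure_preimage hm.nullMeasurableSet]
  simp

theorem sq_add_sq_le_norm_sq (x : Vec d) {j : Fin d} (hj : j ≠ 0) :
    x 0 ^ 2 + x j ^ 2 ≤ ‖x‖ ^ 2 := by
  rw [EuclideanSpace.real_norm_sq_eq, ← Finset.sum_pair (f := fun i => x i ^ 2) hj.symm]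
  exact Finset.sum_le_sum_of_subset_of_nonneg (Finset.subset_univ _) fun _ _ _ => sq_nonneg _

theorem norm_sq_le_of_mem_slabBox {x : Vec d} {l r ρ : ℝ} (hx : x ∈ slabBox d l r ρ) :
    ‖x‖ ^ 2 ≤ x 0 ^ 2 + d * ρ ^ 2 := by
  rw [EuclideanSpace.real_norm_sq_eq, Fintype.sum_eq_add_sum_compl 0]
  gcongr
  refine (Finset.sum_le_card_nsmul _ _ (ρ ^ 2) fun j hj => ?_).trans ?_
  · exact sq_le_sq' (abs_le.1 (hx.2 j (by simpa using hj))).1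
      (abs_le.1 (hx.2 j (by simpa using hj))).2
  · rw [nsmul_eq_mul]
    gcongr
    exact (Finset.card_le_univ _).trans (by simp)

theorem sqrt_pow_dim {h : ℝ} (hh : 0 ≤ h) : √h ^ (d - 1) = h ^ (((d : ℝ) - 1) / 2) := by
  have : 1 ≤ d := NeZero.one_le
  rw [Real.sqrt_eq_rpow, ← Real.rpow_natCast, ← Real.rpow_mul hh, Nat.cast_sub this]
  congr 1; push_cast; ring

/-- Upper bound for the measure of spherical caps. -/
theorem exists_cap_le (d : ℕ) [NeZero d] : ∃ C : ℝ, 0 < C ∧ ∀ (q : Sph d) (h : ℝ), 0 ≤ h →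
    (sphMeasure d).real {u | 1 - ⟪(u : Vec d), (q : Vec d)⟫_ℝ ≤ h}
      ≤ C * h ^ (((d : ℝ) - 1) / 2) := by
  set V := volume.real (Metric.ball (0 : Vec d) 1) with hV
  have hVp : 0 < V := volume_ball_pos
  refine ⟨2 * (2 * √2) ^ (d - 1) / V, by positivity, fun q h hh => ?_⟩
  have hset : ∀ p : Sph d, {u : Sph d | 1 - ⟪(u : Vec d), (p : Vec d)⟫_ℝ ≤ h}
      = {u : Sph d | ⟪(u : Vec d), (p : Vec d)⟫_ℝ ∈ Set.Ici (1 - h)} := by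
    intro p; ext u; simp only [Set.mem_ofPred_eq, Set.mem_Ici]; constructor <;> intro <;> linarith
  rw [hset, sphMeasure_inner_congr measurableSet_Ici q (sphPole d), sphMeasure_real_eq
    (measurableSet_inner_mem measurableSet_Ici _), ← hV]
  -- A unit vector with first coordinate at least `1 - h` has every other coordinate bounded by
  -- `√(2h)`.
  have hsub : sphCone {u : Sph d | ⟪(u : Vec d), (sphPole d : Vec d)⟫_ℝ ∈ Set.Ici (1 - h)}
      ⊆ slabBox d (-1) 1 (√(2 * h)) := by
    rintro x ⟨r, hr, _, ⟨u, hu, rfl⟩, rfl⟩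
    simp only [Set.mem_ofPred_eq, inner_sphPole, Set.mem_Ici] at hu
    have hn := norm_sph u
    have h0 : |(u : Vec d) 0| ≤ 1 := (PiLp.norm_apply_le (u : Vec d) 0).trans hn.le
    rw [abs_le] at h0
    refine ⟨?_, fun j hj => ?_⟩
    · simp only [PiLp.smul_apply, smul_eq_mul, Set.mem_Icc]
      constructor <;> nlinarith [hr.1, hr.2, h0.1, h0.2]
    · have h1 := sq_add_sq_le_norm_sq (u : Vec d) hj
      rw [hn] at h1
      have h2 : |(u : Vec d) j| ≤ √(2 * h) := by
        apply Real.abs_le_sqrt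
        nlinarith
      simp only [PiLp.smul_apply, smul_eq_mul, abs_mul, abs_of_pos hr.1]
      nlinarith [abs_nonneg ((u : Vec d) j), hr.1, hr.2]
  have := measureReal_mono hsub (volume_slabBox_ne_top _ _ _)
  rw [volume_slabBox (by norm_num) (Real.sqrt_nonneg _)] at this
  rw [div_mul_eq_mul_div]
  gcongr
  refine this.trans (le_of_eq ?_)
  rw [← sqrt_pow_dim hh, Real.sqrt_mul zero_le_two, ← mul_assoc 2 (√2), mul_pow]
  ring

/-- Lower bound for the measure of spherical caps. -/
theorem exists_le_cap (d : ℕ) [NeZero d] : ∃ c : ℝ, 0 < c ∧ ∀ (q : Sph d) (h : ℝ), 0 ≤ h → h ≤ 2 →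
    c * h ^ (((d : ℝ) - 1) / 2)
      ≤ (sphMeasure d).real {u | 1 - ⟪(u : Vec d), (q : Vec d)⟫_ℝ ≤ h} := by
  set V := volume.real (Metric.ball (0 : Vec d) 1) with hV
  have hVp : 0 < V := volume_ball_pos
  have hd : (0 : ℝ) < d := Nat.cast_pos.2 (NeZero.pos d)
  -- The half-width `√(h/(8d))` gives `‖x‖² ≤ x₀² + h/8` on the box. With `x₀ ∈ [1/4, 1/2]` this
  -- yields `‖x‖ < 1` and `x₀ ≥ (1-h)‖x‖`.
  refine ⟨1 / 4 * (2 * √(1 / (8 * d))) ^ (d - 1) / V, by positivity, fun q h hh h2 => ?_⟩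
  have hset : ∀ p : Sph d, {u : Sph d | 1 - ⟪(u : Vec d), (p : Vec d)⟫_ℝ ≤ h}
      = {u : Sph d | ⟪(u : Vec d), (p : Vec d)⟫_ℝ ∈ Set.Ici (1 - h)} := by
    intro p; ext u; simp only [Set.mem_ofPred_eq, Set.mem_Ici]; constructor <;> intro <;> linarith
  rw [hset, sphMeasure_inner_congr measurableSet_Ici q (sphPole d), sphMeasure_real_eq
    (measurableSet_inner_mem measurableSet_Ici _), ← hV]
  have hsub : slabBox d (1 / 4) (1 / 2) (√(1 / (8 * d) * h)) ⊆
      sphCone {u : Sph d | ⟪(u : Vec d), (sphPole d : Vec d)⟫_ℝ ∈ Set.Ici (1 - h)} := by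
    intro x hx
    have h1 := norm_sq_le_of_mem_slabBox hx
    rw [Real.sq_sqrt (by positivity)] at h1
    have h1' : ‖x‖ ^ 2 ≤ x 0 ^ 2 + h / 8 := by
      refine h1.trans (le_of_eq ?_); field_simp
    obtain ⟨⟨hl, hr⟩, -⟩ := hx
    have h0 : |x 0| ≤ ‖x‖ := PiLp.norm_apply_le x 0
    have h0' : x 0 ≤ ‖x‖ := (le_abs_self _).trans h0
    have hpos : 0 < ‖x‖ := by linarith
    have hlt : ‖x‖ < 1 := by nlinarith
    refine ⟨‖x‖, ⟨hpos, hlt⟩, ‖x‖⁻¹ • x, ⟨⟨‖x‖⁻¹ • x, ?_⟩, ?_, rfl⟩, ?_⟩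
    · simp [norm_smul, hpos.ne']
    · simp only [Set.mem_ofPred_eq, inner_sphPole, Set.mem_Ici, PiLp.smul_apply, smul_eq_mul]
      rw [inv_mul_eq_div, le_div_iff₀ hpos]
      nlinarith
    · simp [smul_smul, hpos.ne']
  have := measureReal_mono (μ := volume) hsub ((measure_mono (sphCone_subset_ball _)).trans_lt
    measure_ball_lt_top).ne
  rw [volume_slabBox (by norm_num) (Real.sqrt_nonneg _)] at this
  rw [div_mul_eq_mul_div]
  gcongr
  refine (le_of_eq ?_).trans this
  rw [← sqrt_pow_dim hh, Real.sqrt_mul (by positivity), ← mul_assoc 2, mul_pow (2 * _)]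
  ring

/-- Upper bound for the measure of bands around an equator. -/
theorem exists_band_le (d : ℕ) [NeZero d] : ∃ C : ℝ, 0 < C ∧ ∀ (q : Sph d) (x : ℝ), 0 ≤ x →
    (sphMeasure d).real {u | |⟪(u : Vec d), (q : Vec d)⟫_ℝ| ≤ x} ≤ C * x := by
  set V := volume.real (Metric.ball (0 : Vec d) 1) with hV
  have hVp : 0 < V := volume_ball_pos
  refine ⟨2 * 2 ^ (d - 1) / V, by positivity, fun q h hh => ?_⟩
  have hset : ∀ p : Sph d, {u : Sph d | |⟪(u : Vec d), (p : Vec d)⟫_ℝ| ≤ h}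
      = {u : Sph d | ⟪(u : Vec d), (p : Vec d)⟫_ℝ ∈ Set.Icc (-h) h} := by
    intro p; ext u; simp only [Set.mem_ofPred_eq, Set.mem_Icc, abs_le]
  rw [hset, sphMeasure_inner_congr measurableSet_Icc q (sphPole d), sphMeasure_real_eq
    (measurableSet_inner_mem measurableSet_Icc _), ← hV]
  have hsub : sphCone {u : Sph d | ⟪(u : Vec d), (sphPole d : Vec d)⟫_ℝ ∈ Set.Icc (-h) h}
      ⊆ slabBox d (-h) h 1 := by
    rintro x ⟨r, hr, _, ⟨u, hu, rfl⟩, rfl⟩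
    simp only [Set.mem_ofPred_eq, inner_sphPole, Set.mem_Icc] at hu
    refine ⟨?_, fun j hj => ?_⟩
    · simp only [PiLp.smul_apply, smul_eq_mul, Set.mem_Icc]
      constructor <;> nlinarith [hr.1, hr.2, hu.1, hu.2]
    · have h0 : |(u : Vec d) j| ≤ 1 :=
        (PiLp.norm_apply_le (u : Vec d) j).trans (norm_sph u).le
      simp only [PiLp.smul_apply, smul_eq_mul, abs_mul, abs_of_pos hr.1]
      nlinarith [abs_nonneg ((u : Vec d) j), hr.1, hr.2]
  have := measureReal_mono hsub (volume_slabBox_ne_top _ _ _)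
  rw [volume_slabBox (by linarith) zero_le_one] at this
  rw [div_mul_eq_mul_div]
  gcongr
  refine this.trans (le_of_eq ?_)
  ring

end

/-! ### Softmax weights and the bias and noise parts of the loss. -/

/-- Softmax weights. -/
def softWeight {n : ℕ} (z : Fin n → ℝ) (i : Fin n) : ℝ := Real.exp (z i) / ∑ j, Real.exp (z j)

/-- The piecewise linear function with slope one on `[0, ∞)` and slope `τ` on `(-∞, 0]`. -/
def ramp (τ z : ℝ) : ℝ := max z 0 + τ * min z 0

theorem ramp_one (z : ℝ) : ramp 1 z = z := by
  rw [ramp, one_mul, max_add_min, add_zero]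

theorem ramp_zero (z : ℝ) : ramp 0 z = max z 0 := by simp [ramp]

@[fun_prop] theorem Continuous.ramp {X : Type*} [TopologicalSpace X] {f : X → ℝ} (τ : ℝ)
    (hf : Continuous f) : Continuous fun x => ramp τ (f x) := by
  unfold SoftmaxICL.ramp; fun_prop

section softWeight
variable {n : ℕ}

theorem sum_exp_pos (z : Fin n → ℝ) (i : Fin n) : 0 < ∑ j, Real.exp (z j) :=
  Finset.sum_pos (fun _ _ => Real.exp_pos _) ⟨i, Finset.mem_univ _⟩

@[fun_prop] theorem Continuous.softWeight {X : Type*} [TopologicalSpace X] {f : X → Fin n → ℝ}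
    (hf : Continuous f) (i : Fin n) : Continuous fun x => softWeight (f x) i := by
  unfold SoftmaxICL.softWeight
  exact Continuous.div (by fun_prop) (by fun_prop) fun x => (sum_exp_pos (f x) i).ne'

theorem softWeight_pos (z : Fin n → ℝ) (i : Fin n) : 0 < softWeight z i :=
  div_pos (Real.exp_pos _) (sum_exp_pos z i)

theorem sum_softWeight [NeZero n] (z : Fin n → ℝ) : ∑ i, softWeight z i = 1 := by
  unfold softWeight
  rw [← Finset.sum_div, div_self (sum_exp_pos z 0).ne']

end softWeight

/-- The noiseless prediction error of the attention scores `⟪u i, a⟫` at the query `q`. -/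
def predErr {n : ℕ} (τ : ℝ) (a q : Vec d) (v : Sph d) (u : Fin n → Sph d) : ℝ :=
  ∑ i, softWeight (fun j => ⟪(u j : Vec d), a⟫_ℝ) i * ramp τ ⟪(v : Vec d), (u i : Vec d)⟫_ℝ
    - ramp τ ⟪(v : Vec d), q⟫_ℝ

/-- Mean squared noiseless prediction error. -/
def biasAt (τ : ℝ) (n : ℕ) (a q : Vec d) : ℝ :=
  ∫ p : Sph d × (Fin n → Sph d), predErr τ a q p.1 p.2 ^ 2 ∂((sphMeasure d).prod (sphPi d n))

/-- Mean sum of squared attention weights. -/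
def noiseAt (n : ℕ) (a : Vec d) : ℝ :=
  ∫ u : Fin n → Sph d, ∑ i, softWeight (fun j => ⟪(u j : Vec d), a⟫_ℝ) i ^ 2 ∂(sphPi d n)

/-- The loss at a given query. -/
def pointLoss (τ c s : ℝ) (n : ℕ) (a q : Vec d) : ℝ := c * biasAt τ n a q + s * noiseAt n a

/-- The loss in whitened coordinates. -/
def whiteLoss (τ c s : ℝ) (n : ℕ) (A : Vec d →ₗ[ℝ] Vec d) : ℝ :=
  ∫ q : Sph d, pointLoss τ c s n (A q) q ∂(sphMeasure d)

@[fun_prop] theorem Continuous.predErr {X : Type*} [TopologicalSpace X] {n : ℕ} (τ : ℝ)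
    {a q : X → Vec d} {v : X → Sph d} {u : X → Fin n → Sph d} (ha : Continuous a)
    (hq : Continuous q) (hv : Continuous v) (hu : Continuous u) :
    Continuous fun x => predErr τ (a x) (q x) (v x) (u x) := by
  unfold SoftmaxICL.predErr
  fun_prop

/-! ### Whitening: the loss as a bias term plus a noise term. -/

theorem integral_sq_orthogonal {ι Ω T : Type*} [Fintype ι] [MeasurableSpace Ω]
    [MeasurableSpace T] {μ : Measure Ω} {ρ : Measure T} [SFinite μ] [SFinite ρ]
    {τ : ι → T → ℝ} {Y : ι → Ω → ℝ} (hτ : ∀ i, MemLp (τ i) 2 ρ)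
    (horth : ∀ i j, i ≠ j → ∫ t, τ i t * τ j t ∂ρ = 0)
    (hY : ∀ i j, Integrable (fun ω => Y i ω * Y j ω) μ) :
    ∫ z, (∑ i, Y i z.1 * τ i z.2) ^ 2 ∂(μ.prod ρ)
      = ∑ i, (∫ t, τ i t ^ 2 ∂ρ) * ∫ ω, Y i ω ^ 2 ∂μ := by
  have e : ∀ z : Ω × T, (∑ i, Y i z.1 * τ i z.2) ^ 2
      = ∑ i, ∑ j, (Y i z.1 * Y j z.1) * (τ i z.2 * τ j z.2) := by
    intro z
    rw [sq, Finset.sum_mul_sum]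
    exact Finset.sum_congr rfl fun i _ => Finset.sum_congr rfl fun j _ => by ring
  have hint : ∀ i j, Integrable (fun z : Ω × T => (Y i z.1 * Y j z.1) * (τ i z.2 * τ j z.2))
      (μ.prod ρ) := fun i j =>
    (hY i j).mul_prod ((hτ i).integrable_mul (hτ j))
  simp_rw [e]
  rw [integral_finsetSum _ fun i _ => integrable_finsetSum _ fun j _ => hint i j]
  refine Finset.sum_congr rfl fun i _ => ?_
  rw [integral_finsetSum _ fun j _ => hint i j, Finset.sum_eq_single i]
  · rw [integral_prod_mul (fun ω => Y i ω * Y i ω) (fun t => τ i t * τ i t), mul_comm]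
    simp only [sq]
  · intro j _ hj
    rw [integral_prod_mul (fun ω => Y i ω * Y j ω) (fun t => τ i t * τ j t),
      horth i j hj.symm, mul_zero]
  · simp

/-- Passes from (query, direction, context) and (slopes, noise), the grouping in which the error
factors, to the order of integration in `iclLoss`. -/
theorem measurePreserving_regroup {A B C T E : Type*} [MeasurableSpace A] [MeasurableSpace B]
    [MeasurableSpace C] [MeasurableSpace T] [MeasurableSpace E] (a : Measure A) (b : Measure B)
    (c : Measure C) (t : Measure T) (e : Measure E) [SFinite a] [SFinite b] [SFinite c]
    [SFinite t] [SFinite e] :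
    MeasurePreserving
      (fun z : (C × A × B) × T × E => ((z.1.2.1, z.2.1), z.1.2.2, z.1.1, z.2.2))
      ((c.prod (a.prod b)).prod (t.prod e)) ((a.prod t).prod (b.prod (c.prod e))) := by
  have h1 : MeasurePreserving (fun z : C × A × B => (z.2.1, z.2.2, z.1))
      (c.prod (a.prod b)) (a.prod (b.prod c)) :=
    (measurePreserving_prodAssoc a b c).comp Measure.measurePreserving_swap
  have s1 := h1.prod (MeasurePreserving.id (t.prod e))
  have s2 := (measurePreserving_prodAssoc a (b.prod c) (t.prod e)).comp s1
  have h3 : MeasurePreserving (fun z : (B × C) × T × E => (z.2.1, z.1, z.2.2))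
      ((b.prod c).prod (t.prod e)) (t.prod ((b.prod c).prod e)) := by
    have k1 := (measurePreserving_prodAssoc (b.prod c) t e).symm
    have k2 := (Measure.measurePreserving_swap (μ := b.prod c) (ν := t)).prod
      (MeasurePreserving.id e)
    exact (measurePreserving_prodAssoc t (b.prod c) e).comp (k2.comp k1)
  have s3 := ((MeasurePreserving.id a).prod h3).comp s2
  have s4 := ((measurePreserving_prodAssoc a t ((b.prod c).prod e)).symm).comp s3
  exact ((MeasurePreserving.id (a.prod t)).prod (measurePreserving_prodAssoc b c e)).comp s4

section moments

theorem integral_unifInterval (L : ℝ) (hL : 0 < L) (f : ℝ → ℝ) :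
    ∫ x, f x ∂(unifInterval L) = (2 * L)⁻¹ * ∫ x in (-L)..L, f x := by
  rw [unifInterval, ProbabilityTheory.cond, integral_smul_measure,
    intervalIntegral.integral_of_le (by linarith), integral_Icc_eq_integral_Ioc, Real.volume_Icc,
    smul_eq_mul, ENNReal.toReal_inv, ENNReal.toReal_ofReal (by linarith)]
  ring

theorem isProbabilityMeasure_unifInterval {L : ℝ} (hL : 0 < L) :
    IsProbabilityMeasure (unifInterval L) := by
  apply ProbabilityTheory.cond_isProbabilityMeasure_of_finite
  · rw [Real.volume_Icc]; simp [hL]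
  · rw [Real.volume_Icc]; simp

theorem memLp_unifInterval {L : ℝ} (hL : 0 < L) : MemLp id 2 (unifInterval L) := by
  have := isProbabilityMeasure_unifInterval hL
  refine MemLp.of_bound (by fun_prop) L ?_
  have h : ∀ᵐ x ∂(unifInterval L), x ∈ Set.Icc (-L) L := ae_cond_mem measurableSet_Icc
  filter_upwards [h] with x hx
  simpa [abs_le] using hx

theorem integral_id_unifInterval {L : ℝ} (hL : 0 < L) : ∫ x, x ∂(unifInterval L) = 0 := by
  rw [integral_unifInterval L hL, integral_id]; ring

theorem integral_sq_unifInterval {L : ℝ} (hL : 0 < L) :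
    ∫ x, x ^ 2 ∂(unifInterval L) = L ^ 2 / 3 := by
  rw [integral_unifInterval L hL, integral_pow]
  field_simp; norm_num; ring

variable {n : ℕ} {Dε : Measure ℝ} [IsProbabilityMeasure Dε]

theorem memLp_noise (h2 : MemLp id 2 Dε) (i : Fin n) :
    MemLp (fun e : Fin n → ℝ => e i) 2 (Measure.pi fun _ => Dε) :=
  h2.comp_measurePreserving (measurePreserving_eval (fun _ : Fin n => Dε) i)

theorem integral_noise (h0 : ∫ e, e ∂Dε = 0) (i : Fin n) :
    ∫ e : Fin n → ℝ, e i ∂(Measure.pi fun _ => Dε) = 0 := by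
  rw [← h0]
  exact integral_comp_eval (μ := fun _ : Fin n => Dε) (f := fun e : ℝ => e)
    measurable_id.aestronglyMeasurable

theorem integral_noise_mul (h0 : ∫ e, e ∂Dε = 0) {i j : Fin n} (hij : i ≠ j) :
    ∫ e : Fin n → ℝ, e i * e j ∂(Measure.pi fun _ => Dε) = 0 := by
  have hi : iIndepFun (fun (i : Fin n) (e : Fin n → ℝ) => e i) (Measure.pi fun _ => Dε) :=
    iIndepFun_pi (X := fun _ : Fin n => (id : ℝ → ℝ)) fun _ => aemeasurable_id
  have := (hi.indepFun hij).integral_mul_eq_mul_integral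
    (measurable_pi_apply i).aestronglyMeasurable (measurable_pi_apply j).aestronglyMeasurable
  rw [integral_noise h0, zero_mul] at this
  exact this

theorem integral_noise_sq {σ : ℝ} (h0 : ∫ e, e ∂Dε = 0)
    (hv : variance id Dε = σ ^ 2) (i : Fin n) :
    ∫ e : Fin n → ℝ, e i ^ 2 ∂(Measure.pi fun _ => Dε) = σ ^ 2 := by
  rw [← hv, variance_of_integral_eq_zero aemeasurable_id h0]
  exact integral_comp_eval (μ := fun _ : Fin n => Dε) (f := fun e : ℝ => e ^ 2)
    (by fun_prop)

end moments

section sqrt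
variable {S : Matrix (Fin d) (Fin d) ℝ}

theorem sqrt_mul_sqrt (hS : S.PosDef) : CFC.sqrt S * CFC.sqrt S = S :=
  CFC.sqrt_mul_sqrt_self S (Matrix.nonneg_iff_posSemidef.2 hS.posSemidef)

theorem transpose_sqrt : (CFC.sqrt S)ᵀ = CFC.sqrt S := by
  have h : IsSelfAdjoint (CFC.sqrt S) := (CFC.sqrt_nonneg S).isSelfAdjoint
  have h' : (CFC.sqrt S)ᴴ = CFC.sqrt S := h
  rwa [Matrix.conjTranspose_eq_transpose_of_trivial] at h'

theorem isUnit_det_sqrt (hS : S.PosDef) : IsUnit (CFC.sqrt S).det := by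
  have h := congrArg Matrix.det (sqrt_mul_sqrt hS)
  rw [Matrix.det_mul] at h
  refine isUnit_iff_ne_zero.2 fun h0 => ?_
  rw [h0, zero_mul] at h
  exact hS.det_pos.ne h

end sqrt

theorem dotProduct_toEuclideanLin (A B M : Matrix (Fin d) (Fin d) ℝ) (x y : Vec d) :
    (Matrix.toEuclideanLin A x) ⬝ᵥ M *ᵥ (Matrix.toEuclideanLin B y)
      = ⟪x, Matrix.toEuclideanLin (Aᵀ * M * B) y⟫_ℝ := by
  rw [EuclideanSpace.inner_eq_star_dotProduct]
  simp only [Matrix.ofLp_toLpLin, Matrix.toLin'_apply, star_trivial, Matrix.mulVec_mulVec]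
  rw [dotProduct_comm _ (x.ofLp), Matrix.dotProduct_mulVec, Matrix.vecMul_mulVec,
    ← Matrix.dotProduct_mulVec, Matrix.mul_assoc]

theorem dotProduct_sqrt {S : Matrix (Fin d) (Fin d) ℝ} (hS : S.PosDef) (x y : Vec d) :
    (Matrix.toEuclideanLin (CFC.sqrt S) x) ⬝ᵥ (Matrix.toEuclideanLin (CFC.sqrt S)⁻¹ y)
      = ⟪x, y⟫_ℝ := by
  have h := dotProduct_toEuclideanLin (CFC.sqrt S) (CFC.sqrt S)⁻¹ 1 x y
  have h1 : Matrix.toEuclideanLin (1 : Matrix (Fin d) (Fin d) ℝ) y = y := by ext; simp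
  rwa [Matrix.one_mulVec, transpose_sqrt, Matrix.mul_one,
    Matrix.mul_nonsing_inv _ (isUnit_det_sqrt hS), h1] at h

/-- The whitened attention matrix `S^{-1/2} M S^{-1/2}`. -/
def whiten (S M : Matrix (Fin d) (Fin d) ℝ) : Matrix (Fin d) (Fin d) ℝ :=
  (CFC.sqrt S)⁻¹ * M * (CFC.sqrt S)⁻¹

theorem dotProduct_whiten {S : Matrix (Fin d) (Fin d) ℝ} (M : Matrix (Fin d) (Fin d) ℝ)
    (x y : Vec d) :
    (Matrix.toEuclideanLin (CFC.sqrt S)⁻¹ x) ⬝ᵥ M *ᵥ (Matrix.toEuclideanLin (CFC.sqrt S)⁻¹ y)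
      = ⟪x, Matrix.toEuclideanLin (whiten S M) y⟫_ℝ := by
  rw [dotProduct_toEuclideanLin, Matrix.transpose_nonsing_inv, transpose_sqrt, whiten]

theorem sqrt_mul_whiten_mul_sqrt {S : Matrix (Fin d) (Fin d) ℝ} (hS : S.PosDef)
    (M : Matrix (Fin d) (Fin d) ℝ) : CFC.sqrt S * whiten S M * CFC.sqrt S = M := by
  have h := isUnit_det_sqrt hS
  simp only [whiten, Matrix.mul_assoc, Matrix.nonsing_inv_mul _ h, Matrix.mul_one]
  rw [← Matrix.mul_assoc, Matrix.mul_nonsing_inv _ h, Matrix.one_mul]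

theorem whiten_sqrt_mul_mul_sqrt {S : Matrix (Fin d) (Fin d) ℝ} (hS : S.PosDef)
    (A : Matrix (Fin d) (Fin d) ℝ) : whiten S (CFC.sqrt S * A * CFC.sqrt S) = A := by
  have h := isUnit_det_sqrt hS
  simp only [whiten, Matrix.mul_assoc, Matrix.mul_nonsing_inv _ h, Matrix.mul_one]
  rw [← Matrix.mul_assoc, Matrix.nonsing_inv_mul _ h, Matrix.one_mul]

section
variable [NeZero d]

theorem measurePreserving_linearSphere (A : Matrix (Fin d) (Fin d) ℝ) :
    MeasurePreserving (fun u : Sph d => Matrix.toEuclideanLin A (u : Vec d)) (sphMeasure d)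
      (linearSphere A) := by
  have hc : Continuous fun u : Vec d => Matrix.toEuclideanLin A u :=
    LinearMap.continuous_of_finiteDimensional _
  refine ⟨(hc.comp continuous_subtype_val).measurable, ?_⟩
  rw [linearSphere, sphereUniform_eq_map, Measure.map_map hc.measurable measurable_subtype_coe]
  rfl

instance isProbabilityMeasure_linearSphere (A : Matrix (Fin d) (Fin d) ℝ) :
    IsProbabilityMeasure (linearSphere A) := by
  rw [← (measurePreserving_linearSphere A).map_eq]
  exact Measure.isProbabilityMeasure_map (measurePreserving_linearSphere A).measurable.aemeasurable

theorem continuous_dotProduct_mulVec {X : Type*} [TopologicalSpace X] {x q : X → Vec d}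
    (M : Matrix (Fin d) (Fin d) ℝ) (hx : Continuous x) (hq : Continuous q) :
    Continuous fun z => x z ⬝ᵥ M *ᵥ q z := by
  have h1 : Continuous fun z => (x z).ofLp := (PiLp.continuous_ofLp 2 _).comp hx
  have h2 : Continuous fun z => (q z).ofLp := (PiLp.continuous_ofLp 2 _).comp hq
  exact h1.dotProduct (continuous_const.matrix_mulVec h2)

/-- The geometric factors `Y` are continuous on a compact space, so square integrability is needed
only of the coefficients `c`. Orthogonality of the coefficients then removes all cross terms,
whatever the noise law. -/
theorem iclLoss_eq_sum {T ι : Type} [Fintype ι] [MeasurableSpace T] [TopologicalSpace T]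
    [BorelSpace T] [SecondCountableTopology T] {Pt : Measure T} [IsProbabilityMeasure Pt]
    {task : Vec d × T → Vec d → ℝ} (htask : Continuous fun z : (Vec d × T) × Vec d => task z.1 z.2)
    {S : Matrix (Fin d) (Fin d) ℝ} {Dε : Measure ℝ} [IsProbabilityMeasure Dε] {n : ℕ}
    {M : Matrix (Fin d) (Fin d) ℝ}
    {Y : ι → Sph d × Sph d × (Fin n → Sph d) → ℝ} {c : ι → T × (Fin n → ℝ) → ℝ}
    (hdec : ∀ (v : Sph d) (t : T) (u : Fin n → Sph d) (q : Sph d) (ε : Fin n → ℝ), softmaxPrediction M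
      (fun i => Matrix.toEuclideanLin (CFC.sqrt S)⁻¹ (u i : Vec d))
      (fun i => task (Matrix.toEuclideanLin (CFC.sqrt S) (v : Vec d), t)
        (Matrix.toEuclideanLin (CFC.sqrt S)⁻¹ (u i : Vec d)) + ε i)
      (Matrix.toEuclideanLin (CFC.sqrt S)⁻¹ (q : Vec d))
      - task (Matrix.toEuclideanLin (CFC.sqrt S) (v : Vec d), t)
        (Matrix.toEuclideanLin (CFC.sqrt S)⁻¹ (q : Vec d)) = ∑ k, Y k (q, v, u) * c k (t, ε))
    (hc : ∀ k, MemLp (c k) 2 (Pt.prod (Measure.pi fun _ => Dε)))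
    (horth : ∀ i j, i ≠ j → ∫ t, c i t * c j t ∂(Pt.prod (Measure.pi fun _ => Dε)) = 0)
    (hY : ∀ i, Continuous (Y i)) :
    iclLoss ((directionLaw S).prod Pt) task (covariateLaw S) Dε n M
      = ∑ k, (∫ t, c k t ^ 2 ∂(Pt.prod (Measure.pi fun _ => Dε))) *
        ∫ ω, Y k ω ^ 2 ∂((sphMeasure d).prod ((sphMeasure d).prod (sphPi d n))) := by
  rw [← integral_sq_orthogonal hc horth fun i j =>
    integrable_of_continuous ((hY i).mul (hY j))]
  have hx := measurePreserving_linearSphere (d := d) (CFC.sqrt S)⁻¹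
  have hv := measurePreserving_linearSphere (d := d) (CFC.sqrt S)
  have hp : MeasurePreserving (fun (u : Fin n → Sph d) i =>
      Matrix.toEuclideanLin (CFC.sqrt S)⁻¹ (u i : Vec d)) (sphPi d n)
      (Measure.pi fun _ => covariateLaw S) := measurePreserving_pi _ _ fun _ => hx
  have hmap := ((hv.prod (MeasurePreserving.id Pt)).prod
    (hp.prod (hx.prod (MeasurePreserving.id (Measure.pi fun _ : Fin n => Dε))))).comp
      (measurePreserving_regroup (sphMeasure d) (sphPi d n) (sphMeasure d) Pt
        (Measure.pi fun _ : Fin n => Dε))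
  have hmeas : Measurable fun z : (Vec d × T) × (Fin n → Vec d) × Vec d × (Fin n → ℝ) =>
      (softmaxPrediction M z.2.1 (fun i => task z.1 (z.2.1 i) + z.2.2.2 i) z.2.2.1
        - task z.1 z.2.2.1) ^ 2 := by
    have ht : ∀ {f : (Vec d × T) × (Fin n → Vec d) × Vec d × (Fin n → ℝ) → Vec d},
        Continuous f → Continuous fun z => task z.1 (f z) := fun hf =>
      htask.comp (continuous_fst.prodMk hf)
    have he : ∀ i, Continuous fun z : (Vec d × T) × (Fin n → Vec d) × Vec d × (Fin n → ℝ) =>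
        Real.exp (z.2.1 i ⬝ᵥ M *ᵥ z.2.2.1) := fun i =>
      Real.continuous_exp.comp (continuous_dotProduct_mulVec M (by fun_prop) (by fun_prop))
    refine Measurable.pow_const (Measurable.sub (Measurable.div ?_ ?_) ?_) 2
    · refine Continuous.measurable (continuous_finsetSum _ fun i _ => ?_)
      exact ((ht (by fun_prop)).add (by fun_prop)).mul (he i)
    · exact Continuous.measurable (continuous_finsetSum _ fun i _ => he i)
    · exact (ht (by fun_prop)).measurable
  rw [iclLoss, directionLaw, covariateLaw]
  have := integral_map (μ := ((sphMeasure d).prod ((sphMeasure d).prod (sphPi d n))).prod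
    (Pt.prod (Measure.pi fun _ : Fin n => Dε))) hmap.measurable.aemeasurable
    (hmeas.aestronglyMeasurable)
  rw [hmap.map_eq] at this
  refine this.trans (integral_congr_ae (Filter.Eventually.of_forall fun z => ?_))
  obtain ⟨⟨q, v, u⟩, t, ε⟩ := z
  exact congrArg (· ^ 2) (hdec v t u q ε)

end

theorem softmaxPrediction_whiten {n : ℕ} {S : Matrix (Fin d) (Fin d) ℝ}
    (M : Matrix (Fin d) (Fin d) ℝ) (x : Fin n → Vec d) (y : Fin n → ℝ) (q : Vec d) :
    softmaxPrediction M (fun i => Matrix.toEuclideanLin (CFC.sqrt S)⁻¹ (x i)) y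
      (Matrix.toEuclideanLin (CFC.sqrt S)⁻¹ q)
      = ∑ i, y i * softWeight (fun j => ⟪x j, Matrix.toEuclideanLin (whiten S M) q⟫_ℝ) i := by
  simp only [softmaxPrediction, dotProduct_whiten, softWeight, Finset.sum_div, mul_div_assoc]

section
variable [NeZero d] {n : ℕ}

theorem whiteLoss_eq (τ c s : ℝ) (A : Vec d →ₗ[ℝ] Vec d) :
    whiteLoss τ c s n A
      = c * (∫ ω : Sph d × Sph d × (Fin n → Sph d), predErr τ (A ω.1) ω.1 ω.2.1 ω.2.2 ^ 2
          ∂((sphMeasure d).prod ((sphMeasure d).prod (sphPi d n))))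
        + s * ∑ i, ∫ ω : Sph d × Sph d × (Fin n → Sph d),
          softWeight (fun j => ⟪(ω.2.2 j : Vec d), A ω.1⟫_ℝ) i ^ 2
          ∂((sphMeasure d).prod ((sphMeasure d).prod (sphPi d n))) := by
  have hA : Continuous A := LinearMap.continuous_of_finiteDimensional _
  have h1 : Integrable (fun ω : Sph d × Sph d × (Fin n → Sph d) =>
      predErr τ (A ω.1) ω.1 ω.2.1 ω.2.2 ^ 2)
      ((sphMeasure d).prod ((sphMeasure d).prod (sphPi d n))) :=
    integrable_of_continuous (by fun_prop)
  have h2 : ∀ i, Integrable (fun ω : Sph d × Sph d × (Fin n → Sph d) =>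
      softWeight (fun j => ⟪(ω.2.2 j : Vec d), A ω.1⟫_ℝ) i ^ 2)
      ((sphMeasure d).prod ((sphMeasure d).prod (sphPi d n))) := fun i =>
    integrable_of_continuous (by fun_prop)
  rw [← integral_finsetSum _ fun i _ => h2 i]
  have h3 := integrable_finsetSum Finset.univ fun i _ => h2 i
  rw [integral_prod _ h1, integral_prod _ h3, ← integral_const_mul, ← integral_const_mul,
    ← integral_add (h1.integral_prod_left.const_mul c) (h3.integral_prod_left.const_mul s)]
  refine integral_congr_ae (Filter.Eventually.of_forall fun q => ?_)
  simp only [pointLoss, biasAt, noiseAt]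
  congr 2
  have := integral_fun_snd (μ := sphMeasure d) (ν := sphPi d n)
    (f := fun u : Fin n → Sph d => ∑ i, softWeight (fun j => ⟪(u j : Vec d), A q⟫_ℝ) i ^ 2)
  simp only [probReal_univ, one_smul] at this
  exact this.symm

/-- The intercept drops out because the weights sum to one; what remains is linear in the slope and
the noises, which are uncorrelated. -/
theorem iclLoss_affine [NeZero n] {S : Matrix (Fin d) (Fin d) ℝ} (hS : S.PosDef) {L σ : ℝ}
    (hL : 0 < L) {Dε : Measure ℝ} [IsProbabilityMeasure Dε] (h2 : MemLp id 2 Dε)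
    (h0 : ∫ e, e ∂Dε = 0) (hv : variance id Dε = σ ^ 2) (M : Matrix (Fin d) (Fin d) ℝ) :
    iclLoss (affineLaw S L) affineTask (covariateLaw S) Dε n M
      = whiteLoss 1 (L ^ 2 / 3) (σ ^ 2) n (Matrix.toEuclideanLin (whiten S M)) := by
  have := isProbabilityMeasure_unifInterval hL
  set A := Matrix.toEuclideanLin (whiten S M) with hAdef
  have hA : Continuous A := LinearMap.continuous_of_finiteDimensional _
  set Pt := (unifInterval L).prod (unifInterval L) with hPt
  set Pe := Measure.pi fun _ : Fin n => Dε with hPe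
  have ht : MeasurePreserving (fun z : (ℝ × ℝ) × (Fin n → ℝ) => z.1.1) (Pt.prod Pe)
      (unifInterval L) := measurePreserving_fst.comp measurePreserving_fst
  have he : MeasurePreserving (fun z : (ℝ × ℝ) × (Fin n → ℝ) => z.2) (Pt.prod Pe) Pe :=
    measurePreserving_snd
  -- The index `none` carries the slope, `some i` the noise of the label `i`.
  rw [affineLaw, iclLoss_eq_sum (ι := Option (Fin n))
    (Y := fun k ω => k.elim (predErr 1 (A ω.1) ω.1 ω.2.1 ω.2.2)
      (softWeight (fun j => ⟪(ω.2.2 j : Vec d), A ω.1⟫_ℝ)))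
    (c := fun k z => k.elim z.1.1 z.2), whiteLoss_eq, Fintype.sum_option, Finset.mul_sum]
  · congr 1
    · congr 1
      rw [← integral_sq_unifInterval hL]
      exact integral_comp_of_continuous ht (f := fun x => x ^ 2) (by fun_prop)
    · refine Finset.sum_congr rfl fun i _ => ?_
      congr 1
      rw [← integral_noise_sq h0 hv i]
      exact integral_comp_of_continuous he (f := fun e => e i ^ 2) (by fun_prop)
  · unfold affineTask
    have h : ∀ x : ((Vec d × ℝ × ℝ) × Vec d), x.1.1.ofLp ⬝ᵥ x.2.ofLp = ⟪x.1.1, x.2⟫_ℝ := by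
      intro x; rw [EuclideanSpace.inner_eq_star_dotProduct, star_trivial, dotProduct_comm]
    simp_rw [h]
    fun_prop
  · intro v t u q ε
    rw [softmaxPrediction_whiten]
    simp only [affineTask, dotProduct_sqrt hS, Fintype.sum_option, Option.elim, predErr, ramp_one,
      ← hAdef]
    set p := softWeight fun j => ⟪(u j : Vec d), A q⟫_ℝ with hp
    have hs : ∑ i, p i = 1 := sum_softWeight _
    have e1 : ∑ i, (t.1 * ⟪(v : Vec d), (u i : Vec d)⟫_ℝ + t.2 + ε i) * p i
        = t.1 * ∑ i, p i * ⟪(v : Vec d), (u i : Vec d)⟫_ℝ + t.2 * ∑ i, p i + ∑ i, p i * ε i := by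
      rw [Finset.mul_sum, Finset.mul_sum, ← Finset.sum_add_distrib, ← Finset.sum_add_distrib]
      exact Finset.sum_congr rfl fun i _ => by ring
    rw [e1, hs]; ring
  · rintro (_ | i)
    · exact (memLp_unifInterval hL).comp_measurePreserving ht
    · exact (memLp_noise h2 i).comp_measurePreserving he
  · have hmix : ∀ i, ∫ z : (ℝ × ℝ) × (Fin n → ℝ), z.1.1 * z.2 i ∂(Pt.prod Pe) = 0 := fun i => by
      rw [integral_prod_mul (fun x : ℝ × ℝ => x.1) (fun e : Fin n → ℝ => e i), integral_noise h0,
        mul_zero]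
    rintro (_ | i) (_ | j) hij
    · exact absurd rfl hij
    · exact hmix j
    · exact (integral_congr_ae (.of_forall fun z => mul_comm _ _)).trans (hmix i)
    · have hij' : i ≠ j := fun h => hij (by rw [h])
      rw [← integral_noise_mul h0 hij']
      exact integral_comp_of_continuous he (f := fun e => e i * e j) (by fun_prop)
  · rintro (_ | i) <;> simp only [Option.elim] <;> fun_prop

theorem integral_predErr_sq_neg (τ : ℝ) {A : Vec d → Vec d} (hA : Continuous A) :
    ∫ ω : Sph d × Sph d × (Fin n → Sph d),
        predErr τ (A ω.1) ω.1 (rot (LinearIsometryEquiv.neg ℝ) ω.2.1) ω.2.2 ^ 2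
        ∂((sphMeasure d).prod ((sphMeasure d).prod (sphPi d n)))
      = ∫ ω : Sph d × Sph d × (Fin n → Sph d), predErr τ (A ω.1) ω.1 ω.2.1 ω.2.2 ^ 2
        ∂((sphMeasure d).prod ((sphMeasure d).prod (sphPi d n))) :=
  integral_comp_of_continuous ((MeasurePreserving.id _).prod
    ((measurePreserving_rot (LinearIsometryEquiv.neg ℝ)).prod (MeasurePreserving.id _)))
    (f := fun ω : Sph d × Sph d × (Fin n → Sph d) => predErr τ (A ω.1) ω.1 ω.2.1 ω.2.2 ^ 2)
    (by fun_prop)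

/-- The second piece is the first one for the direction `-v`, so both slopes meet the same mean
squared error and their variances add. -/
theorem iclLoss_relu [NeZero n] {S : Matrix (Fin d) (Fin d) ℝ} (hS : S.PosDef) {L σ : ℝ}
    (hL : 0 < L) {Dε : Measure ℝ} [IsProbabilityMeasure Dε] (h2 : MemLp id 2 Dε)
    (h0 : ∫ e, e ∂Dε = 0) (hv : variance id Dε = σ ^ 2) (M : Matrix (Fin d) (Fin d) ℝ) :
    iclLoss (reluLaw S L) reluTask (covariateLaw S) Dε n M
      = whiteLoss 0 (2 * L ^ 2 / 3) (σ ^ 2) n (Matrix.toEuclideanLin (whiten S M)) := by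
  have := isProbabilityMeasure_unifInterval hL
  set A := Matrix.toEuclideanLin (whiten S M) with hAdef
  have hA : Continuous A := LinearMap.continuous_of_finiteDimensional _
  set Pt := (unifInterval L).prod ((unifInterval L).prod (unifInterval L)) with hPt
  set Pe := Measure.pi fun _ : Fin n => Dε with hPe
  have ht1 : MeasurePreserving (fun z : (ℝ × ℝ × ℝ) × (Fin n → ℝ) => z.1.1) (Pt.prod Pe)
      (unifInterval L) := measurePreserving_fst.comp measurePreserving_fst
  have ht2 : MeasurePreserving (fun z : (ℝ × ℝ × ℝ) × (Fin n → ℝ) => z.1.2.1) (Pt.prod Pe)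
      (unifInterval L) :=
    (measurePreserving_fst.comp measurePreserving_snd).comp measurePreserving_fst
  have he : MeasurePreserving (fun z : (ℝ × ℝ × ℝ) × (Fin n → ℝ) => z.2) (Pt.prod Pe) Pe :=
    measurePreserving_snd
  rw [reluLaw, iclLoss_eq_sum (ι := Option (Option (Fin n)))
    (Y := fun k ω => k.elim (predErr 0 (A ω.1) ω.1 ω.2.1 ω.2.2) fun k' =>
      k'.elim (predErr 0 (A ω.1) ω.1 (rot (LinearIsometryEquiv.neg ℝ) ω.2.1) ω.2.2)
      (softWeight (fun j => ⟪(ω.2.2 j : Vec d), A ω.1⟫_ℝ)))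
    (c := fun k z => k.elim z.1.1 fun k' => k'.elim z.1.2.1 z.2), whiteLoss_eq,
    Fintype.sum_option, Fintype.sum_option, Finset.mul_sum, ← add_assoc]
  · congr 1
    · simp only [Option.elim]
      rw [integral_predErr_sq_neg 0 hA, ← add_mul]
      congr 1
      have e1 := integral_comp_of_continuous ht1 (f := fun x => x ^ 2) (by fun_prop)
      have e2 := integral_comp_of_continuous ht2 (f := fun x => x ^ 2) (by fun_prop)
      rw [e1, e2, integral_sq_unifInterval hL]; ring
    · refine Finset.sum_congr rfl fun i _ => ?_
      congr 1
      rw [← integral_noise_sq h0 hv i]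
      exact integral_comp_of_continuous he (f := fun e => e i ^ 2) (by fun_prop)
  · unfold reluTask
    have h : ∀ x : ((Vec d × ℝ × ℝ × ℝ) × Vec d), x.1.1.ofLp ⬝ᵥ x.2.ofLp = ⟪x.1.1, x.2⟫_ℝ := by
      intro x; rw [EuclideanSpace.inner_eq_star_dotProduct, star_trivial, dotProduct_comm]
    simp_rw [h]
    fun_prop
  · intro v t u q ε
    rw [softmaxPrediction_whiten]
    simp only [reluTask, dotProduct_sqrt hS, Fintype.sum_option, Option.elim, predErr, ramp_zero,
      coe_rot, LinearIsometryEquiv.coe_neg, inner_neg_left, ← hAdef]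
    set p := softWeight fun j => ⟪(u j : Vec d), A q⟫_ℝ with hp
    have hs : ∑ i, p i = 1 := sum_softWeight _
    have e1 : ∑ i, (t.1 * max ⟪(v : Vec d), (u i : Vec d)⟫_ℝ 0
          + t.2.1 * max (-⟪(v : Vec d), (u i : Vec d)⟫_ℝ) 0 + t.2.2 + ε i) * p i
        = t.1 * ∑ i, p i * max ⟪(v : Vec d), (u i : Vec d)⟫_ℝ 0
          + t.2.1 * ∑ i, p i * max (-⟪(v : Vec d), (u i : Vec d)⟫_ℝ) 0
          + t.2.2 * ∑ i, p i + ∑ i, p i * ε i := by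
      rw [Finset.mul_sum, Finset.mul_sum, Finset.mul_sum, ← Finset.sum_add_distrib,
        ← Finset.sum_add_distrib, ← Finset.sum_add_distrib]
      exact Finset.sum_congr rfl fun i _ => by ring
    rw [e1, hs]; ring
  · rintro (_ | _ | i)
    · exact (memLp_unifInterval hL).comp_measurePreserving ht1
    · exact (memLp_unifInterval hL).comp_measurePreserving ht2
    · exact (memLp_noise h2 i).comp_measurePreserving he
  · have hmix1 : ∀ i, ∫ z : (ℝ × ℝ × ℝ) × (Fin n → ℝ), z.1.1 * z.2 i ∂(Pt.prod Pe) = 0 := fun i => by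
      rw [integral_prod_mul (fun x : ℝ × ℝ × ℝ => x.1) (fun e : Fin n → ℝ => e i),
        integral_noise h0, mul_zero]
    have hmix2 : ∀ i, ∫ z : (ℝ × ℝ × ℝ) × (Fin n → ℝ), z.1.2.1 * z.2 i ∂(Pt.prod Pe) = 0 := by
      intro i
      rw [integral_prod_mul (fun x : ℝ × ℝ × ℝ => x.2.1) (fun e : Fin n → ℝ => e i),
        integral_noise h0, mul_zero]
    have hll : ∫ z : (ℝ × ℝ × ℝ) × (Fin n → ℝ), z.1.1 * z.1.2.1 ∂(Pt.prod Pe) = 0 := by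
      rw [integral_comp_of_continuous (measurePreserving_fst (μ := Pt) (ν := Pe))
        (f := fun t : ℝ × ℝ × ℝ => t.1 * t.2.1) (by fun_prop), hPt,
        integral_prod_mul (fun x : ℝ => x) (fun t : ℝ × ℝ => t.1), integral_id_unifInterval hL,
        zero_mul]
    rintro (_ | _ | i) (_ | _ | j) hij
    · exact absurd rfl hij
    · exact hll
    · exact hmix1 j
    · exact (integral_congr_ae (.of_forall fun z => mul_comm _ _)).trans (hll)
    · exact absurd rfl hij
    · exact hmix2 j
    · exact (integral_congr_ae (.of_forall fun z => mul_comm _ _)).trans (hmix1 i)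
    · exact (integral_congr_ae (.of_forall fun z => mul_comm _ _)).trans (hmix2 i)
    · have hij' : i ≠ j := fun h => hij (by rw [h])
      rw [← integral_noise_mul h0 hij']
      exact integral_comp_of_continuous he (f := fun e => e i * e j) (by fun_prop)
  · rintro (_ | _ | i) <;> simp only [Option.elim] <;> fun_prop

end

/-! ### Symmetry: minimizers are nonnegative multiples of the identity. -/

theorem ramp_mono {τ : ℝ} (hτ : 0 ≤ τ) : Monotone (ramp τ) := fun x y h => by
  unfold ramp; gcongr

theorem ramp_lt_one {τ x : ℝ} (hτ : 0 ≤ τ) (hx : x < 1) : ramp τ x < 1 := by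
  have h1 : max x 0 < 1 := max_lt hx one_pos
  have h2 : τ * min x 0 ≤ 0 := mul_nonpos_of_nonneg_of_nonpos hτ (min_le_right _ _)
  unfold ramp; linarith

theorem ramp_at_one (τ : ℝ) : ramp τ 1 = 1 := by simp [ramp]

section softWeight
variable {n : ℕ}

theorem softWeight_eq_div (z : Fin n → ℝ) (i : Fin n) :
    softWeight z i = Real.exp (z i) / (Real.exp (z i) + ∑ j ∈ {i}ᶜ, Real.exp (z j)) := by
  rw [softWeight, Fintype.sum_eq_add_sum_compl i]

theorem softWeight_le_of_le {z z' : Fin n → ℝ} {i : Fin n} (h : ∀ j, j ≠ i → z j = z' j)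
    (hi : z i ≤ z' i) : softWeight z i ≤ softWeight z' i := by
  have e : ∑ j ∈ {i}ᶜ, Real.exp (z j) = ∑ j ∈ {i}ᶜ, Real.exp (z' j) :=
    Finset.sum_congr rfl fun j hj => by rw [h j (by simpa using hj)]
  rw [softWeight_eq_div, softWeight_eq_div, e]
  have hT : 0 ≤ ∑ j ∈ {i}ᶜ, Real.exp (z' j) := Finset.sum_nonneg fun _ _ => (Real.exp_pos _).le
  have h1 := Real.exp_pos (z i)
  have h2 := Real.exp_le_exp.2 hi
  rw [div_le_div_iff₀ (by positivity) (by positivity)]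
  nlinarith

theorem softWeight_lt_of_lt {z z' : Fin n → ℝ} {i : Fin n} (hn : 2 ≤ n)
    (h : ∀ j, j ≠ i → z j = z' j) (hi : z i < z' i) : softWeight z i < softWeight z' i := by
  have e : ∑ j ∈ {i}ᶜ, Real.exp (z j) = ∑ j ∈ {i}ᶜ, Real.exp (z' j) :=
    Finset.sum_congr rfl fun j hj => by rw [h j (by simpa using hj)]
  rw [softWeight_eq_div, softWeight_eq_div, e]
  have hne : (({i} : Finset (Fin n))ᶜ).Nonempty := by
    rw [← Finset.card_pos, Finset.card_compl]; simp; omega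
  have hT : 0 < ∑ j ∈ {i}ᶜ, Real.exp (z' j) := Finset.sum_pos (fun _ _ => Real.exp_pos _) hne
  have h1 := Real.exp_pos (z i)
  have h2 := Real.exp_lt_exp.2 hi
  rw [div_lt_div_iff₀ (by positivity) (by positivity)]
  nlinarith

end softWeight

section
variable [NeZero d] {n : ℕ}

theorem predErr_rot (τ : ℝ) (O : Vec d ≃ₗᵢ[ℝ] Vec d) (a q : Vec d) (v : Sph d)
    (u : Fin n → Sph d) :
    predErr τ (O a) (O q) (rot O v) (fun i => rot O (u i)) = predErr τ a q v u := by
  simp only [predErr, coe_rot, LinearIsometryEquiv.inner_map_map]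

theorem biasAt_rot (τ : ℝ) (n : ℕ) (O : Vec d ≃ₗᵢ[ℝ] Vec d) (a q : Vec d) :
    biasAt τ n (O a) (O q) = biasAt τ n a q := by
  rw [biasAt, ← integral_comp_of_continuous ((measurePreserving_rot O).prod
    (measurePreserving_sphPi fun _ : Fin n => measurePreserving_rot O)) (by fun_prop)]
  simp only [Prod.map, predErr_rot]
  rfl

theorem noiseAt_rot (n : ℕ) (O : Vec d ≃ₗᵢ[ℝ] Vec d) (a : Vec d) :
    noiseAt n (O a) = noiseAt n a := by
  rw [noiseAt, ← integral_comp_of_continuous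
    (measurePreserving_sphPi fun _ : Fin n => measurePreserving_rot O) (by fun_prop)]
  simp only [coe_rot, LinearIsometryEquiv.inner_map_map]
  rfl

theorem pointLoss_rot (τ c s : ℝ) (n : ℕ) (O : Vec d ≃ₗᵢ[ℝ] Vec d) (a q : Vec d) :
    pointLoss τ c s n (O a) (O q) = pointLoss τ c s n a q := by
  rw [pointLoss, biasAt_rot, noiseAt_rot, pointLoss]

theorem pointLoss_aligned (τ c s : ℝ) (n : ℕ) (w : ℝ) (p q : Sph d) :
    pointLoss τ c s n (w • (p : Vec d)) p = pointLoss τ c s n (w • (q : Vec d)) q := by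
  obtain ⟨O, rfl⟩ := exists_rot_eq p q
  rw [coe_rot, ← map_smul, pointLoss_rot]

theorem whiteLoss_smul_id (τ c s : ℝ) (n : ℕ) (w : ℝ) (p : Sph d) :
    whiteLoss τ c s n (w • (LinearMap.id : Vec d →ₗ[ℝ] Vec d)) = pointLoss τ c s n (w • (p : Vec d)) p := by
  have : ∀ q : Sph d, pointLoss τ c s n ((w • LinearMap.id : Vec d →ₗ[ℝ] Vec d) q) q
      = pointLoss τ c s n (w • (p : Vec d)) p := fun q => pointLoss_aligned τ c s n w q p
  simp only [whiteLoss, this, integral_const, probReal_univ, one_smul]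

/-- The action of a linear isometry on a single context point. -/
def rotAt (O : Vec d ≃ₗᵢ[ℝ] Vec d) (i : Fin n) (u : Fin n → Sph d) : Fin n → Sph d :=
  fun j => (if j = i then rot O else id) (u j)

theorem rotAt_self (O : Vec d ≃ₗᵢ[ℝ] Vec d) (i : Fin n) (u : Fin n → Sph d) :
    rotAt O i u i = rot O (u i) := by simp [rotAt]

theorem rotAt_of_ne (O : Vec d ≃ₗᵢ[ℝ] Vec d) {i j : Fin n} (h : j ≠ i) (u : Fin n → Sph d) :
    rotAt O i u j = u j := by simp [rotAt, h]

@[fun_prop] theorem continuous_rotAt (O : Vec d ≃ₗᵢ[ℝ] Vec d) (i : Fin n) :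
    Continuous (rotAt O i) := by
  refine continuous_pi fun j => ?_
  by_cases h : j = i
  · simp only [rotAt, h, if_true]; fun_prop
  · simp only [rotAt, h, if_false]; fun_prop

theorem measurePreserving_rotAt (O : Vec d ≃ₗᵢ[ℝ] Vec d) (i : Fin n) :
    MeasurePreserving (rotAt O i) (sphPi d n) (sphPi d n) := by
  refine measurePreserving_sphPi (f := fun j => if j = i then rot O else id) fun j => ?_
  by_cases h : j = i
  · simp only [h, if_true]; exact measurePreserving_rot O
  · simp only [h, if_false]; exact MeasurePreserving.id _

theorem inner_lt_one {a b : Sph d} (h : a ≠ b) : ⟪(a : Vec d), (b : Vec d)⟫_ℝ < 1 := by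
  rw [inner_lt_one_iff_real_of_norm_eq_one (norm_sph a) (norm_sph b)]
  exact fun h' => h (Subtype.ext h')

/-- Average the integrand over the four maps that apply the reflection swapping `a` and `b` to the
task direction, to the context point `i`, to both or to neither. The result is a product of three
differences. With `α = ⟪a - b, u i⟫` and `β = ⟪a - b, v⟫` they have the signs of `α`, `βα` and `β`
(or vanish), so the product is nonnegative. -/
theorem cross_term_pos {τ r : ℝ} (hτ : 0 ≤ τ) (hr : 0 < r) (hn : 2 ≤ n) {a b : Sph d}
    (hab : a ≠ b) (i : Fin n) :
    0 < ∫ p : Sph d × (Fin n → Sph d),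
      softWeight (fun j => ⟪(p.2 j : Vec d), r • (a : Vec d)⟫_ℝ) i
        * ramp τ ⟪(p.1 : Vec d), (p.2 i : Vec d)⟫_ℝ
        * (ramp τ ⟪(p.1 : Vec d), (a : Vec d)⟫_ℝ - ramp τ ⟪(p.1 : Vec d), (b : Vec d)⟫_ℝ)
      ∂((sphMeasure d).prod (sphPi d n)) := by
  set μ := (sphMeasure d).prod (sphPi d n)
  set R := swapRefl (a : Vec d) (b : Vec d) with hR
  have hnorm : ‖(a : Vec d)‖ = ‖(b : Vec d)‖ := by simp
  set F : Sph d × (Fin n → Sph d) → ℝ := fun p =>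
    softWeight (fun j => ⟪(p.2 j : Vec d), r • (a : Vec d)⟫_ℝ) i
        * ramp τ ⟪(p.1 : Vec d), (p.2 i : Vec d)⟫_ℝ
        * (ramp τ ⟪(p.1 : Vec d), (a : Vec d)⟫_ℝ - ramp τ ⟪(p.1 : Vec d), (b : Vec d)⟫_ℝ) with hF
  have hFc : Continuous F := by fun_prop
  have i1 : ∫ p, F (rot R p.1, p.2) ∂μ = ∫ p, F p ∂μ :=
    integral_comp_of_continuous ((measurePreserving_rot R).prod (MeasurePreserving.id _)) hFc
  have i2 : ∫ p, F (p.1, rotAt R i p.2) ∂μ = ∫ p, F p ∂μ :=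
    integral_comp_of_continuous ((MeasurePreserving.id _).prod (measurePreserving_rotAt R i)) hFc
  have i3 : ∫ p, F (rot R p.1, rotAt R i p.2) ∂μ = ∫ p, F p ∂μ :=
    integral_comp_of_continuous ((measurePreserving_rot R).prod (measurePreserving_rotAt R i)) hFc
  set G : Sph d × (Fin n → Sph d) → ℝ := fun p =>
    F p + F (rot R p.1, p.2) + F (p.1, rotAt R i p.2) + F (rot R p.1, rotAt R i p.2) with hG
  have hGc : Continuous G := by fun_prop
  have hsum : ∫ p, G p ∂μ = 4 * ∫ p, F p ∂μ := by
    rw [hG, integral_add, integral_add, integral_add, i1, i2, i3]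
    · ring
    all_goals exact integrable_of_continuous (by fun_prop)
  have hGeq : ∀ p, G p = (softWeight (fun j => ⟪(p.2 j : Vec d), r • (a : Vec d)⟫_ℝ) i
        - softWeight (fun j => ⟪(rotAt R i p.2 j : Vec d), r • (a : Vec d)⟫_ℝ) i)
      * (ramp τ ⟪(p.1 : Vec d), (p.2 i : Vec d)⟫_ℝ - ramp τ ⟪(p.1 : Vec d), R (p.2 i : Vec d)⟫_ℝ)
      * (ramp τ ⟪(p.1 : Vec d), (a : Vec d)⟫_ℝ - ramp τ ⟪(p.1 : Vec d), (b : Vec d)⟫_ℝ) := by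
    intro p
    simp only [hG, hF, rotAt_self, coe_rot, LinearIsometryEquiv.inner_map_map]
    rw [hR, inner_swapRefl _ _ (p.1 : Vec d) (a : Vec d),
      inner_swapRefl _ _ (p.1 : Vec d) (b : Vec d), swapRefl_left hnorm, swapRefl_right hnorm,
      inner_swapRefl _ _ (p.1 : Vec d) (p.2 i : Vec d)]
    ring
  have hne : 0 < ‖(a : Vec d) - (b : Vec d)‖ ^ 2 := by
    have : (a : Vec d) - b ≠ 0 := sub_ne_zero.2 fun h => hab (Subtype.ext h)
    positivity
  have hscore : ∀ u : Fin n → Sph d, ⟪(u i : Vec d), r • (a : Vec d)⟫_ℝ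
      - ⟪(rotAt R i u i : Vec d), r • (a : Vec d)⟫_ℝ
      = r * ⟪(a : Vec d) - b, (u i : Vec d)⟫_ℝ := by
    intro u
    rw [rotAt_self, coe_rot, inner_smul_right, inner_smul_right, hR, inner_swapRefl,
      swapRefl_left hnorm, inner_sub_left, real_inner_comm (a : Vec d), real_inner_comm (b : Vec d)]
    ring
  have hG0 : ∀ p, 0 ≤ G p := by
    intro p
    rw [hGeq]
    have hα := hscore p.2
    have hβ := inner_sub_inner_swapRefl (a : Vec d) (b : Vec d) (p.1 : Vec d) (p.2 i : Vec d)
    have hγ : ⟪(p.1 : Vec d), (a : Vec d)⟫_ℝ - ⟪(p.1 : Vec d), (b : Vec d)⟫_ℝ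
        = ⟪(a : Vec d) - b, (p.1 : Vec d)⟫_ℝ := by
      rw [inner_sub_left, real_inner_comm (a : Vec d), real_inner_comm (b : Vec d)]
    rw [← hR] at hβ
    set α := ⟪(a : Vec d) - b, (p.2 i : Vec d)⟫_ℝ
    set β := ⟪(a : Vec d) - b, (p.1 : Vec d)⟫_ℝ
    have hne' : ∀ j, j ≠ i → ⟪(rotAt R i p.2 j : Vec d), r • (a : Vec d)⟫_ℝ
        = ⟪(p.2 j : Vec d), r • (a : Vec d)⟫_ℝ := fun j hj => by rw [rotAt_of_ne R hj]
    have hA : 0 ≤ α → 0 ≤ softWeight (fun j => ⟪(p.2 j : Vec d), r • (a : Vec d)⟫_ℝ) i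
        - softWeight (fun j => ⟪(rotAt R i p.2 j : Vec d), r • (a : Vec d)⟫_ℝ) i := fun h =>
      sub_nonneg.2 (softWeight_le_of_le hne' (by nlinarith))
    have hA' : α ≤ 0 → softWeight (fun j => ⟪(p.2 j : Vec d), r • (a : Vec d)⟫_ℝ) i
        - softWeight (fun j => ⟪(rotAt R i p.2 j : Vec d), r • (a : Vec d)⟫_ℝ) i ≤ 0 := fun h =>
      sub_nonpos.2 (softWeight_le_of_le (fun j hj => (hne' j hj).symm) (by nlinarith))
    have hB : 0 ≤ β * α → 0 ≤ ramp τ ⟪(p.1 : Vec d), (p.2 i : Vec d)⟫_ℝ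
        - ramp τ ⟪(p.1 : Vec d), R (p.2 i : Vec d)⟫_ℝ := fun h =>
      sub_nonneg.2 (ramp_mono hτ (by
        have : 0 ≤ 2 * (β * α) / ‖(a : Vec d) - (b : Vec d)‖ ^ 2 := by positivity
        linarith))
    have hB' : β * α ≤ 0 → ramp τ ⟪(p.1 : Vec d), (p.2 i : Vec d)⟫_ℝ
        - ramp τ ⟪(p.1 : Vec d), R (p.2 i : Vec d)⟫_ℝ ≤ 0 := fun h =>
      sub_nonpos.2 (ramp_mono hτ (by
        have : 2 * (β * α) / ‖(a : Vec d) - (b : Vec d)‖ ^ 2 ≤ 0 :=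
          div_nonpos_of_nonpos_of_nonneg (by linarith) hne.le
        linarith))
    have hC : 0 ≤ β → 0 ≤ ramp τ ⟪(p.1 : Vec d), (a : Vec d)⟫_ℝ
        - ramp τ ⟪(p.1 : Vec d), (b : Vec d)⟫_ℝ := fun h =>
      sub_nonneg.2 (ramp_mono hτ (by linarith))
    have hC' : β ≤ 0 → ramp τ ⟪(p.1 : Vec d), (a : Vec d)⟫_ℝ
        - ramp τ ⟪(p.1 : Vec d), (b : Vec d)⟫_ℝ ≤ 0 := fun h =>
      sub_nonpos.2 (ramp_mono hτ (by linarith))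
    rcases le_total 0 α with h1 | h1 <;> rcases le_total 0 β with h2 | h2
    · exact mul_nonneg (mul_nonneg (hA h1) (hB (mul_nonneg h2 h1))) (hC h2)
    · exact mul_nonneg_of_nonpos_of_nonpos (mul_nonpos_of_nonneg_of_nonpos (hA h1)
        (hB' (mul_nonpos_of_nonpos_of_nonneg h2 h1))) (hC' h2)
    · exact mul_nonneg (mul_nonneg_of_nonpos_of_nonpos (hA' h1)
        (hB' (mul_nonpos_of_nonneg_of_nonpos h2 h1))) (hC h2)
    · exact mul_nonneg_of_nonpos_of_nonpos (mul_nonpos_of_nonpos_of_nonneg (hA' h1)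
        (hB (mul_nonneg_of_nonpos_of_nonpos h2 h1))) (hC' h2)
  have hpos : 0 < ∫ p, G p ∂μ := by
    -- At this configuration all three differences are nonzero. The weight really changes only
    -- because `n ≥ 2`.
    refine integral_pos_of_continuous hGc hG0 (x := (a, fun _ => a)) ?_
    rw [hGeq]
    simp only []
    have hlt := inner_lt_one hab
    have hRa : R (a : Vec d) = b := swapRefl_left hnorm
    have h1 := ramp_lt_one hτ hlt
    rw [inner_sph_self, hRa, ramp_at_one]
    refine mul_ne_zero (mul_ne_zero (sub_ne_zero.2 (ne_of_gt ?_)) ?_) ?_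
    · refine softWeight_lt_of_lt hn (fun j hj => by rw [rotAt_of_ne R hj]) ?_
      have := hscore fun _ => a
      rw [inner_sub_left, inner_sph_self, real_inner_comm (a : Vec d) (b : Vec d)] at this
      nlinarith
    · exact (sub_pos.2 h1).ne'
    · exact (sub_pos.2 h1).ne'
  linarith

/-- On expanding the squares, the prediction is the same on both sides and the squared targets have
equal means by rotation; the difference is twice the sum of the cross terms. -/
theorem biasAt_aligned_lt {τ r : ℝ} (hτ : 0 ≤ τ) (hr : 0 < r) (hn : 2 ≤ n) {a b : Sph d}
    (hab : a ≠ b) :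
    biasAt τ n (r • (a : Vec d)) a < biasAt τ n (r • (a : Vec d)) b := by
  set μ := (sphMeasure d).prod (sphPi d n) with hμ
  have hψ : ∫ p : Sph d × (Fin n → Sph d), ramp τ ⟪(p.1 : Vec d), (b : Vec d)⟫_ℝ ^ 2
      - ramp τ ⟪(p.1 : Vec d), (a : Vec d)⟫_ℝ ^ 2 ∂μ = 0 := by
    rw [integral_sub (integrable_of_continuous (by fun_prop))
      (integrable_of_continuous (by fun_prop)), sub_eq_zero]
    have h : ∀ q : Sph d, ∫ p : Sph d × (Fin n → Sph d), ramp τ ⟪(p.1 : Vec d), (q : Vec d)⟫_ℝ ^ 2 ∂μ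
        = ∫ v : Sph d, ramp τ ⟪(v : Vec d), (q : Vec d)⟫_ℝ ^ 2 ∂(sphMeasure d) := fun q =>
      integral_comp_of_continuous measurePreserving_fst
        (f := fun v : Sph d => ramp τ ⟪(v : Vec d), (q : Vec d)⟫_ℝ ^ 2) (by fun_prop)
    rw [h, h]
    exact integral_inner_congr (f := fun t => ramp τ t ^ 2) (by fun_prop) b a
  have hdiff : biasAt τ n (r • (a : Vec d)) b - biasAt τ n (r • (a : Vec d)) a
      = 2 * ∑ i, ∫ p : Sph d × (Fin n → Sph d),
        softWeight (fun j => ⟪(p.2 j : Vec d), r • (a : Vec d)⟫_ℝ) i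
          * ramp τ ⟪(p.1 : Vec d), (p.2 i : Vec d)⟫_ℝ
          * (ramp τ ⟪(p.1 : Vec d), (a : Vec d)⟫_ℝ - ramp τ ⟪(p.1 : Vec d), (b : Vec d)⟫_ℝ) ∂μ := by
    rw [← integral_finsetSum _ fun i _ => integrable_of_continuous (by fun_prop),
      ← integral_const_mul, biasAt, biasAt,
      ← integral_sub (integrable_of_continuous (by fun_prop))
        (integrable_of_continuous (by fun_prop)), ← sub_eq_zero,
      ← integral_sub (integrable_of_continuous (by fun_prop))
        (integrable_of_continuous (by fun_prop)), ← hψ]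
    refine integral_congr_ae (Filter.Eventually.of_forall fun p => ?_)
    simp only [predErr, ← Finset.sum_mul]
    ring
  have hsum : 0 < ∑ i : Fin n, ∫ p : Sph d × (Fin n → Sph d),
        softWeight (fun j => ⟪(p.2 j : Vec d), r • (a : Vec d)⟫_ℝ) i
          * ramp τ ⟪(p.1 : Vec d), (p.2 i : Vec d)⟫_ℝ
          * (ramp τ ⟪(p.1 : Vec d), (a : Vec d)⟫_ℝ
            - ramp τ ⟪(p.1 : Vec d), (b : Vec d)⟫_ℝ) ∂μ :=
    Finset.sum_pos (fun i _ => cross_term_pos hτ hr hn hab i) ⟨⟨0, by omega⟩, Finset.mem_univ _⟩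
  linarith

theorem continuous_integral_of_continuous {X Y : Type*} [TopologicalSpace X]
    [FirstCountableTopology X] [LocallyCompactSpace X] [TopologicalSpace Y] [CompactSpace Y]
    [MeasurableSpace Y] [OpensMeasurableSpace Y] {μ : Measure Y} [IsFiniteMeasure μ]
    {f : X → Y → ℝ} (hf : Continuous (Function.uncurry f)) :
    Continuous fun x => ∫ y, f x y ∂μ := by
  simpa using continuous_parametric_integral_of_continuous (μ := μ) hf isCompact_univ

theorem continuous_pointLoss (τ c s : ℝ) (n : ℕ) :
    Continuous fun p : Vec d × Vec d => pointLoss τ c s n p.1 p.2 := by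
  unfold pointLoss biasAt noiseAt
  refine (continuous_const.mul ?_).add (continuous_const.mul ?_)
  · exact continuous_integral_of_continuous (f := fun (x : Vec d × Vec d)
      (p : Sph d × (Fin n → Sph d)) => predErr τ x.1 x.2 p.1 p.2 ^ 2)
      (by unfold Function.uncurry; fun_prop)
  · exact continuous_integral_of_continuous (f := fun (x : Vec d × Vec d) (u : Fin n → Sph d) =>
      ∑ i, softWeight (fun j => ⟪(u j : Vec d), x.1⟫_ℝ) i ^ 2)
      (by unfold Function.uncurry; fun_prop)

/-- The loss at a query is smallest when the score direction is the query. -/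
theorem pointLoss_norm_le {τ c : ℝ} (hτ : 0 ≤ τ) (hc : 0 < c) (s : ℝ) (hn : 2 ≤ n) (a : Vec d)
    (q : Sph d) : pointLoss τ c s n (‖a‖ • (q : Vec d)) q ≤ pointLoss τ c s n a q ∧
      (a ≠ ‖a‖ • (q : Vec d) →
        pointLoss τ c s n (‖a‖ • (q : Vec d)) q < pointLoss τ c s n a q) := by
  by_cases haq : a = ‖a‖ • (q : Vec d)
  · rw [← haq]; exact ⟨le_rfl, fun h => absurd rfl h⟩
  have ha0 : a ≠ 0 := by rintro rfl; simp at haq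
  have hpos : 0 < ‖a‖ := norm_pos_iff.2 ha0
  set p : Sph d := ⟨‖a‖⁻¹ • a, by simp [norm_smul, hpos.ne']⟩ with hp
  have hap : ‖a‖ • (p : Vec d) = a := by simp [hp, smul_smul, hpos.ne']
  have hpq : p ≠ q := by rintro rfl; exact haq hap.symm
  have h := biasAt_aligned_lt hτ hpos hn hpq
  have key : pointLoss τ c s n (‖a‖ • (q : Vec d)) q < pointLoss τ c s n a q := by
    -- Aligned losses agree at all queries. So fix the score vector `a` and compare the query
    -- `a/‖a‖` with `q`: the noise is unchanged, and only the bias moves.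
    rw [pointLoss_aligned τ c s n ‖a‖ q p]
    conv_rhs => rw [← hap]
    unfold pointLoss
    gcongr
  exact ⟨key.le, fun _ => key⟩

end

section
variable [NeZero d] {n : ℕ}

/-- Minimizers of the whitened loss are nonnegative multiples of the identity. -/
theorem exists_smul_id_of_isMin {τ c : ℝ} (hτ : 0 ≤ τ) (hc : 0 < c) (s : ℝ) (hn : 2 ≤ n)
    {A : Vec d →ₗ[ℝ] Vec d} (hA : ∀ B : Vec d →ₗ[ℝ] Vec d, whiteLoss τ c s n A ≤ whiteLoss τ c s n B) :
    ∃ w : ℝ, 0 ≤ w ∧ A = w • LinearMap.id := by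
  have hAc : Continuous A := LinearMap.continuous_of_finiteDimensional _
  have hGc : Continuous fun q : Sph d => pointLoss τ c s n (A q) q := by
    have hp : Continuous fun q : Sph d => ((A q, (q : Vec d)) : Vec d × Vec d) :=
      (hAc.comp continuous_subtype_val).prodMk continuous_subtype_val
    have h := continuous_pointLoss (d := d) τ c s n
    have h' := h.comp hp
    exact h'
  have h1 : ∀ q : Sph d, whiteLoss τ c s n A ≤ pointLoss τ c s n (‖A q‖ • (q : Vec d)) q := by
    intro q
    rw [← whiteLoss_smul_id]; exact hA _
  -- The loss is the average of a continuous function which by `h1` and alignment never falls below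
  -- that average.
  have h2 : ∀ q : Sph d, pointLoss τ c s n (A q) q = whiteLoss τ c s n A := by
    by_contra! hcon
    obtain ⟨q, hq⟩ := hcon
    have := integral_pos_of_continuous (μ := sphMeasure d)
      (f := fun q : Sph d => pointLoss τ c s n (A q) q - whiteLoss τ c s n A) (by fun_prop)
      (fun q => sub_nonneg.2 ((h1 q).trans (pointLoss_norm_le hτ hc s hn _ q).1))
      (sub_ne_zero.2 hq)
    rw [integral_sub (integrable_of_continuous hGc) (integrable_const _)] at this
    simp [whiteLoss] at this
  have h3 : ∀ q : Sph d, A q = ‖A q‖ • (q : Vec d) := by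
    intro q
    by_contra hq
    have := (pointLoss_norm_le hτ hc s hn _ q).2 hq
    rw [h2] at this
    exact absurd (h1 q) (not_le.2 this)
  -- By `h3` every vector is an eigenvector, so `A` is a scalar.
  obtain ⟨w, hw⟩ := LinearMap.exists_eq_smul_id_of_forall_notLinearIndependent (f := A) (by
    intro v hli
    rw [LinearIndependent.pair_iff] at hli
    by_cases hv : v = 0
    · have := hli 1 0 (by simp [hv])
      exact one_ne_zero this.1
    · have hn : ‖v‖ ≠ 0 := norm_ne_zero_iff.2 hv
      have hq := h3 ⟨‖v‖⁻¹ • v, by simp [norm_smul, hn]⟩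
      simp only [map_smul] at hq
      have hq' : A v = ‖‖v‖⁻¹ • A v‖ • v := by
        have := congrArg (fun x => ‖v‖ • x) hq
        simpa [smul_smul, hn, mul_comm, mul_assoc, mul_left_comm] using this
      have := (hli (-‖‖v‖⁻¹ • A v‖) 1 (by rw [one_smul, neg_smul, ← hq', neg_add_cancel])).2
      exact one_ne_zero this)
  refine ⟨w, ?_, hw⟩
  have hp := h3 (sphPole d)
  have : w • ((sphPole d : Sph d) : Vec d) = ‖A (sphPole d)‖ • ((sphPole d : Sph d) : Vec d) := by
    rw [← hp, hw]; rfl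
  have h4 : w = ‖A (sphPole d)‖ := by
    have := congrArg (fun x => ⟪x, ((sphPole d : Sph d) : Vec d)⟫_ℝ) this
    simpa only [real_inner_smul_left, inner_sph_self, mul_one] using this
  rw [h4]; exact norm_nonneg _

end

/-! ### Moments of i.i.d. sums, and Laplace asymptotics of the unnormalized attention weights. -/

section
variable [NeZero d] {n : ℕ}

theorem integral_sphPi_mul {f g : Sph d → ℝ} (hf : Continuous f) (hg : Continuous g)
    {i j : Fin n} (hij : i ≠ j) :
    ∫ u, f (u i) * g (u j) ∂(sphPi d n)
      = (∫ x, f x ∂(sphMeasure d)) * ∫ x, g x ∂(sphMeasure d) := by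
  have hi : iIndepFun (fun (i : Fin n) (u : Fin n → Sph d) => u i) (sphPi d n) :=
    iIndepFun_pi (X := fun _ : Fin n => (id : Sph d → Sph d)) fun _ => aemeasurable_id
  have h := ((hi.indepFun hij).comp hf.measurable hg.measurable).integral_fun_comp_mul_comp
    (f := id) (g := id) (hf.comp (continuous_apply i)).measurable.aemeasurable
    (hg.comp (continuous_apply j)).measurable.aemeasurable (by fun_prop) (by fun_prop)
  rw [← integral_sphPi_eval hf i, ← integral_sphPi_eval hg j]
  exact h

theorem integral_sum_sq_le {f : Sph d → ℝ} (hf : Continuous f) :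
    ∫ u : Fin n → Sph d, (∑ i, f (u i)) ^ 2 ∂(sphPi d n)
      ≤ n * ∫ x, f x ^ 2 ∂(sphMeasure d) + n ^ 2 * (∫ x, f x ∂(sphMeasure d)) ^ 2 := by
  have e : ∀ u : Fin n → Sph d, (∑ i, f (u i)) ^ 2 = ∑ i, ∑ j, f (u i) * f (u j) := by
    intro u; rw [sq, Finset.sum_mul_sum]
  simp_rw [e]
  rw [integral_finsetSum _ fun i _ => integrable_of_continuous (by fun_prop)]
  have h : ∀ i : Fin n, ∫ u : Fin n → Sph d, ∑ j, f (u i) * f (u j) ∂(sphPi d n)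
      ≤ ∫ x, f x ^ 2 ∂(sphMeasure d) + n * (∫ x, f x ∂(sphMeasure d)) ^ 2 := by
    intro i
    rw [integral_finsetSum _ fun j _ => integrable_of_continuous (by fun_prop),
      Fintype.sum_eq_add_sum_compl i]
    refine add_le_add ?_ ?_
    · rw [← integral_sphPi_eval (by fun_prop : Continuous fun x => f x ^ 2) i]
      simp only [sq, le_refl]
    · rw [Finset.sum_congr rfl (g := fun _ => (∫ x, f x ∂(sphMeasure d)) ^ 2), Finset.sum_const,
        nsmul_eq_mul]
      · gcongr
        exact (Finset.card_le_univ _).trans (by simp)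
      · intro j hj
        rw [integral_sphPi_mul hf hf (by simpa using fun h => (by simpa using hj : j ≠ i) h.symm),
          sq]
  refine (Finset.sum_le_sum fun i _ => h i).trans (le_of_eq ?_)
  simp only [Finset.sum_const, Finset.card_univ, Fintype.card_fin, nsmul_eq_mul]
  ring

/-- Independence of one context point from the rest; it applies to softmax weights once the own term
in the denominator is replaced by a constant. -/
theorem integral_mul_comp_sum_compl {f g : Sph d → ℝ} (hf : Continuous f) (hg : Continuous g)
    {a : ℝ → ℝ} (ha : Measurable a) (i : Fin n) :
    ∫ u : Fin n → Sph d, f (u i) * a (∑ j ∈ {i}ᶜ, g (u j)) ∂(sphPi d n)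
      = (∫ x, f x ∂(sphMeasure d)) * ∫ u : Fin n → Sph d, a (∑ j ∈ {i}ᶜ, g (u j)) ∂(sphPi d n) := by
  have hi : iIndepFun (fun (j : Fin n) (u : Fin n → Sph d) => if j = i then f (u j) else g (u j))
      (sphPi d n) := by
    refine iIndepFun_pi (X := fun (j : Fin n) x => if j = i then f x else g x) fun j => ?_
    split_ifs
    · exact hf.measurable.aemeasurable
    · exact hg.measurable.aemeasurable
  have hm : ∀ j, Measurable fun u : Fin n → Sph d => if j = i then f (u j) else g (u j) := by
    intro j
    split_ifs
    · exact (hf.comp (continuous_apply j)).measurable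
    · exact (hg.comp (continuous_apply j)).measurable
  have h1 := (hi.indepFun_finsetSum_of_notMem hm (s := {i}ᶜ) (i := i) (by simp)).symm
  have e : ∀ u : Fin n → Sph d, (∑ j ∈ ({i}ᶜ : Finset (Fin n)),
      fun u : Fin n → Sph d => if j = i then f (u j) else g (u j)) u = ∑ j ∈ {i}ᶜ, g (u j) := by
    intro u
    rw [Finset.sum_apply]
    exact Finset.sum_congr rfl fun j hj => if_neg (by simpa using hj)
  have h2 := h1.integral_fun_comp_mul_comp (f := id) (g := a) (hm i).aemeasurable
    (Finset.aemeasurable_sum _ fun j _ => (hm j).aemeasurable)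
    (by fun_prop) ha.aestronglyMeasurable
  simp only [id, if_true, e] at h2
  rw [← integral_sphPi_eval hf i]
  exact h2

theorem integral_sphPi_exp_sum {f : Sph d → ℝ} :
    ∫ u : Fin n → Sph d, Real.exp (∑ i, f (u i)) ∂(sphPi d n)
      = (∫ x, Real.exp (f x) ∂(sphMeasure d)) ^ n := by
  simp_rw [Real.exp_sum]
  rw [sphPi, integral_fintype_prod_eq_prod (f := fun _ : Fin n => fun x => Real.exp (f x))]
  simp

/-- Cauchy–Schwarz for a weighted integral. -/
theorem sq_integral_mul_le {g f : Sph d → ℝ} (hg : Continuous g) (hf : Continuous f)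
    (hg0 : ∀ x, 0 < g x) :
    (∫ x, g x * f x ∂(sphMeasure d)) ^ 2
      ≤ (∫ x, g x ∂(sphMeasure d)) * ∫ x, g x * f x ^ 2 ∂(sphMeasure d) := by
  set m := ∫ x, g x ∂(sphMeasure d) with hm
  set b := ∫ x, g x * f x ∂(sphMeasure d) with hb
  have hpos : 0 < m := integral_pos_of_continuous hg (fun x => (hg0 x).le)
    (x := Classical.arbitrary _) (hg0 _).ne'
  have h : 0 ≤ ∫ x, g x * (m * f x - b) ^ 2 ∂(sphMeasure d) :=
    integral_nonneg fun x => mul_nonneg (hg0 x).le (sq_nonneg _)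
  have e : ∀ x, g x * (m * f x - b) ^ 2
      = m ^ 2 * (g x * f x ^ 2) - 2 * m * b * (g x * f x) + b ^ 2 * g x := fun x => by ring
  simp_rw [e] at h
  rw [integral_add, integral_sub, integral_const_mul, integral_const_mul, integral_const_mul,
    ← hm, ← hb] at h
  · have : 0 ≤ m * (m * (∫ x, g x * f x ^ 2 ∂(sphMeasure d)) - b ^ 2) := by nlinarith
    linarith [nonneg_of_mul_nonneg_right this hpos]
  all_goals exact integrable_of_continuous (by fun_prop)

/-- One minus the cosine of the angle between two points of the sphere. -/
def gap (q u : Sph d) : ℝ := 1 - ⟪(u : Vec d), (q : Vec d)⟫_ℝ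

@[fun_prop] theorem continuous_gap (q : Sph d) : Continuous (gap q) := by
  unfold gap; fun_prop

theorem gap_nonneg (q u : Sph d) : 0 ≤ gap q u := by
  have := (abs_le.1 (abs_inner_sph_le u q)).2
  unfold gap; linarith

theorem gap_le_two (q u : Sph d) : gap q u ≤ 2 := by
  have := (abs_le.1 (abs_inner_sph_le u q)).1
  unfold gap; linarith

/-- The unnormalized attention weight. -/
def gibbs (w : ℝ) (q u : Sph d) : ℝ := Real.exp (-(w * gap q u))

@[fun_prop] theorem continuous_gibbs (w : ℝ) (q : Sph d) : Continuous (gibbs w q) := by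
  unfold gibbs; fun_prop

theorem gibbs_pos (w : ℝ) (q u : Sph d) : 0 < gibbs w q u := Real.exp_pos _

theorem gibbs_le_one {w : ℝ} (hw : 0 ≤ w) (q u : Sph d) : gibbs w q u ≤ 1 :=
  Real.exp_le_one_iff.2 (neg_nonpos.2 (mul_nonneg hw (gap_nonneg q u)))

/-- The mean unnormalized attention weight. -/
def gibbsMass (w : ℝ) (q : Sph d) : ℝ := ∫ u, gibbs w q u ∂(sphMeasure d)

theorem gibbsMass_pos (w : ℝ) (q : Sph d) : 0 < gibbsMass w q :=
  integral_pos_of_continuous (by fun_prop) (fun u => (gibbs_pos w q u).le) (x := q)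
    (gibbs_pos w q q).ne'

theorem gibbsMass_anti {w w' : ℝ} (h : w ≤ w') (q : Sph d) : gibbsMass w' q ≤ gibbsMass w q := by
  refine integral_mono (integrable_of_continuous (by fun_prop))
    (integrable_of_continuous (by fun_prop)) fun u => ?_
  exact Real.exp_le_exp.2 (neg_le_neg (mul_le_mul_of_nonneg_right h (gap_nonneg q u)))

theorem measurableSet_gap_le (q : Sph d) (h : ℝ) : MeasurableSet {u | gap q u ≤ h} :=
  measurableSet_le (by fun_prop) (by fun_prop)

/-- On the cap of height `1/w` the weight is at least `exp (-1)`. -/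
theorem exists_le_gibbsMass (d : ℕ) [NeZero d] : ∃ c : ℝ, 0 < c ∧ ∀ (q : Sph d) (w : ℝ), 1 ≤ w →
    c * w ^ (-(((d : ℝ) - 1) / 2)) ≤ gibbsMass w q := by
  obtain ⟨c, hc, H⟩ := exists_le_cap d
  refine ⟨Real.exp (-1) * c, by positivity, fun q w hw => ?_⟩
  have hw0 : 0 < w := by linarith
  have h1 := H q w⁻¹ (by positivity) ((inv_le_one_of_one_le₀ hw).trans (by norm_num))
  rw [Real.rpow_neg hw0.le, ← Real.inv_rpow hw0.le, mul_assoc]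
  refine (mul_le_mul_of_nonneg_left h1 (Real.exp_pos _).le).trans ?_
  have h2 : ∫ u, ({u | gap q u ≤ w⁻¹}.indicator fun _ => Real.exp (-1)) u ∂(sphMeasure d)
      ≤ gibbsMass w q := by
    refine integral_mono ((integrable_const _).indicator (measurableSet_gap_le q _))
      (integrable_of_continuous (by fun_prop)) fun u => ?_
    refine Set.indicator_le' (fun u hu => ?_) (fun u _ => (gibbs_pos w q u).le) u
    refine Real.exp_le_exp.2 (neg_le_neg ?_)
    rw [← le_inv_mul_iff₀ hw0, mul_one]
    exact hu
  rw [integral_indicator_const _ (measurableSet_gap_le q _), smul_eq_mul, mul_comm] at h2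
  exact h2

/-- Cut the sphere into the shells `j ≤ w * gap < j + 1`. Each lies in a cap of height `(j+1)/w` and
has weight at most `exp (-j)`, so polynomial growth of caps makes the sum converge. -/
theorem exists_gibbsMass_le (d : ℕ) [NeZero d] : ∃ C : ℝ, 0 < C ∧ ∀ (q : Sph d) (w : ℝ), 0 < w →
    gibbsMass w q ≤ C * w ^ (-(((d : ℝ) - 1) / 2)) := by
  obtain ⟨C, hC, H⟩ := exists_cap_le d
  set k : ℝ := ((d : ℝ) - 1) / 2 with hk
  have hd1 : (1 : ℝ) ≤ d := by exact_mod_cast NeZero.one_le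
  have hsum : Summable fun j : ℕ => ((j : ℝ) + 1) ^ d * Real.exp (-j) := by
    have h := (summable_nat_add_iff 1).2 (Real.summable_pow_mul_exp_neg_nat_mul d one_pos)
    refine (h.mul_left (Real.exp 1)).congr fun j => ?_
    push_cast
    rw [mul_left_comm, ← Real.exp_add]
    ring_nf
  set A := ∑' j : ℕ, ((j : ℝ) + 1) ^ d * Real.exp (-j) with hA
  have hA0 : 0 < A := hsum.tsum_pos (fun j => by positivity) 0 (by positivity)
  refine ⟨C * A, by positivity, fun q w hw => ?_⟩
  -- The gap is at most two, so these shells cover the sphere.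
  set J := ⌊2 * w⌋₊ + 1
  have hpt : ∀ u : Sph d, gibbs w q u ≤ ∑ j ∈ Finset.range J,
      ({u : Sph d | gap q u ≤ ((j : ℝ) + 1) / w}.indicator fun _ => Real.exp (-(j : ℝ))) u := by
    intro u
    have h0 : 0 ≤ w * gap q u := mul_nonneg hw.le (gap_nonneg q u)
    have hj : ⌊w * gap q u⌋₊ ∈ Finset.range J := by
      rw [Finset.mem_range, Nat.lt_succ_iff]
      exact Nat.floor_le_floor (by nlinarith [gap_le_two q u])
    refine le_trans ?_ (Finset.single_le_sum (f := fun j : ℕ =>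
      ({u : Sph d | gap q u ≤ ((j : ℝ) + 1) / w}.indicator fun _ => Real.exp (-(j : ℝ))) u)
      (fun j _ => Set.indicator_nonneg (fun _ _ => (Real.exp_pos _).le) u) hj)
    rw [Set.indicator_of_mem]
    · exact Real.exp_le_exp.2 (neg_le_neg (Nat.floor_le h0))
    · show gap q u ≤ _
      rw [le_div_iff₀ hw, mul_comm]
      exact (Nat.lt_floor_add_one _).le
  have hint : ∀ j : ℕ, Integrable ({u : Sph d | gap q u ≤ ((j : ℝ) + 1) / w}.indicator
      fun _ => Real.exp (-(j : ℝ))) (sphMeasure d) := fun j =>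
    (integrable_const _).indicator (measurableSet_gap_le q _)
  calc gibbsMass w q ≤ ∫ u, ∑ j ∈ Finset.range J,
      ({u : Sph d | gap q u ≤ ((j : ℝ) + 1) / w}.indicator fun _ => Real.exp (-(j : ℝ))) u
        ∂(sphMeasure d) := integral_mono (integrable_of_continuous (by fun_prop))
          (integrable_finsetSum _ fun j _ => hint j) hpt
    _ = ∑ j ∈ Finset.range J, (sphMeasure d).real {u | gap q u ≤ ((j : ℝ) + 1) / w}
        * Real.exp (-(j : ℝ)) := by
      rw [integral_finsetSum _ fun j _ => hint j]
      refine Finset.sum_congr rfl fun j _ => ?_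
      rw [integral_indicator_const _ (measurableSet_gap_le q _), smul_eq_mul]
    _ ≤ ∑ j ∈ Finset.range J, (C * w ^ (-k)) * (((j : ℝ) + 1) ^ d * Real.exp (-(j : ℝ))) := by
      refine Finset.sum_le_sum fun j _ => ?_
      have h1 := H q (((j : ℝ) + 1) / w) (by positivity)
      have h2 : (((j : ℝ) + 1) / w) ^ k ≤ w ^ (-k) * ((j : ℝ) + 1) ^ d := by
        rw [Real.div_rpow (by positivity) hw.le, Real.rpow_neg hw.le, div_eq_inv_mul]
        gcongr
        rw [← Real.rpow_natCast]
        exact Real.rpow_le_rpow_of_exponent_le (by linarith [(Nat.cast_nonneg j : (0:ℝ) ≤ j)])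
          (by rw [hk]; linarith)
      have h3 : (sphMeasure d).real {u | gap q u ≤ ((j : ℝ) + 1) / w}
          ≤ C * (w ^ (-k) * ((j : ℝ) + 1) ^ d) := h1.trans (by gcongr)
      calc _ ≤ C * (w ^ (-k) * ((j : ℝ) + 1) ^ d) * Real.exp (-(j : ℝ)) := by gcongr
        _ = _ := by ring
    _ ≤ C * A * w ^ (-k) := by
      rw [← Finset.mul_sum, mul_right_comm]
      gcongr
      exact hsum.sum_le_tsum _ fun j _ => by positivity

theorem rpow_le_exp_half {p x : ℝ} (hp0 : 0 ≤ p) (hp : p ≤ 2) (hx : 0 ≤ x) :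
    x ^ p ≤ 8 * Real.exp (x / 2) := by
  have h0 : 1 ≤ Real.exp (x / 2) := Real.one_le_exp (by positivity)
  rcases le_total x 1 with h | h
  · exact (Real.rpow_le_one hx h hp0).trans (by linarith)
  · refine (Real.rpow_le_rpow_of_exponent_le h hp).trans ?_
    rw [Real.rpow_two]
    have := Real.quadratic_le_exp_of_nonneg (by positivity : 0 ≤ x / 2)
    nlinarith

/-- Half of the exponential absorbs `(w * gap)^p`, which leaves the mass at inverse temperature
`w/2`. -/
theorem exists_gibbs_moment_le (d : ℕ) [NeZero d] : ∃ C : ℝ, 0 < C ∧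
    ∀ (q : Sph d) (p w : ℝ), 0 ≤ p → p ≤ 2 → 0 < w →
      ∫ u, gibbs w q u * gap q u ^ p ∂(sphMeasure d) ≤ C * w ^ (-p - ((d : ℝ) - 1) / 2) := by
  obtain ⟨C, hC, H⟩ := exists_gibbsMass_le d
  refine ⟨8 * C * 2 ^ (((d : ℝ) - 1) / 2), by positivity, fun q p w hp0 hp hw => ?_⟩
  have hpt : ∀ u, gibbs w q u * gap q u ^ p ≤ 8 * w ^ (-p) * gibbs (w / 2) q u := by
    intro u
    have h1 := rpow_le_exp_half hp0 hp (mul_nonneg hw.le (gap_nonneg q u))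
    rw [Real.mul_rpow hw.le (gap_nonneg q u)] at h1
    have h2 : gibbs w q u * Real.exp (w * gap q u / 2) = gibbs (w / 2) q u := by
      unfold gibbs; rw [← Real.exp_add]; ring_nf
    have h3 : w ^ (-p) * w ^ p = 1 := by rw [← Real.rpow_add hw]; simp
    calc gibbs w q u * gap q u ^ p
        = w ^ (-p) * gibbs w q u * (w ^ p * gap q u ^ p) := by
          linear_combination (-(gibbs w q u * gap q u ^ p)) * h3
      _ ≤ w ^ (-p) * gibbs w q u * (8 * Real.exp (w * gap q u / 2)) := by
          have := (gibbs_pos w q u).le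
          gcongr
      _ = _ := by rw [← h2]; ring
  have hpc : Continuous fun u : Sph d => gap q u ^ p :=
    (continuous_gap q).rpow_const fun u => Or.inr hp0
  calc _ ≤ ∫ u, 8 * w ^ (-p) * gibbs (w / 2) q u ∂(sphMeasure d) :=
        integral_mono (integrable_of_continuous (by fun_prop))
          (integrable_of_continuous (by fun_prop)) hpt
    _ = 8 * w ^ (-p) * gibbsMass (w / 2) q := integral_const_mul _ _
    _ ≤ 8 * w ^ (-p) * (C * (w / 2) ^ (-(((d : ℝ) - 1) / 2))) := by
        gcongr; exact H q _ (by positivity)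
    _ = _ := by
        rw [Real.div_rpow hw.le zero_le_two, Real.rpow_neg zero_le_two, sub_eq_add_neg (-p),
          Real.rpow_add hw]
        field_simp

end

/-! ### Upper bounds for noise and bias through concentration of the normalizer. -/

section
variable {n : ℕ} [NeZero d]

theorem softWeight_eq_gibbs (w : ℝ) (q : Sph d) (u : Fin n → Sph d) (i : Fin n) :
    softWeight (fun j => ⟪(u j : Vec d), w • (q : Vec d)⟫_ℝ) i
      = gibbs w q (u i) / ∑ j, gibbs w q (u j) := by
  have h : ∀ j, Real.exp ⟪(u j : Vec d), w • (q : Vec d)⟫_ℝ = Real.exp w * gibbs w q (u j) := by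
    intro j
    rw [gibbs, ← Real.exp_add, real_inner_smul_right, gap]
    ring_nf
  simp only [softWeight, h, ← Finset.mul_sum]
  exact mul_div_mul_left _ _ (Real.exp_pos w).ne'

theorem softWeight_le_one (z : Fin n → ℝ) (i : Fin n) : softWeight z i ≤ 1 := by
  rw [softWeight, div_le_one (sum_exp_pos z i)]
  exact Finset.single_le_sum (f := fun j => Real.exp (z j)) (fun j _ => (Real.exp_pos _).le)
    (Finset.mem_univ i)

theorem sum_softWeight_sq_le_one [NeZero n] (z : Fin n → ℝ) : ∑ i, softWeight z i ^ 2 ≤ 1 := by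
  rw [← sum_softWeight z]
  refine Finset.sum_le_sum fun i _ => ?_
  nlinarith [softWeight_pos z i, softWeight_le_one z i]

theorem abs_sum_softWeight_mul_le [NeZero n] (z : Fin n → ℝ) {x : Fin n → ℝ} {b : ℝ}
    (hx : ∀ i, |x i| ≤ b) : |∑ i, softWeight z i * x i| ≤ b := by
  refine (Finset.abs_sum_le_sum_abs _ _).trans ?_
  calc _ ≤ ∑ i, softWeight z i * b := by
        refine Finset.sum_le_sum fun i _ => ?_
        rw [abs_mul, abs_of_pos (softWeight_pos z i)]
        exact mul_le_mul_of_nonneg_left (hx i) (softWeight_pos z i).le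
    _ = b := by rw [← Finset.sum_mul, sum_softWeight, one_mul]

theorem abs_ramp_le {τ : ℝ} (h0 : 0 ≤ τ) (h1 : τ ≤ 1) (z : ℝ) : |ramp τ z| ≤ |z| := by
  unfold ramp
  rcases le_total z 0 with h | h
  · rw [max_eq_right h, min_eq_left h, zero_add, abs_mul, abs_of_nonneg h0]
    exact mul_le_of_le_one_left (abs_nonneg _) h1
  · simp [max_eq_left h, min_eq_right h]

theorem abs_ramp_sub_le {τ : ℝ} (h0 : 0 ≤ τ) (h1 : τ ≤ 1) (x y : ℝ) :
    |ramp τ x - ramp τ y| ≤ |x - y| := by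
  wlog h : y ≤ x generalizing x y
  · rw [abs_sub_comm, abs_sub_comm x]; exact this y x (le_of_not_ge h)
  rw [abs_of_nonneg (sub_nonneg.2 (ramp_mono h0 h)), abs_of_nonneg (sub_nonneg.2 h)]
  unfold ramp
  rcases le_total x 0 with hx | hx <;> rcases le_total y 0 with hy | hy <;>
    simp only [hx, hy, max_eq_left, max_eq_right, min_eq_left, min_eq_right] <;> nlinarith

theorem abs_predErr_le_two [NeZero n] {τ : ℝ} (h0 : 0 ≤ τ) (h1 : τ ≤ 1) (a : Vec d)
    (q v : Sph d) (u : Fin n → Sph d) : |predErr τ a q v u| ≤ 2 := by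
  have h : ∀ x : Sph d, |ramp τ ⟪(v : Vec d), (x : Vec d)⟫_ℝ| ≤ 1 := fun x =>
    (abs_ramp_le h0 h1 _).trans (abs_inner_sph_le v x)
  have h3 := abs_sum_softWeight_mul_le (fun j => ⟪(u j : Vec d), a⟫_ℝ) fun i => h (u i)
  have h2 := h q
  unfold predErr
  rw [abs_le] at *
  constructor <;> linarith

/-- The contribution of one context point to the unnormalized prediction error. -/
def wdev (τ w : ℝ) (q v u : Sph d) : ℝ :=
  gibbs w q u * (ramp τ ⟪(v : Vec d), (u : Vec d)⟫_ℝ - ramp τ ⟪(v : Vec d), (q : Vec d)⟫_ℝ)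

@[fun_prop] theorem Continuous.wdev {X : Type*} [TopologicalSpace X] (τ w : ℝ) (q : Sph d)
    {v u : X → Sph d} (hv : Continuous v) (hu : Continuous u) :
    Continuous fun x => wdev τ w q (v x) (u x) := by
  unfold SoftmaxICL.wdev
  have := (continuous_gibbs w q).comp hu
  simp only [Function.comp_def] at this
  fun_prop

theorem sum_gibbs_pos [NeZero n] (w : ℝ) (q : Sph d) (u : Fin n → Sph d) :
    0 < ∑ i, gibbs w q (u i) :=
  Finset.sum_pos (fun i _ => gibbs_pos w q (u i)) ⟨0, Finset.mem_univ _⟩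

theorem predErr_eq_div [NeZero n] (τ w : ℝ) (q v : Sph d) (u : Fin n → Sph d) :
    predErr τ (w • (q : Vec d)) q v u
      = (∑ i, wdev τ w q v (u i)) / ∑ i, gibbs w q (u i) := by
  have hs := (sum_gibbs_pos w q u).ne'
  simp only [predErr, softWeight_eq_gibbs, wdev, mul_sub, Finset.sum_sub_distrib, ← Finset.sum_mul,
    sub_div]
  rw [mul_div_right_comm, div_self hs, one_mul, Finset.sum_div]
  congr 1
  exact Finset.sum_congr rfl fun i _ => by ring

/-- A quotient is controlled by the quotient with a typical denominator, up to a term that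
is exponentially small when the denominator is concentrated. -/
theorem div_sq_le_exp_add {x D N b : ℝ} (hD : 0 < D) (hN : 0 < N) (hx : 0 ≤ x)
    (hb : x / D ^ 2 ≤ b) (hb0 : 0 ≤ b) :
    x / D ^ 2 ≤ b * Real.exp ((N / 2 - D) / 4) + 4 * x / N ^ 2 := by
  rcases le_total D (N / 2) with h | h
  · have h1 : 1 ≤ Real.exp ((N / 2 - D) / 4) := Real.one_le_exp (by linarith)
    have h2 : 0 ≤ 4 * x / N ^ 2 := by positivity
    nlinarith
  · have h2 : x / D ^ 2 ≤ 4 * x / N ^ 2 := by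
      rw [div_le_div_iff₀ (by positivity) (by positivity)]
      have : N ^ 2 ≤ 4 * D ^ 2 := by nlinarith
      nlinarith
    have := mul_nonneg hb0 (Real.exp_pos ((N / 2 - D) / 4)).le
    linarith

/-- Exponential bound for the lower tail of the normalizing sum. -/
theorem integral_exp_gibbs_le {w : ℝ} (hw : 0 ≤ w) (q : Sph d) (n : ℕ) :
    ∫ u : Fin n → Sph d, Real.exp ((n * gibbsMass w q / 2 - ∑ i, gibbs w q (u i)) / 4) ∂(sphPi d n)
      ≤ Real.exp (-(n * gibbsMass w q / 16)) := by
  set m := gibbsMass w q with hm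
  have e : ∀ u : Fin n → Sph d, Real.exp ((n * m / 2 - ∑ i, gibbs w q (u i)) / 4)
      = Real.exp (n * m / 8) * Real.exp (∑ i, -(gibbs w q (u i) / 4)) := by
    intro u
    rw [← Real.exp_add, Finset.sum_neg_distrib, ← Finset.sum_div]; ring_nf
  simp_rw [e]
  rw [integral_const_mul, integral_sphPi_exp_sum (f := fun u => -(gibbs w q u / 4))]
  have h1 : ∫ u, Real.exp (-(gibbs w q u / 4)) ∂(sphMeasure d) ≤ Real.exp (-(3 * m / 16)) := by
    -- From `exp (-t) ≤ 1 - t + t²` at `t = g/4`, with `g² ≤ g`. The final exponent is `1/8 - 3/16 =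
    -- -1/16` times `n * m`.
    have hpt : ∀ u, Real.exp (-(gibbs w q u / 4)) ≤ 1 - 3 / 16 * gibbs w q u := by
      intro u
      have g0 := gibbs_pos w q u
      have g1 := gibbs_le_one hw q u
      have := (abs_le.1 (Real.abs_exp_sub_one_sub_id_le (x := -(gibbs w q u / 4))
        (by rw [abs_neg, abs_of_pos (by positivity)]; linarith))).2
      nlinarith
    calc _ ≤ ∫ u, 1 - 3 / 16 * gibbs w q u ∂(sphMeasure d) :=
          integral_mono (integrable_of_continuous (by fun_prop))
            (integrable_of_continuous (by fun_prop)) hpt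
      _ = 1 - 3 / 16 * m := by
          rw [integral_sub (integrable_const _) (integrable_of_continuous (by fun_prop)),
            integral_const_mul]
          simp [hm, gibbsMass]
      _ ≤ _ := by
          have := Real.add_one_le_exp (-(3 * m / 16))
          linarith
  calc _ ≤ Real.exp (n * m / 8) * Real.exp (-(3 * m / 16)) ^ n := by
        gcongr
    _ = _ := by
        rw [← Real.exp_nat_mul, ← Real.exp_add]; ring_nf

/-- When the normalizer is at least half its mean `n * m`, the bound `g² ≤ g` gives order `1/(n *
m)`; otherwise the sum of squares is at most one and the tail is exponentially small. The constant
is `16 + 4`. -/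
theorem noiseAt_le [NeZero n] {w : ℝ} (hw : 0 ≤ w) (q : Sph d) :
    noiseAt n (w • (q : Vec d)) ≤ 20 / (n * gibbsMass w q) := by
  set m := gibbsMass w q with hm
  have hm0 : 0 < m := gibbsMass_pos w q
  have hn : (0 : ℝ) < n := Nat.cast_pos.2 (NeZero.pos n)
  have hpt : ∀ u : Fin n → Sph d,
      ∑ i, softWeight (fun j => ⟪(u j : Vec d), w • (q : Vec d)⟫_ℝ) i ^ 2
      ≤ 1 * Real.exp ((n * m / 2 - ∑ i, gibbs w q (u i)) / 4)
        + 4 * (∑ i, gibbs w q (u i)) / (n * m) ^ 2 := by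
    intro u
    have h1 := sum_softWeight_sq_le_one fun j => ⟪(u j : Vec d), w • (q : Vec d)⟫_ℝ
    have e : ∑ i, softWeight (fun j => ⟪(u j : Vec d), w • (q : Vec d)⟫_ℝ) i ^ 2
        = (∑ i, gibbs w q (u i) ^ 2) / (∑ i, gibbs w q (u i)) ^ 2 := by
      simp only [softWeight_eq_gibbs, div_pow, Finset.sum_div]
    rw [e] at h1 ⊢
    refine (div_sq_le_exp_add (sum_gibbs_pos w q u) (mul_pos hn hm0)
      (Finset.sum_nonneg fun i _ => sq_nonneg _) h1 zero_le_one).trans ?_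
    gcongr with i
    nlinarith [gibbs_pos w q (u i), gibbs_le_one hw q (u i)]
  have h2 : noiseAt n (w • (q : Vec d)) ≤ Real.exp (-(n * m / 16)) + 4 * (n * m) / (n * m) ^ 2 := by
    calc _ ≤ ∫ u : Fin n → Sph d, (1 * Real.exp ((n * m / 2 - ∑ i, gibbs w q (u i)) / 4)
        + 4 * (∑ i, gibbs w q (u i)) / (n * m) ^ 2) ∂(sphPi d n) :=
          integral_mono (integrable_of_continuous (by fun_prop))
            (integrable_of_continuous (by fun_prop)) hpt
      _ ≤ _ := by
          rw [integral_add (integrable_of_continuous (by fun_prop))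
            (integrable_of_continuous (by fun_prop)), integral_const_mul, one_mul,
            integral_div, integral_const_mul, integral_finsetSum _ fun i _ =>
            integrable_of_continuous (by fun_prop),
            Finset.sum_congr rfl fun i _ => integral_sphPi_eval (continuous_gibbs w q) i]
          have := integral_exp_gibbs_le hw q n
          simp only [Finset.sum_const, Finset.card_univ, Fintype.card_fin, nsmul_eq_mul]
          exact add_le_add this le_rfl
  refine h2.trans ?_
  have hN : 0 < n * m := by positivity
  have h3 : Real.exp (-(n * m / 16)) ≤ 16 / (n * m) := by
    rw [Real.exp_neg, ← inv_div (n * m) 16]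
    refine inv_anti₀ (by positivity : (0 : ℝ) < n * m / 16) ?_
    have := Real.add_one_le_exp (n * m / 16)
    linarith
  have h4 : 4 * (n * m) / (n * m) ^ 2 = 4 / (n * m) := by field_simp
  rw [h4]
  refine (add_le_add h3 le_rfl).trans (le_of_eq ?_)
  rw [← add_div]; norm_num

theorem sq_inner_sub_le (q u v : Sph d) :
    (⟪(v : Vec d), (u : Vec d)⟫_ℝ - ⟪(v : Vec d), (q : Vec d)⟫_ℝ) ^ 2 ≤ 2 * gap q u := by
  rw [← inner_sub_right]
  have h := abs_real_inner_le_norm (v : Vec d) ((u : Vec d) - q)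
  rw [norm_sph, one_mul] at h
  rw [← sq_abs]
  have h2 : ‖(u : Vec d) - q‖ ^ 2 = 2 * gap q u := by
    rw [norm_sub_sq_real, norm_sph, norm_sph, gap]; ring
  rw [← h2]
  gcongr

/-- The three terms come from an atypically small normalizer, from the sampling variance of the
numerator, and from its mean. The ramp is 1-Lipschitz, so a squared deviation is at most `2 * gap`.
-/
theorem biasAt_le [NeZero n] {τ w : ℝ} (h0 : 0 ≤ τ) (h1 : τ ≤ 1) (hw : 0 ≤ w) (q : Sph d) :
    biasAt τ n (w • (q : Vec d)) q ≤ 4 * Real.exp (-(n * gibbsMass w q / 16))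
      + 8 * (∫ u, gibbs w q u * gap q u ∂(sphMeasure d)) / (n * gibbsMass w q ^ 2)
      + 4 * (∫ v, (∫ u, wdev τ w q v u ∂(sphMeasure d)) ^ 2 ∂(sphMeasure d)) / gibbsMass w q ^ 2
      := by
  set m := gibbsMass w q with hm
  have hm0 : 0 < m := gibbsMass_pos w q
  have hn : (0 : ℝ) < n := Nat.cast_pos.2 (NeZero.pos n)
  have hpt : ∀ p : Sph d × (Fin n → Sph d), predErr τ (w • (q : Vec d)) q p.1 p.2 ^ 2
      ≤ 4 * Real.exp ((n * m / 2 - ∑ i, gibbs w q (p.2 i)) / 4)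
        + 4 * (∑ i, wdev τ w q p.1 (p.2 i)) ^ 2 / (n * m) ^ 2 := by
    intro p
    have h2 : predErr τ (w • (q : Vec d)) q p.1 p.2 ^ 2 ≤ 4 := by
      have := abs_predErr_le_two h0 h1 (w • (q : Vec d)) q p.1 p.2
      rw [← sq_abs]; nlinarith [abs_nonneg (predErr τ (w • (q : Vec d)) q p.1 p.2)]
    rw [predErr_eq_div, div_pow] at h2 ⊢
    exact div_sq_le_exp_add (sum_gibbs_pos w q p.2) (mul_pos hn hm0) (sq_nonneg _) h2 (by norm_num)
  have hE : ∫ p : Sph d × (Fin n → Sph d),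
      Real.exp ((n * m / 2 - ∑ i, gibbs w q (p.2 i)) / 4) ∂((sphMeasure d).prod (sphPi d n))
      ≤ Real.exp (-(n * m / 16)) := by
    rw [integral_comp_of_continuous measurePreserving_snd (f := fun u : Fin n → Sph d =>
      Real.exp ((n * m / 2 - ∑ i, gibbs w q (u i)) / 4)) (by fun_prop)]
    exact integral_exp_gibbs_le hw q n
  have hc1 : Continuous fun v : Sph d => ∫ u, wdev τ w q v u ∂(sphMeasure d) :=
    continuous_integral_of_continuous (f := fun v u : Sph d => wdev τ w q v u)
      (by unfold Function.uncurry; fun_prop)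
  have hin : ∀ v : Sph d, ∫ u : Fin n → Sph d, (∑ i, wdev τ w q v (u i)) ^ 2 ∂(sphPi d n)
      ≤ n * (2 * ∫ u, gibbs w q u * gap q u ∂(sphMeasure d))
        + n ^ 2 * (∫ u, wdev τ w q v u ∂(sphMeasure d)) ^ 2 := by
    intro v
    refine (integral_sum_sq_le (f := wdev τ w q v)
      (by fun_prop : Continuous fun u => wdev τ w q v u)).trans ?_
    gcongr
    rw [← integral_const_mul]
    refine integral_mono (integrable_of_continuous (by fun_prop))
      (integrable_of_continuous (by fun_prop)) fun u => ?_
    have a1 := sq_inner_sub_le q u v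
    have a2 := abs_ramp_sub_le h0 h1 ⟪(v : Vec d), (u : Vec d)⟫_ℝ ⟪(v : Vec d), (q : Vec d)⟫_ℝ
    have a3 := gibbs_pos w q u
    have a4 := gibbs_le_one hw q u
    have a5 : (ramp τ ⟪(v : Vec d), (u : Vec d)⟫_ℝ - ramp τ ⟪(v : Vec d), (q : Vec d)⟫_ℝ) ^ 2
        ≤ 2 * gap q u := (sq_le_sq.2 a2).trans a1
    have a6 := gap_nonneg q u
    simp only [wdev, mul_pow]
    calc _ ≤ gibbs w q u * (2 * gap q u) := by
          gcongr
          nlinarith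
      _ = _ := by ring
  have hQ : ∫ p : Sph d × (Fin n → Sph d), (∑ i, wdev τ w q p.1 (p.2 i)) ^ 2
        ∂((sphMeasure d).prod (sphPi d n))
      ≤ n * (2 * ∫ u, gibbs w q u * gap q u ∂(sphMeasure d))
        + n ^ 2 * ∫ v, (∫ u, wdev τ w q v u ∂(sphMeasure d)) ^ 2 ∂(sphMeasure d) := by
    have hI : Integrable (fun p : Sph d × (Fin n → Sph d) => (∑ i, wdev τ w q p.1 (p.2 i)) ^ 2)
      ((sphMeasure d).prod (sphPi d n)) := integrable_of_continuous (by fun_prop)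
    rw [integral_prod _ hI]
    refine (integral_mono hI.integral_prod_left (integrable_of_continuous (by fun_prop))
      hin).trans (le_of_eq ?_)
    rw [integral_add (integrable_const _) (integrable_of_continuous (by fun_prop)),
      integral_const, probReal_univ, one_smul, integral_const_mul]
  calc biasAt τ n (w • (q : Vec d)) q
      ≤ ∫ p : Sph d × (Fin n → Sph d), (4 * Real.exp ((n * m / 2 - ∑ i, gibbs w q (p.2 i)) / 4)
        + 4 * (∑ i, wdev τ w q p.1 (p.2 i)) ^ 2 / (n * m) ^ 2)
          ∂((sphMeasure d).prod (sphPi d n)) :=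
        integral_mono (integrable_of_continuous (by fun_prop))
          (integrable_of_continuous (by fun_prop)) hpt
    _ = 4 * (∫ p : Sph d × (Fin n → Sph d),
      Real.exp ((n * m / 2 - ∑ i, gibbs w q (p.2 i)) / 4) ∂((sphMeasure d).prod (sphPi d n)))
        + 4 * (∫ p : Sph d × (Fin n → Sph d), (∑ i, wdev τ w q p.1 (p.2 i)) ^ 2
        ∂((sphMeasure d).prod (sphPi d n))) / (n * m) ^ 2 := by
        rw [integral_add (integrable_of_continuous (by fun_prop))
            (integrable_of_continuous (by fun_prop)), integral_const_mul, integral_div,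
            integral_const_mul]
    _ ≤ 4 * Real.exp (-(n * m / 16))
        + 4 * (n * (2 * ∫ u, gibbs w q u * gap q u ∂(sphMeasure d))
        + n ^ 2 * ∫ v, (∫ u, wdev τ w q v u ∂(sphMeasure d)) ^ 2 ∂(sphMeasure d)) / (n * m) ^ 2 := by
        gcongr
    _ = _ := by field_simp; ring

end

/-! ### The mean deviation of the attended labels, affine and ReLU. -/

section
variable {n : ℕ} [NeZero d]

/-- The weight is symmetric about the axis `q`, so reflecting in the component of `v` orthogonal to
`q` kills its contribution. Only a deviation of order `gap` survives, not `√gap`. -/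
theorem integral_gibbs_mul_inner (w : ℝ) (q v : Sph d) :
    ∫ u, gibbs w q u * (⟪(v : Vec d), (u : Vec d)⟫_ℝ - ⟪(v : Vec d), (q : Vec d)⟫_ℝ) ∂(sphMeasure d)
      = -(⟪(v : Vec d), (q : Vec d)⟫_ℝ * ∫ u, gibbs w q u * gap q u ∂(sphMeasure d)) := by
  set x : Vec d := (v : Vec d) - ⟪(v : Vec d), (q : Vec d)⟫_ℝ • (q : Vec d) with hx
  have hxq : ⟪x, (q : Vec d)⟫_ℝ = 0 := by
    rw [hx, inner_sub_left, real_inner_smul_left, inner_sph_self, mul_one, sub_self]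
  set O : Vec d ≃ₗᵢ[ℝ] Vec d := (ℝ ∙ x)ᗮ.reflection with hO
  have hOx : O x = -x := Submodule.reflection_orthogonalComplement_singleton_eq_neg x
  have hOq : O (q : Vec d) = q := by
    refine Submodule.reflection_mem_subspace_eq_self ?_
    rw [Submodule.mem_orthogonal_singleton_iff_inner_right]
    exact hxq
  have hflip : ∫ u, gibbs w q u * ⟪x, (u : Vec d)⟫_ℝ ∂(sphMeasure d) = 0 := by
    have h := integral_rot (f := fun u : Sph d => gibbs w q u * ⟪x, (u : Vec d)⟫_ℝ)
      (by fun_prop) O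
    have e : ∀ u : Sph d, gibbs w q (rot O u) * ⟪x, (rot O u : Vec d)⟫_ℝ
        = -(gibbs w q u * ⟪x, (u : Vec d)⟫_ℝ) := by
      intro u
      have h1 : ⟪O (u : Vec d), (q : Vec d)⟫_ℝ = ⟪(u : Vec d), (q : Vec d)⟫_ℝ := by
        conv_lhs => rw [← hOq]
        exact O.inner_map_map _ _
      have h2 : ⟪x, O (u : Vec d)⟫_ℝ = -⟪x, (u : Vec d)⟫_ℝ := by
        have := O.inner_map_map x (u : Vec d)
        rw [hOx, inner_neg_left] at this
        linarith
      rw [gibbs, gibbs, gap, gap, coe_rot, h1, h2]; ring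
    simp_rw [e, integral_neg] at h
    linarith
  have e : ∀ u : Sph d, gibbs w q u * (⟪(v : Vec d), (u : Vec d)⟫_ℝ - ⟪(v : Vec d), (q : Vec d)⟫_ℝ)
      = gibbs w q u * ⟪x, (u : Vec d)⟫_ℝ
        - ⟪(v : Vec d), (q : Vec d)⟫_ℝ * (gibbs w q u * gap q u) := by
    intro u
    rw [hx, inner_sub_left, real_inner_smul_left, gap, real_inner_comm (u : Vec d) (q : Vec d)]
    ring
  simp_rw [e]
  rw [integral_sub (integrable_of_continuous (by fun_prop))
    (integrable_of_continuous (by fun_prop)), hflip, integral_const_mul, zero_sub]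

theorem sq_integral_gibbs_mul_inner_le (w : ℝ) (q v : Sph d) :
    (∫ u, gibbs w q u * (⟪(v : Vec d), (u : Vec d)⟫_ℝ - ⟪(v : Vec d), (q : Vec d)⟫_ℝ)
      ∂(sphMeasure d)) ^ 2 ≤ (∫ u, gibbs w q u * gap q u ∂(sphMeasure d)) ^ 2 := by
  rw [integral_gibbs_mul_inner, neg_sq, mul_pow]
  refine mul_le_of_le_one_left (sq_nonneg _) ?_
  rw [← sq_abs]
  exact pow_le_one₀ (abs_nonneg _) (abs_inner_sph_le v q)

/-- Mean square of the expected deviation, affine case. -/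
theorem exists_mean_wdev_one_le (d : ℕ) [NeZero d] : ∃ C : ℝ, 0 < C ∧ ∀ (q : Sph d) (w : ℝ),
    0 < w → ∫ v, (∫ u, wdev 1 w q v u ∂(sphMeasure d)) ^ 2 ∂(sphMeasure d)
      ≤ C * w ^ (-2 - 2 * (((d : ℝ) - 1) / 2)) := by
  obtain ⟨C, hC, H⟩ := exists_gibbs_moment_le d
  refine ⟨C ^ 2, by positivity, fun q w hw => ?_⟩
  have h1 := H q 1 w zero_le_one (by norm_num) hw
  simp only [Real.rpow_one] at h1
  have h2 : 0 ≤ ∫ u, gibbs w q u * gap q u ∂(sphMeasure d) :=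
    integral_nonneg fun u => mul_nonneg (gibbs_pos w q u).le (gap_nonneg q u)
  calc _ ≤ ∫ v, (C * w ^ (-1 - ((d : ℝ) - 1) / 2)) ^ 2 ∂(sphMeasure d) := by
        refine integral_mono_of_nonneg (Filter.Eventually.of_forall fun v => sq_nonneg _)
          (integrable_const _) (Filter.Eventually.of_forall fun v => ?_)
        simp only [wdev, ramp_one]
        exact (sq_integral_gibbs_mul_inner_le w q v).trans (by gcongr)
    _ = _ := by
        rw [integral_const, probReal_univ, one_smul, mul_pow, ← Real.rpow_mul_natCast hw.le]
        congr 2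
        push_cast; ring

/-- The integrand is at most `2s` and lives on a band of half-width `√(2s)`, whose measure is
`O(√s)`. -/
theorem integral_slab_le {C : ℝ} (q : Sph d)
    (H : ∀ x : ℝ, 0 ≤ x → (sphMeasure d).real {u | |⟪(u : Vec d), (q : Vec d)⟫_ℝ| ≤ x} ≤ C * x)
    {s : ℝ} (hs : 0 ≤ s) :
    ∫ v : Sph d, max 0 (2 * s - ⟪(v : Vec d), (q : Vec d)⟫_ℝ ^ 2) ∂(sphMeasure d)
      ≤ 4 * C * s ^ (3 / 2 : ℝ) := by
  have hm : MeasurableSet {u : Sph d | |⟪(u : Vec d), (q : Vec d)⟫_ℝ| ≤ √(2 * s)} :=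
    measurableSet_le (by fun_prop) (by fun_prop)
  have hC : 0 ≤ C := by
    have := measureReal_nonneg.trans (H 1 zero_le_one)
    linarith
  calc _ ≤ ∫ v : Sph d, ({u : Sph d | |⟪(u : Vec d), (q : Vec d)⟫_ℝ| ≤ √(2 * s)}.indicator
        fun _ => 2 * s) v ∂(sphMeasure d) := by
        refine integral_mono (integrable_of_continuous (by fun_prop))
          ((integrable_const _).indicator hm) fun v => ?_
        by_cases hv : |⟪(v : Vec d), (q : Vec d)⟫_ℝ| ≤ √(2 * s)
        · rw [Set.indicator_of_mem (by exact hv)]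
          exact max_le (by positivity) (by nlinarith [sq_nonneg ⟪(v : Vec d), (q : Vec d)⟫_ℝ])
        · rw [Set.indicator_of_notMem (by exact hv)]
          refine max_le le_rfl ?_
          have hv' := not_le.1 hv
          rw [Real.sqrt_lt' ((Real.sqrt_nonneg _).trans_lt hv'), sq_abs] at hv'
          linarith
    _ = (sphMeasure d).real {u | |⟪(u : Vec d), (q : Vec d)⟫_ℝ| ≤ √(2 * s)} * (2 * s) := by
        rw [integral_indicator_const _ hm, smul_eq_mul]
    _ ≤ C * √(2 * s) * (2 * s) := by gcongr; exact H _ (Real.sqrt_nonneg _)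
    _ ≤ C * (2 * √s) * (2 * s) := by
        gcongr
        rw [Real.sqrt_le_left (by positivity), mul_pow, Real.sq_sqrt hs]
        linarith
    _ = 4 * C * s ^ (3 / 2 : ℝ) := by
        rw [show (3 / 2 : ℝ) = 1 / 2 + 1 by norm_num, Real.rpow_add' hs (by norm_num),
          Real.rpow_one, Real.sqrt_eq_rpow]
        ring

/-- Near the query the ReLU is linear, and its linear part is handled as in the affine case. The
remainder vanishes unless the context point lies across the kink, which forces `y² ≤ 2 * gap`;
Cauchy–Schwarz bounds its mean. -/
theorem sq_mean_wdev_zero_le (w : ℝ) (q v : Sph d) :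
    (∫ u, wdev 0 w q v u ∂(sphMeasure d)) ^ 2
      ≤ 2 * (∫ u, gibbs w q u * gap q u ∂(sphMeasure d)) ^ 2
        + 2 * (gibbsMass w q * ∫ u, gibbs w q u
          * max 0 (2 * gap q u - ⟪(v : Vec d), (q : Vec d)⟫_ℝ ^ 2) ∂(sphMeasure d)) := by
  set y := ⟪(v : Vec d), (q : Vec d)⟫_ℝ with hy
  -- Here `κ` is the slope of the ReLU on the side of `y`, and `ρ` the correction on the other side.
  obtain ⟨κ, ρ, hκ, hρc, hdec, hρ⟩ : ∃ (κ : ℝ) (ρ : ℝ → ℝ), κ ^ 2 ≤ 1 ∧ Continuous ρ ∧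
      (∀ z, max z 0 - max y 0 = κ * (z - y) + ρ z) ∧ ∀ z, ρ z ^ 2 ≤ max 0 ((z - y) ^ 2 - y ^ 2) := by
    rcases le_total y 0 with h | h
    · refine ⟨0, fun z => max z 0, by norm_num, by fun_prop, fun z => ?_, fun z => ?_⟩
      · rw [max_eq_right h]; ring
      · beta_reduce
        rcases le_total z 0 with hz | hz
        · simp [max_eq_right hz]
        · rw [max_eq_left hz]
          exact le_max_of_le_right (by nlinarith [mul_nonneg hz (neg_nonneg.2 h)])
    · refine ⟨1, fun z => max (-z) 0, by norm_num, by fun_prop, fun z => ?_, fun z => ?_⟩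
      · rw [max_eq_left h]
        beta_reduce
        rcases le_total z 0 with hz | hz
        · rw [max_eq_right hz, max_eq_left (neg_nonneg.2 hz)]; ring
        · rw [max_eq_left hz, max_eq_right (neg_nonpos.2 hz)]; ring
      · beta_reduce
        rcases le_total z 0 with hz | hz
        · rw [max_eq_left (neg_nonneg.2 hz)]
          exact le_max_of_le_right (by nlinarith [mul_nonneg h (neg_nonneg.2 hz)])
        · simp [max_eq_right (neg_nonpos.2 hz)]
  have e : ∀ u : Sph d, wdev 0 w q v u
      = κ * (gibbs w q u * (⟪(v : Vec d), (u : Vec d)⟫_ℝ - y))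
        + gibbs w q u * ρ ⟪(v : Vec d), (u : Vec d)⟫_ℝ := by
    intro u
    rw [wdev, ramp_zero, ramp_zero, ← hy, hdec]; ring
  simp_rw [e]
  rw [integral_add (integrable_of_continuous (by fun_prop))
    (integrable_of_continuous (by fun_prop)), integral_const_mul]
  have h1 := sq_integral_gibbs_mul_inner_le w q v
  rw [← hy] at h1
  have h2 := sq_integral_mul_le (continuous_gibbs w q)
    (hρc.comp (by fun_prop : Continuous fun u : Sph d => ⟪(v : Vec d), (u : Vec d)⟫_ℝ)) (gibbs_pos w q)
  have h3 : ∫ u, gibbs w q u * ρ ⟪(v : Vec d), (u : Vec d)⟫_ℝ ^ 2 ∂(sphMeasure d)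
      ≤ ∫ u, gibbs w q u * max 0 (2 * gap q u - y ^ 2) ∂(sphMeasure d) := by
    refine integral_mono (integrable_of_continuous (by fun_prop))
      (integrable_of_continuous (by fun_prop)) fun u => ?_
    refine mul_le_mul_of_nonneg_left ((hρ _).trans (max_le_max le_rfl ?_)) (gibbs_pos w q u).le
    have := sq_inner_sub_le q u v
    rw [← hy] at this
    linarith
  have h4 := mul_le_mul_of_nonneg_left h3 (gibbsMass_pos w q).le
  simp only [Function.comp_apply] at h2
  rw [gibbsMass] at h4 ⊢
  set I1 := ∫ u, gibbs w q u * (⟪(v : Vec d), (u : Vec d)⟫_ℝ - y) ∂(sphMeasure d)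
  set I2 := ∫ u, gibbs w q u * ρ ⟪(v : Vec d), (u : Vec d)⟫_ℝ ∂(sphMeasure d)
  have h5 : (κ * I1) ^ 2 ≤ I1 ^ 2 := by
    rw [mul_pow]; exact mul_le_of_le_one_left (sq_nonneg _) hκ
  nlinarith [sq_nonneg (κ * I1 - I2)]

/-- Mean square of the expected deviation, ReLU case. -/
theorem exists_mean_wdev_zero_le (d : ℕ) [NeZero d] : ∃ C : ℝ, 0 < C ∧ ∀ (q : Sph d) (w : ℝ),
    1 ≤ w → ∫ v, (∫ u, wdev 0 w q v u ∂(sphMeasure d)) ^ 2 ∂(sphMeasure d)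
      ≤ C * w ^ (-(3 / 2) - 2 * (((d : ℝ) - 1) / 2)) := by
  obtain ⟨C, hC, H⟩ := exists_gibbs_moment_le d
  obtain ⟨B, hB, HB⟩ := exists_band_le d
  set k : ℝ := ((d : ℝ) - 1) / 2 with hk
  refine ⟨2 * C ^ 2 + 2 * (C * (4 * B * C)), by positivity, fun q w hw => ?_⟩
  have hw0 : 0 < w := by linarith
  have h0 := H q 0 w le_rfl (by norm_num) hw0
  have h1 := H q 1 w zero_le_one (by norm_num) hw0
  have h2 := H q (3 / 2) w (by norm_num) (by norm_num) hw0
  simp only [Real.rpow_one] at h1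
  simp only [Real.rpow_zero, mul_one] at h0
  have hn1 : 0 ≤ ∫ u, gibbs w q u * gap q u ∂(sphMeasure d) :=
    integral_nonneg fun u => mul_nonneg (gibbs_pos w q u).le (gap_nonneg q u)
  -- Integrating over the direction first makes the band around the kink small, which turns the
  -- crossing term into a moment of order `3/2`.
  have hsw : ∫ v : Sph d, (∫ u, gibbs w q u
      * max 0 (2 * gap q u - ⟪(v : Vec d), (q : Vec d)⟫_ℝ ^ 2) ∂(sphMeasure d)) ∂(sphMeasure d)
      ≤ 4 * B * (C * w ^ (-(3 / 2) - k)) := by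
    have hcg : Continuous fun p : Sph d × Sph d => gibbs w q p.2 :=
      (continuous_gibbs w q).comp continuous_snd
    have hcs : Continuous fun p : Sph d × Sph d => gap q p.2 :=
      (continuous_gap q).comp continuous_snd
    have hp : Continuous fun u : Sph d => gap q u ^ (3 / 2 : ℝ) :=
      (continuous_gap q).rpow_const fun u => Or.inr (by norm_num)
    have hI : Integrable (Function.uncurry fun v u : Sph d => gibbs w q u
        * max 0 (2 * gap q u - ⟪(v : Vec d), (q : Vec d)⟫_ℝ ^ 2))
        ((sphMeasure d).prod (sphMeasure d)) :=
      integrable_of_continuous (by unfold Function.uncurry; fun_prop)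
    rw [integral_integral_swap hI]
    refine le_trans ?_ (mul_le_mul_of_nonneg_left h2 (by positivity : 0 ≤ 4 * B))
    rw [← integral_const_mul]
    refine integral_mono hI.integral_prod_right (integrable_of_continuous (by fun_prop))
      fun u => ?_
    beta_reduce
    rw [integral_const_mul]
    have := integral_slab_le q (HB q) (gap_nonneg q u)
    calc _ ≤ gibbs w q u * (4 * B * gap q u ^ (3 / 2 : ℝ)) :=
          mul_le_mul_of_nonneg_left this (gibbs_pos w q u).le
      _ = _ := by ring
  have hcI : Continuous fun v : Sph d => ∫ u, gibbs w q u
      * max 0 (2 * gap q u - ⟪(v : Vec d), (q : Vec d)⟫_ℝ ^ 2) ∂(sphMeasure d) := by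
    have hcg : Continuous fun p : Sph d × Sph d => gibbs w q p.2 :=
      (continuous_gibbs w q).comp continuous_snd
    have hcs : Continuous fun p : Sph d × Sph d => gap q p.2 :=
      (continuous_gap q).comp continuous_snd
    exact continuous_integral_of_continuous (f := fun v u : Sph d => gibbs w q u
      * max 0 (2 * gap q u - ⟪(v : Vec d), (q : Vec d)⟫_ℝ ^ 2))
      (by unfold Function.uncurry; fun_prop)
  have hcW : Continuous fun v : Sph d => ∫ u, wdev 0 w q v u ∂(sphMeasure d) :=
    continuous_integral_of_continuous (f := fun v u : Sph d => wdev 0 w q v u)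
      (by unfold Function.uncurry; fun_prop)
  have hstep : ∫ v, (∫ u, wdev 0 w q v u ∂(sphMeasure d)) ^ 2 ∂(sphMeasure d)
      ≤ 2 * (C * w ^ (-1 - k)) ^ 2
        + 2 * (C * w ^ (-k) * (4 * B * (C * w ^ (-(3 / 2) - k)))) := by
    refine (integral_mono (integrable_of_continuous (by fun_prop))
      (integrable_of_continuous (by fun_prop)) fun v => sq_mean_wdev_zero_le w q v).trans ?_
    rw [integral_add (integrable_const _) (integrable_of_continuous (by fun_prop)),
      integral_const, probReal_univ, one_smul, integral_const_mul, integral_const_mul]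
    have hm := (gibbsMass_pos w q).le
    have h0' : gibbsMass w q ≤ C * w ^ (-k) := by
      rw [neg_zero, zero_sub] at h0; exact h0
    gcongr
    exact integral_nonneg fun v => integral_nonneg fun u =>
      mul_nonneg (gibbs_pos w q u).le (le_max_left _ _)
  -- For `w ≥ 1` the crossing term dominates the linear one.
  refine hstep.trans (le_of_eq_of_le (b := 2 * C ^ 2 * w ^ (-2 - 2 * k)
    + 2 * (C * (4 * B * C)) * w ^ (-(3 / 2) - 2 * k)) ?_ ?_)
  · have e1 : (w ^ (-1 - k)) ^ 2 = w ^ (-2 - 2 * k) := by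
      rw [← Real.rpow_mul_natCast hw0.le]; congr 1; push_cast; ring
    have e2 : w ^ (-k) * w ^ (-(3 / 2) - k) = w ^ (-(3 / 2) - 2 * k) := by
      rw [← Real.rpow_add hw0]; congr 1; ring
    rw [← e1, ← e2]; ring
  · rw [add_mul]
    gcongr
    norm_num

end

/-! ### Lower bounds for noise and bias, and monotonicity of the noise. -/

section
variable {n : ℕ} [NeZero d]

theorem softWeight_eq_gibbs_compl (w : ℝ) (q : Sph d) (u : Fin n → Sph d) (i : Fin n) :
    softWeight (fun j => ⟪(u j : Vec d), w • (q : Vec d)⟫_ℝ) i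
      = gibbs w q (u i) / (gibbs w q (u i) + ∑ j ∈ {i}ᶜ, gibbs w q (u j)) := by
  rw [softWeight_eq_gibbs, Fintype.sum_eq_add_sum_compl i]

/-- Replacing the own weight `g` by one in the denominator separates it from the other context
points. -/
theorem mul_inv_le_div_le_inv {g Z : ℝ} (hg : 0 < g) (h1 : g ≤ 1) (hZ : 0 ≤ Z) :
    g * (1 + Z)⁻¹ ≤ g / (g + Z) ∧ g / (g + Z) ≤ (1 + Z)⁻¹ := by
  constructor
  · rw [div_eq_mul_inv]
    exact mul_le_mul_of_nonneg_left (inv_anti₀ (by linarith) (by linarith)) hg.le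
  · rw [← one_div, div_le_div_iff₀ (by linarith) (by linarith)]
    nlinarith

theorem sum_compl_gibbs_nonneg (w : ℝ) (q : Sph d) (u : Fin n → Sph d) (i : Fin n) :
    0 ≤ ∑ j ∈ {i}ᶜ, gibbs w q (u j) := Finset.sum_nonneg fun _ _ => (gibbs_pos w q _).le

theorem gibbs_div_le_softWeight {w : ℝ} (hw : 0 ≤ w) (q : Sph d) (u : Fin n → Sph d) (i : Fin n) :
    gibbs w q (u i) * (1 + ∑ j ∈ {i}ᶜ, gibbs w q (u j))⁻¹
      ≤ softWeight (fun j => ⟪(u j : Vec d), w • (q : Vec d)⟫_ℝ) i := by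
  rw [softWeight_eq_gibbs_compl]
  exact (mul_inv_le_div_le_inv (gibbs_pos w q _) (gibbs_le_one hw q _)
    (sum_compl_gibbs_nonneg w q u i)).1

theorem softWeight_le_inv {w : ℝ} (hw : 0 ≤ w) (q : Sph d) (u : Fin n → Sph d) (i : Fin n) :
    softWeight (fun j => ⟪(u j : Vec d), w • (q : Vec d)⟫_ℝ) i
      ≤ (1 + ∑ j ∈ {i}ᶜ, gibbs w q (u j))⁻¹ := by
  rw [softWeight_eq_gibbs_compl]
  exact (mul_inv_le_div_le_inv (gibbs_pos w q _) (gibbs_le_one hw q _)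
    (sum_compl_gibbs_nonneg w q u i)).2

theorem integral_sum_compl (w : ℝ) (q : Sph d) (i : Fin n) :
    ∫ u : Fin n → Sph d, ∑ j ∈ {i}ᶜ, gibbs w q (u j) ∂(sphPi d n) = (n - 1 : ℕ) * gibbsMass w q := by
  rw [integral_finsetSum _ fun j _ => integrable_of_continuous (by fun_prop),
    Finset.sum_congr rfl fun j _ => integral_sphPi_eval (continuous_gibbs w q) j]
  simp [Finset.card_compl, gibbsMass]

/-- The convex function `(1+x)⁻²` lies above its tangent at `z`. -/
theorem inv_sq_tangent_le {x z : ℝ} (hx : 0 ≤ x) (hz : 0 ≤ z) :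
    (1 + z)⁻¹ ^ 2 * (1 - 2 * (x - z) * (1 + z)⁻¹) ≤ (1 + x)⁻¹ ^ 2 := by
  have h1 : 0 < 1 + z := by linarith
  have h2 : 0 < 1 + x := by linarith
  have e : (1 + x)⁻¹ ^ 2 - (1 + z)⁻¹ ^ 2 * (1 - 2 * (x - z) * (1 + z)⁻¹)
      = (x - z) ^ 2 * (3 * (1 + z) + 2 * (x - z)) / ((1 + x) ^ 2 * (1 + z) ^ 3) := by
    field_simp; ring
  have : 0 ≤ (x - z) ^ 2 * (3 * (1 + z) + 2 * (x - z)) / ((1 + x) ^ 2 * (1 + z) ^ 3) := by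
    have : 0 ≤ 3 * (1 + z) + 2 * (x - z) := by linarith
    positivity
  linarith

theorem gibbs_two_mul (w : ℝ) (q u : Sph d) : gibbs (2 * w) q u = gibbs w q u ^ 2 := by
  unfold gibbs; rw [← Real.exp_nat_mul]; push_cast; ring_nf

theorem tangent_le_softWeight_sq {w z : ℝ} (hw : 0 ≤ w) (hz : 0 ≤ z) (q : Sph d)
    (u : Fin n → Sph d) (i : Fin n) :
    gibbs (2 * w) q (u i) * ((1 + z)⁻¹ ^ 2
        * (1 - 2 * ((∑ j ∈ {i}ᶜ, gibbs w q (u j)) - z) * (1 + z)⁻¹))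
      ≤ softWeight (fun j => ⟪(u j : Vec d), w • (q : Vec d)⟫_ℝ) i ^ 2 := by
  have h0 := sum_compl_gibbs_nonneg w q u i
  have h1 := gibbs_div_le_softWeight hw q u i
  have h2 := gibbs_pos w q (u i)
  refine (mul_le_mul_of_nonneg_left (inv_sq_tangent_le h0 hz) (gibbs_pos _ q _).le).trans ?_
  rw [gibbs_two_mul, ← mul_pow]
  exact pow_le_pow_left₀ (mul_nonneg h2.le (inv_nonneg.2 (by linarith))) h1 2

/-- Jensen's inequality: the tangent is taken at the mean `z` of the other weights, so its linear
term integrates to zero. -/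
theorem le_integral_softWeight_sq {w : ℝ} (hw : 0 ≤ w) (q : Sph d) (i : Fin n) :
    gibbsMass (2 * w) q * (1 + (n - 1 : ℕ) * gibbsMass w q)⁻¹ ^ 2
      ≤ ∫ u : Fin n → Sph d, softWeight (fun j => ⟪(u j : Vec d), w • (q : Vec d)⟫_ℝ) i ^ 2
        ∂(sphPi d n) := by
  set m := gibbsMass w q with hm
  have hm0 : 0 < m := gibbsMass_pos w q
  set z : ℝ := (n - 1 : ℕ) * m with hz
  have hz0 : 0 ≤ z := by positivity
  have hgi : ∀ i, Continuous fun u : Fin n → Sph d => gibbs w q (u i) := fun i =>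
    (continuous_gibbs w q).comp (continuous_apply i)
  have hgi' : Continuous fun u : Fin n → Sph d => gibbs (2 * w) q (u i) :=
    (continuous_gibbs (2 * w) q).comp (continuous_apply i)
  have hint := integral_mul_comp_sum_compl (continuous_gibbs (2 * w) q) (continuous_gibbs w q)
    (a := fun x => (1 + z)⁻¹ ^ 2 * (1 - 2 * (x - z) * (1 + z)⁻¹)) (by fun_prop) i
  have hval : ∫ u : Fin n → Sph d, (1 + z)⁻¹ ^ 2
      * (1 - 2 * ((∑ j ∈ {i}ᶜ, gibbs w q (u j)) - z) * (1 + z)⁻¹) ∂(sphPi d n)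
      = (1 + z)⁻¹ ^ 2 := by
    rw [integral_const_mul, integral_sub (integrable_const _)
      (integrable_of_continuous (by fun_prop)), integral_mul_const, integral_const_mul,
      integral_sub (integrable_of_continuous (by fun_prop)) (integrable_const _),
      integral_sum_compl]
    simp [hz, hm]
  rw [hval] at hint
  rw [gibbsMass, ← hint]
  exact integral_mono (integrable_of_continuous (by fun_prop))
    (integrable_of_continuous (by fun_prop)) fun u => tangent_le_softWeight_sq hw hz0 q u i

/-- Lower bound for the noise term. -/
theorem le_noiseAt {w : ℝ} (hw : 0 ≤ w) (q : Sph d) (n : ℕ) :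
    n * gibbsMass (2 * w) q / (1 + n * gibbsMass w q) ^ 2 ≤ noiseAt n (w • (q : Vec d)) := by
  have hm0 := gibbsMass_pos w q
  have hm2 := gibbsMass_pos (2 * w) q
  have hi : ∀ i : Fin n, gibbsMass (2 * w) q / (1 + n * gibbsMass w q) ^ 2
      ≤ ∫ u : Fin n → Sph d, softWeight (fun j => ⟪(u j : Vec d), w • (q : Vec d)⟫_ℝ) i ^ 2
        ∂(sphPi d n) := by
    intro i
    refine le_trans ?_ (le_integral_softWeight_sq hw q i)
    rw [div_eq_mul_inv, ← inv_pow]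
    have : ((n - 1 : ℕ) : ℝ) ≤ n := by exact_mod_cast Nat.sub_le n 1
    gcongr
  rw [noiseAt, integral_finsetSum _ fun i _ => integrable_of_continuous (by fun_prop)]
  refine le_trans (le_of_eq ?_) (Finset.sum_le_sum fun i _ => hi i)
  simp [mul_div_assoc]

/-- Softmax weights concentrate as the inverse temperature grows. -/
theorem sum_softWeight_sq_mono {t : Fin n → ℝ} {w w' : ℝ} (hw : 0 ≤ w) (h : w ≤ w') :
    ∑ i, softWeight (fun j => w * t j) i ^ 2 ≤ ∑ i, softWeight (fun j => w' * t j) i ^ 2 := by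
  rcases Nat.eq_zero_or_pos n with rfl | hn
  · simp
  set x : Fin n → ℝ := fun i => Real.exp (w * t i) with hx
  set y : Fin n → ℝ := fun i => Real.exp ((w' - w) * t i) with hy
  have hx0 : ∀ i, 0 < x i := fun i => Real.exp_pos _
  have hy0 : ∀ i, 0 < y i := fun i => Real.exp_pos _
  have hxy : ∀ i, Real.exp (w' * t i) = x i * y i := fun i => by
    rw [hx, hy, ← Real.exp_add]; ring_nf
  have hco : ∀ i j, 0 ≤ (x i - x j) * (y i ^ 2 - y j ^ 2) := by
    intro i j
    have aux : ∀ i j, t i ≤ t j → x i ≤ x j ∧ y i ≤ y j := fun i j hij =>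
      ⟨Real.exp_le_exp.2 (by nlinarith), Real.exp_le_exp.2 (by nlinarith)⟩
    rcases le_total (t i) (t j) with hij | hij
    · obtain ⟨h1, h2⟩ := aux i j hij
      have := pow_le_pow_left₀ (hy0 i).le h2 2
      exact mul_nonneg_of_nonpos_of_nonpos (by linarith) (by linarith)
    · obtain ⟨h1, h2⟩ := aux j i hij
      have := pow_le_pow_left₀ (hy0 j).le h2 2
      exact mul_nonneg (by linarith) (by linarith)
  -- Chebyshev's sum inequality with weights `x i`: both `x` and `y²` increase with the score `t`.
  have hcheb : (∑ i, x i ^ 2) * (∑ i, x i * y i ^ 2) ≤ (∑ i, x i ^ 2 * y i ^ 2) * ∑ i, x i := by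
    have h1 : 0 ≤ ∑ i, ∑ j, x i * x j * ((x i - x j) * (y i ^ 2 - y j ^ 2)) :=
      Finset.sum_nonneg fun i _ => Finset.sum_nonneg fun j _ =>
        mul_nonneg (mul_nonneg (hx0 i).le (hx0 j).le) (hco i j)
    have h2 : ∑ i, ∑ j, x i * x j * ((x i - x j) * (y i ^ 2 - y j ^ 2))
        = 2 * ((∑ i, x i ^ 2 * y i ^ 2) * ∑ i, x i) - 2 * ((∑ i, x i ^ 2) * ∑ i, x i * y i ^ 2) := by
      have e1 := Finset.sum_mul_sum Finset.univ Finset.univ (fun i => x i ^ 2 * y i ^ 2) x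
      have e2 := Finset.sum_mul_sum Finset.univ Finset.univ x (fun i => x i ^ 2 * y i ^ 2)
      have e3 := Finset.sum_mul_sum Finset.univ Finset.univ (fun i => x i ^ 2)
        (fun i => x i * y i ^ 2)
      have e4 := Finset.sum_mul_sum Finset.univ Finset.univ (fun i => x i * y i ^ 2)
        (fun i => x i ^ 2)
      have e5 : 2 * ((∑ i, x i ^ 2 * y i ^ 2) * ∑ i, x i) - 2 * ((∑ i, x i ^ 2) * ∑ i, x i * y i ^ 2)
        = (∑ i, x i ^ 2 * y i ^ 2) * (∑ i, x i) + (∑ i, x i) * (∑ i, x i ^ 2 * y i ^ 2)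
          - (∑ i, x i ^ 2) * (∑ i, x i * y i ^ 2) - (∑ i, x i * y i ^ 2) * (∑ i, x i ^ 2) := by
        ring
      rw [e5, e1, e2, e3, e4]
      simp only [← Finset.sum_add_distrib, ← Finset.sum_sub_distrib]
      exact Finset.sum_congr rfl fun i _ => Finset.sum_congr rfl fun j _ => by ring
    linarith
  have hcs : (∑ i, x i * y i) ^ 2 ≤ (∑ i, x i) * ∑ i, x i * y i ^ 2 :=
    Finset.sum_sq_le_sum_mul_sum_of_sq_le_mul _ (fun i _ => (hx0 i).le)
      (fun i _ => (mul_pos (hx0 i) (pow_pos (hy0 i) 2)).le) fun i _ => le_of_eq (by ring)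
  have hX : 0 < ∑ i, x i := Finset.sum_pos (fun i _ => hx0 i) ⟨⟨0, hn⟩, Finset.mem_univ _⟩
  have hXY : 0 < ∑ i, x i * y i := Finset.sum_pos (fun i _ => mul_pos (hx0 i) (hy0 i))
    ⟨⟨0, hn⟩, Finset.mem_univ _⟩
  have hX2 : 0 ≤ ∑ i, x i ^ 2 := Finset.sum_nonneg fun i _ => sq_nonneg _
  simp only [softWeight, div_pow, ← Finset.sum_div, hxy]
  rw [div_le_div_iff₀ (by positivity) (by positivity)]
  simp only [mul_pow]
  calc (∑ i, x i ^ 2) * (∑ i, x i * y i) ^ 2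
      ≤ (∑ i, x i ^ 2) * ((∑ i, x i) * ∑ i, x i * y i ^ 2) := by gcongr
    _ = (∑ i, x i) * ((∑ i, x i ^ 2) * ∑ i, x i * y i ^ 2) := by ring
    _ ≤ (∑ i, x i) * ((∑ i, x i ^ 2 * y i ^ 2) * ∑ i, x i) := by gcongr
    _ = _ := by ring

theorem noiseAt_mono {w w' : ℝ} (hw : 0 ≤ w) (h : w ≤ w') (q : Sph d) (n : ℕ) :
    noiseAt n (w • (q : Vec d)) ≤ noiseAt n (w' • (q : Vec d)) := by
  refine integral_mono (integrable_of_continuous (by fun_prop))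
    (integrable_of_continuous (by fun_prop)) fun u => ?_
  simp only [real_inner_smul_right]
  exact sum_softWeight_sq_mono hw h

theorem ramp_sub_ramp_neg (τ z : ℝ) : ramp τ z - ramp τ (-z) = (1 + τ) * z := by
  unfold ramp
  rcases le_total z 0 with h | h
  · rw [max_eq_right h, min_eq_left h, max_eq_left (neg_nonneg.2 h), min_eq_right (neg_nonneg.2 h)]
    ring
  · rw [max_eq_left h, min_eq_right h, max_eq_right (neg_nonpos.2 h), min_eq_left (neg_nonpos.2 h)]
    ring

/-- The odd part of the ramp in `v` is linear, so `(1+τ)` times the affine error is a difference of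
two ramp errors of equal mean square. Lower bounds thus need only the affine case. -/
theorem biasAt_one_le {τ : ℝ} (hτ : 0 ≤ τ) (n : ℕ) (a q : Vec d) :
    biasAt 1 n a q ≤ 4 * biasAt τ n a q := by
  set N : Sph d → Sph d := rot (LinearIsometryEquiv.neg ℝ) with hN
  have hflip : ∫ p : Sph d × (Fin n → Sph d), predErr τ a q (N p.1) p.2 ^ 2
      ∂((sphMeasure d).prod (sphPi d n)) = biasAt τ n a q :=
    integral_comp_of_continuous ((measurePreserving_rot _).prod (MeasurePreserving.id _))
      (f := fun p : Sph d × (Fin n → Sph d) => predErr τ a q p.1 p.2 ^ 2) (by fun_prop)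
  have hc : Continuous N := continuous_rot _
  have hodd : ∀ (v : Sph d) (u : Fin n → Sph d), predErr τ a q v u - predErr τ a q (N v) u
      = (1 + τ) * predErr 1 a q v u := by
    intro v u
    simp only [predErr, hN, coe_rot, LinearIsometryEquiv.coe_neg, inner_neg_left, ramp_one]
    have := ramp_sub_ramp_neg τ
    rw [sub_sub_sub_comm, ← Finset.sum_sub_distrib, this, mul_sub, Finset.mul_sum]
    congr 1
    exact Finset.sum_congr rfl fun i _ => by rw [← mul_sub, this]; ring
  calc biasAt 1 n a q ≤ ∫ p : Sph d × (Fin n → Sph d), (2 * predErr τ a q p.1 p.2 ^ 2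
        + 2 * predErr τ a q (N p.1) p.2 ^ 2) ∂((sphMeasure d).prod (sphPi d n)) := by
        refine integral_mono (integrable_of_continuous (by fun_prop))
          (integrable_of_continuous (by fun_prop)) fun p => ?_
        have h1 := hodd p.1 p.2
        have h2 : predErr 1 a q p.1 p.2 ^ 2 ≤ ((1 + τ) * predErr 1 a q p.1 p.2) ^ 2 := by
          rw [mul_pow]
          exact le_mul_of_one_le_left (sq_nonneg _) (one_le_pow₀ (by linarith))
        beta_reduce
        rw [← h1] at h2
        nlinarith [sq_nonneg (predErr τ a q p.1 p.2 + predErr τ a q (N p.1) p.2)]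
    _ = _ := by
        rw [integral_add (integrable_of_continuous (by fun_prop))
          (integrable_of_continuous (by fun_prop)), integral_const_mul, integral_const_mul, hflip,
          biasAt]
        ring

theorem sq_integral_le {X : Type*} [TopologicalSpace X] [CompactSpace X] [MeasurableSpace X]
    [OpensMeasurableSpace X] {μ : Measure X} [IsProbabilityMeasure μ] {f : X → ℝ}
    (hf : Continuous f) : (∫ x, f x ∂μ) ^ 2 ≤ ∫ x, f x ^ 2 ∂μ := by
  set b := ∫ x, f x ∂μ with hb
  have h : 0 ≤ ∫ x, (f x - b) ^ 2 ∂μ := integral_nonneg fun x => sq_nonneg _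
  have e : ∀ x, (f x - b) ^ 2 = f x ^ 2 - 2 * b * f x + b ^ 2 := fun x => by ring
  simp_rw [e] at h
  rw [integral_add (integrable_of_continuous (by fun_prop)) (integrable_const _),
    integral_sub (integrable_of_continuous (by fun_prop)) (integrable_of_continuous (by fun_prop)),
    integral_const_mul, ← hb, integral_const, probReal_univ, one_smul] at h
  nlinarith

/-- The mean gap between the attended context points and the query. -/
def attendedGap (n : ℕ) (w : ℝ) (q : Sph d) : ℝ :=
  ∫ u : Fin n → Sph d, ∑ i, softWeight (fun j => ⟪(u j : Vec d), w • (q : Vec d)⟫_ℝ) i * gap q (u i)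
    ∂(sphPi d n)

/-- Averaging over `v` gives `secondMoment d` times the squared distance from the attended mean to
`q`. Its component along `q` is minus the attended gap; Jensen's inequality then averages over the
context. -/
theorem le_biasAt_one [NeZero n] (w : ℝ) (q : Sph d) :
    secondMoment d * attendedGap n w q ^ 2 ≤ biasAt 1 n (w • (q : Vec d)) q := by
  have hI : Integrable (fun p : Sph d × (Fin n → Sph d) =>
      predErr 1 (w • (q : Vec d)) q p.1 p.2 ^ 2) ((sphMeasure d).prod (sphPi d n)) :=
    integrable_of_continuous (by fun_prop)
  rw [biasAt, integral_prod_symm _ hI]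
  have hin : ∀ u : Fin n → Sph d, secondMoment d
      * (∑ i, softWeight (fun j => ⟪(u j : Vec d), w • (q : Vec d)⟫_ℝ) i * gap q (u i)) ^ 2
      ≤ ∫ v : Sph d, predErr 1 (w • (q : Vec d)) q v u ^ 2 ∂(sphMeasure d) := by
    intro u
    set p := softWeight fun j => ⟪(u j : Vec d), w • (q : Vec d)⟫_ℝ with hp
    have hs : ∑ i, p i = 1 := sum_softWeight _
    set y : Vec d := ∑ i, p i • (u i : Vec d) - q with hy
    have e : ∀ v : Sph d, predErr 1 (w • (q : Vec d)) q v u = ⟪(v : Vec d), y⟫_ℝ := by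
      intro v
      simp only [predErr, ramp_one, hy, inner_sub_right, inner_sum, real_inner_smul_right, hp]
    simp_rw [e]
    rw [integral_inner_sq]
    have h1 : ⟪y, (q : Vec d)⟫_ℝ = -∑ i, p i * gap q (u i) := by
      simp only [hy, inner_sub_left, sum_inner, real_inner_smul_left, inner_sph_self, gap, mul_sub,
        mul_one, Finset.sum_sub_distrib, hs]
      ring
    have h2 := abs_real_inner_le_norm y (q : Vec d)
    rw [h1, norm_sph, mul_one, abs_neg] at h2
    have h3 : (∑ i, p i * gap q (u i)) ^ 2 ≤ ‖y‖ ^ 2 := by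
      rw [← sq_abs]; gcongr
    exact mul_le_mul_of_nonneg_left h3 secondMoment_pos.le
  calc secondMoment d * attendedGap n w q ^ 2
      ≤ secondMoment d * ∫ u : Fin n → Sph d, (∑ i,
        softWeight (fun j => ⟪(u j : Vec d), w • (q : Vec d)⟫_ℝ) i * gap q (u i)) ^ 2
          ∂(sphPi d n) := by
        refine mul_le_mul_of_nonneg_left (sq_integral_le ?_) secondMoment_pos.le
        have : ∀ i : Fin n, Continuous fun u : Fin n → Sph d => gap q (u i) := fun i =>
          (continuous_gap q).comp (continuous_apply i)
        fun_prop
    _ = ∫ u : Fin n → Sph d, secondMoment d * (∑ i,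
        softWeight (fun j => ⟪(u j : Vec d), w • (q : Vec d)⟫_ℝ) i * gap q (u i)) ^ 2
          ∂(sphPi d n) := (integral_const_mul _ _).symm
    _ ≤ _ := integral_mono (integrable_of_continuous (by
          have : ∀ i : Fin n, Continuous fun u : Fin n → Sph d => gap q (u i) := fun i =>
            (continuous_gap q).comp (continuous_apply i)
          fun_prop)) hI.integral_prod_right hin

/-- Softmax at inverse temperature `w` resolves no scale below `1/w`: a cap of height `δ/(1+w)` with
`δ` small has measure at most half the mean weight, so a tent function on it captures at most half
the attention on average. -/
theorem exists_le_attendedGap (d : ℕ) [NeZero d] (hd : 2 ≤ d) : ∃ c : ℝ, 0 < c ∧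
    ∀ (n : ℕ) [NeZero n] (q : Sph d) (w : ℝ), 0 ≤ w → c / (1 + w) ≤ attendedGap n w q := by
  obtain ⟨C, hC, HC⟩ := exists_cap_le d
  obtain ⟨c, hc, Hc⟩ := exists_le_gibbsMass d
  set k : ℝ := ((d : ℝ) - 1) / 2 with hk
  have hd' : (2 : ℝ) ≤ d := by exact_mod_cast hd
  have hk0 : 0 < k := by rw [hk]; linarith
  -- The cap bound at height `δ/(1+w)` becomes half the lower bound for the mass at `1 + w`;
  -- shifting `w` by one makes that bound available for all `w ≥ 0`.
  obtain ⟨δ, hδ, hδk⟩ : ∃ δ : ℝ, 0 < δ ∧ C * δ ^ k = c / 2 := by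
    refine ⟨(c / (2 * C)) ^ (1 / k), by positivity, ?_⟩
    rw [← Real.rpow_mul (by positivity), one_div_mul_cancel hk0.ne', Real.rpow_one]
    field_simp
  refine ⟨δ / 2, by positivity, fun n _ q w hw => ?_⟩
  have hw1 : 0 < 1 + w := by linarith
  set η := δ / (1 + w) with hη
  have hη0 : 0 < η := by positivity
  -- A continuous tent below the indicator of the cap, with `gap ≥ η * (1 - χ)`.
  set χ : Sph d → ℝ := fun u => max 0 (1 - gap q u / η) with hχ
  have hχc : Continuous χ := by fun_prop
  have hχ0 : ∀ u, 0 ≤ χ u := fun u => le_max_left _ _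
  have hχm : ∫ u, χ u ∂(sphMeasure d) ≤ (1 / 2) * gibbsMass w q := by
    have h1 : ∫ u, χ u ∂(sphMeasure d) ≤ (sphMeasure d).real {u | gap q u ≤ η} := by
      have : ∫ u, ({u | gap q u ≤ η}.indicator fun _ => (1 : ℝ)) u ∂(sphMeasure d)
          = (sphMeasure d).real {u | gap q u ≤ η} := by
        rw [integral_indicator_const _ (measurableSet_gap_le q η), smul_eq_mul, mul_one]
      rw [← this]
      refine integral_mono (integrable_of_continuous hχc)
        ((integrable_const _).indicator (measurableSet_gap_le q η)) fun u => ?_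
      by_cases hu : gap q u ≤ η
      · rw [Set.indicator_of_mem (by exact hu)]
        exact max_le zero_le_one (by
          have := div_nonneg (gap_nonneg q u) hη0.le
          linarith)
      · rw [Set.indicator_of_notMem (by exact hu)]
        refine max_le le_rfl ?_
        have := (one_le_div hη0).2 (not_le.1 hu).le
        linarith
    have h2 : (sphMeasure d).real {u | gap q u ≤ η} ≤ C * η ^ k := HC q η hη0.le
    have h3 : C * η ^ k = (1 / 2) * (c * (1 + w) ^ (-k)) := by
      rw [hη, Real.div_rpow hδ.le hw1.le, ← mul_div_assoc, hδk, Real.rpow_neg hw1.le]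
      field_simp
    have h4 := Hc q (1 + w) (by linarith)
    have h5 : gibbsMass (1 + w) q ≤ gibbsMass w q := gibbsMass_anti (by linarith) q
    linarith
  have hci : ∀ i : Fin n, Continuous fun u : Fin n → Sph d => χ (u i) := fun i =>
    hχc.comp (continuous_apply i)
  have hgi : ∀ i : Fin n, Continuous fun u : Fin n → Sph d => gibbs w q (u i) := fun i =>
    (continuous_gibbs w q).comp (continuous_apply i)
  have hgapi : ∀ i : Fin n, Continuous fun u : Fin n → Sph d => gap q (u i) := fun i =>
    (continuous_gap q).comp (continuous_apply i)
  have hac : ∀ i : Fin n, Continuous fun u : Fin n → Sph d =>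
      (1 + ∑ j ∈ {i}ᶜ, gibbs w q (u j))⁻¹ := fun i =>
    Continuous.inv₀ (by fun_prop) fun u => by
      have : 0 ≤ ∑ j ∈ {i}ᶜ, gibbs w q (u j) := Finset.sum_nonneg fun j _ => (gibbs_pos w q _).le
      linarith
  have hi : ∀ i : Fin n, ∫ u : Fin n → Sph d,
      softWeight (fun j => ⟪(u j : Vec d), w • (q : Vec d)⟫_ℝ) i * χ (u i) ∂(sphPi d n)
      ≤ (1 / 2) * ∫ u : Fin n → Sph d,
        softWeight (fun j => ⟪(u j : Vec d), w • (q : Vec d)⟫_ℝ) i ∂(sphPi d n) := by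
    intro i
    have e1 := integral_mul_comp_sum_compl hχc (continuous_gibbs w q)
      (a := fun x => (1 + x)⁻¹) (by fun_prop) i
    have e2 := integral_mul_comp_sum_compl (continuous_gibbs w q) (continuous_gibbs w q)
      (a := fun x => (1 + x)⁻¹) (by fun_prop) i
    have ha0 : 0 ≤ ∫ u : Fin n → Sph d, (1 + ∑ j ∈ {i}ᶜ, gibbs w q (u j))⁻¹ ∂(sphPi d n) :=
      integral_nonneg fun u => inv_nonneg.2 (by
        have : 0 ≤ ∑ j ∈ {i}ᶜ, gibbs w q (u j) := Finset.sum_nonneg fun j _ => (gibbs_pos w q _).le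
        linarith)
    calc _ ≤ ∫ u : Fin n → Sph d, χ (u i) * (1 + ∑ j ∈ {i}ᶜ, gibbs w q (u j))⁻¹ ∂(sphPi d n) := by
          refine integral_mono (integrable_of_continuous (by fun_prop))
            (integrable_of_continuous ((hci i).mul (hac i))) fun u => ?_
          beta_reduce
          rw [mul_comm]
          exact mul_le_mul_of_nonneg_left (softWeight_le_inv hw q u i) (hχ0 _)
      _ ≤ (1 / 2) * ∫ u : Fin n → Sph d, gibbs w q (u i)
            * (1 + ∑ j ∈ {i}ᶜ, gibbs w q (u j))⁻¹ ∂(sphPi d n) := by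
          rw [e1, e2, ← mul_assoc]
          exact mul_le_mul_of_nonneg_right hχm ha0
      _ ≤ _ := by
          refine mul_le_mul_of_nonneg_left ?_ (by norm_num)
          exact integral_mono (integrable_of_continuous ((hgi i).mul (hac i)))
            (integrable_of_continuous (by fun_prop)) fun u => gibbs_div_le_softWeight hw q u i
  have hsum : ∫ u : Fin n → Sph d, ∑ i,
      softWeight (fun j => ⟪(u j : Vec d), w • (q : Vec d)⟫_ℝ) i * χ (u i) ∂(sphPi d n) ≤ 1 / 2 := by
    rw [integral_finsetSum _ fun i _ => integrable_of_continuous (by fun_prop)]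
    refine (Finset.sum_le_sum fun i _ => hi i).trans (le_of_eq ?_)
    rw [← Finset.mul_sum, ← integral_finsetSum _ fun i _ => integrable_of_continuous (by fun_prop)]
    simp only [sum_softWeight, integral_const, probReal_univ, one_smul, mul_one]
  have hpt : ∀ u : Fin n → Sph d, η - η * ∑ i,
      softWeight (fun j => ⟪(u j : Vec d), w • (q : Vec d)⟫_ℝ) i * χ (u i)
      ≤ ∑ i, softWeight (fun j => ⟪(u j : Vec d), w • (q : Vec d)⟫_ℝ) i * gap q (u i) := by
    intro u
    have hs := sum_softWeight fun j => ⟪(u j : Vec d), w • (q : Vec d)⟫_ℝ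
    have e : η - η * ∑ i, softWeight (fun j => ⟪(u j : Vec d), w • (q : Vec d)⟫_ℝ) i * χ (u i)
        = ∑ i, softWeight (fun j => ⟪(u j : Vec d), w • (q : Vec d)⟫_ℝ) i * (η * (1 - χ (u i))) := by
      simp only [mul_sub, mul_one, Finset.sum_sub_distrib, ← Finset.sum_mul, hs, one_mul,
        Finset.mul_sum]
      congr 1
      exact Finset.sum_congr rfl fun i _ => by ring
    rw [e]
    refine Finset.sum_le_sum fun i _ => mul_le_mul_of_nonneg_left ?_ (softWeight_pos _ i).le
    have h1 : 1 - gap q (u i) / η ≤ χ (u i) := le_max_right _ _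
    have h2 : η * (gap q (u i) / η) = gap q (u i) := by field_simp
    nlinarith
  calc δ / 2 / (1 + w) = η - η * (1 / 2) := by rw [hη]; ring
    _ ≤ η - η * ∫ u : Fin n → Sph d, ∑ i,
      softWeight (fun j => ⟪(u j : Vec d), w • (q : Vec d)⟫_ℝ) i * χ (u i) ∂(sphPi d n) := by
        gcongr
    _ = ∫ u : Fin n → Sph d, (η - η * ∑ i,
      softWeight (fun j => ⟪(u j : Vec d), w • (q : Vec d)⟫_ℝ) i * χ (u i)) ∂(sphPi d n) := by
        rw [integral_sub (integrable_const _) (integrable_of_continuous (by fun_prop)),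
          integral_const_mul, integral_const, probReal_univ, one_smul]
    _ ≤ _ := integral_mono (integrable_of_continuous (by fun_prop))
        (integrable_of_continuous (by fun_prop)) hpt

end

/-! ### Expansion of bias and noise near inverse temperature zero. -/

section softWeight
variable {n : ℕ} [NeZero n]

theorem abs_sum_div_le {x : Fin n → ℝ} {b : ℝ} (hx : ∀ i, |x i| ≤ b) : |(∑ i, x i) / n| ≤ b := by
  have hn : (0 : ℝ) < n := by exact_mod_cast NeZero.pos n
  rw [abs_div, abs_of_pos hn, div_le_iff₀ hn]
  refine (Finset.abs_sum_le_sum_abs _ _).trans ((Finset.sum_le_sum fun i _ => hx i).trans ?_)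
  simp [mul_comm]

/-- First order expansion of the softmax weights at zero scores. -/
theorem abs_mul_softWeight_sub_le {x : Fin n → ℝ} {δ : ℝ} (h0 : 0 ≤ δ) (h1 : δ ≤ 1)
    (hx : ∀ i, |x i| ≤ δ) (i : Fin n) :
    |n * softWeight x i - 1 - (x i - (∑ j, x j) / n)| ≤ 18 * δ ^ 2 := by
  have hn : (0 : ℝ) < n := by exact_mod_cast NeZero.pos n
  set r : Fin n → ℝ := fun j => Real.exp (x j) - 1 - x j with hr
  have hrb : ∀ j, |r j| ≤ δ ^ 2 := fun j => by
    refine (Real.abs_exp_sub_one_sub_id_le ((hx j).trans h1)).trans ?_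
    rw [← sq_abs]; exact pow_le_pow_left₀ (abs_nonneg _) (hx j) 2
  set a := (∑ j, x j) / n with ha
  set b := (∑ j, r j) / n with hb
  have hab : |a| ≤ δ := abs_sum_div_le hx
  have hbb : |b| ≤ δ ^ 2 := abs_sum_div_le hrb
  have hsum : ∑ j, Real.exp (x j) = n * (1 + a + b) := by
    have e : ∀ j, Real.exp (x j) = 1 + x j + r j := fun j => by rw [hr]; ring
    simp only [e, Finset.sum_add_distrib, ha, hb]
    simp only [Finset.sum_const, Finset.card_univ, Fintype.card_fin, nsmul_eq_mul]
    field_simp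
  -- Each exponential is at least `exp (-1)`, since the scores are at least `-1`.
  have hm : 1 / 3 ≤ 1 + a + b := by
    have h2 : ∑ j : Fin n, (1 / 3 : ℝ) ≤ ∑ j, Real.exp (x j) := Finset.sum_le_sum fun j _ => by
      have h3 : -1 ≤ x j := by linarith [(abs_le.1 (hx j)).1]
      have h4 : Real.exp 1 < 3 := Real.exp_one_lt_three
      refine le_trans ?_ (Real.exp_le_exp.2 h3)
      rw [Real.exp_neg, one_div]
      exact inv_anti₀ (Real.exp_pos 1) h4.le
    rw [hsum, Finset.sum_const, Finset.card_univ, Fintype.card_fin, nsmul_eq_mul] at h2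
    exact le_of_mul_le_mul_left h2 hn
  have hm0 : 0 < 1 + a + b := by linarith
  have e : n * softWeight x i - 1 - (x i - a)
      = (r i - b - (a + b) * (x i - a)) / (1 + a + b) := by
    have : Real.exp (x i) = 1 + x i + r i := by rw [hr]; ring
    rw [softWeight, hsum, this]
    field_simp
    ring
  rw [e, abs_div, abs_of_pos hm0, div_le_iff₀ hm0]
  have h2 : |x i - a| ≤ 2 * δ := (abs_sub _ _).trans (by linarith [hx i])
  have h3 : |a + b| ≤ 2 * δ := (abs_add_le _ _).trans (by nlinarith)
  have h4 : |(a + b) * (x i - a)| ≤ 2 * δ * (2 * δ) := by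
    rw [abs_mul]; exact mul_le_mul h3 h2 (abs_nonneg _) (by linarith)
  have h5 : |r i - b - (a + b) * (x i - a)| ≤ 6 * δ ^ 2 := by
    refine (abs_sub _ _).trans ?_
    have := abs_sub (r i) b
    nlinarith [hrb i]
  nlinarith [sq_nonneg δ]

theorem abs_mul_softWeight_sub_one_le {x : Fin n → ℝ} {δ : ℝ} (h0 : 0 ≤ δ) (h1 : δ ≤ 1)
    (hx : ∀ i, |x i| ≤ δ) (i : Fin n) : |n * softWeight x i - 1| ≤ 20 * δ := by
  have h2 := abs_mul_softWeight_sub_le h0 h1 hx i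
  have h3 : |x i - (∑ j, x j) / n| ≤ 2 * δ :=
    (abs_sub _ _).trans (by linarith [hx i, abs_sum_div_le hx])
  have h4 := abs_add_le (n * softWeight x i - 1 - (x i - (∑ j, x j) / n)) (x i - (∑ j, x j) / n)
  rw [sub_add_cancel] at h4
  nlinarith

/-- The uniform weights minimize the sum of squares, so the noise grows only quadratically in `δ`,
while the bias will fall linearly. -/
theorem sum_softWeight_sq_le {x : Fin n → ℝ} {δ : ℝ} (h0 : 0 ≤ δ) (h1 : δ ≤ 1)
    (hx : ∀ i, |x i| ≤ δ) : ∑ i, softWeight x i ^ 2 ≤ (1 + 400 * δ ^ 2) / n := by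
  have hn : (0 : ℝ) < n := by exact_mod_cast NeZero.pos n
  have h2 : ∀ i, softWeight x i ^ 2
      ≤ (400 * δ ^ 2 - 1) / n ^ 2 + 2 / n * softWeight x i := fun i => by
    have h3 := pow_le_pow_left₀ (abs_nonneg _) (abs_mul_softWeight_sub_one_le h0 h1 hx i) 2
    rw [sq_abs] at h3
    have e : (400 * δ ^ 2 - 1) / n ^ 2 + 2 / n * softWeight x i - softWeight x i ^ 2
        = ((20 * δ) ^ 2 - (n * softWeight x i - 1) ^ 2) / n ^ 2 := by
      field_simp; ring
    have : 0 ≤ ((20 * δ) ^ 2 - (n * softWeight x i - 1) ^ 2) / n ^ 2 :=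
      div_nonneg (by linarith) (by positivity)
    linarith
  refine (Finset.sum_le_sum fun i _ => h2 i).trans (le_of_eq ?_)
  rw [Finset.sum_add_distrib, ← Finset.mul_sum, sum_softWeight]
  simp only [Finset.sum_const, Finset.card_univ, Fintype.card_fin, nsmul_eq_mul]
  field_simp
  ring

theorem le_sum_softWeight_sq (x : Fin n → ℝ) : 1 / n ≤ ∑ i, softWeight x i ^ 2 := by
  have hn : (0 : ℝ) < n := by exact_mod_cast NeZero.pos n
  have := sq_sum_le_card_mul_sum_sq (s := Finset.univ) (f := softWeight x)
  rw [sum_softWeight, Finset.card_univ, Fintype.card_fin] at this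
  rw [div_le_iff₀ hn]
  linarith

end softWeight

section
variable [NeZero d] {n : ℕ} [NeZero n]

theorem abs_inner_smul_le {δ : ℝ} (h0 : 0 ≤ δ) (q u : Sph d) :
    |⟪(u : Vec d), δ • (q : Vec d)⟫_ℝ| ≤ δ := by
  rw [real_inner_smul_right, abs_mul, abs_of_nonneg h0]
  exact mul_le_of_le_one_right h0 (abs_inner_sph_le u q)

theorem noiseAt_small_le {δ : ℝ} (h0 : 0 ≤ δ) (h1 : δ ≤ 1) (q : Sph d) :
    noiseAt n (δ • (q : Vec d)) ≤ (1 + 400 * δ ^ 2) / n := by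
  have : ∫ _ : Fin n → Sph d, (1 + 400 * δ ^ 2) / (n : ℝ) ∂(sphPi d n) = (1 + 400 * δ ^ 2) / n := by
    simp
  rw [← this]
  exact integral_mono (integrable_of_continuous (by fun_prop)) (integrable_const _) fun u =>
    sum_softWeight_sq_le h0 h1 fun i => abs_inner_smul_le h0 q (u i)

theorem inv_le_noiseAt (a : Vec d) : 1 / n ≤ noiseAt n a := by
  have : ∫ _ : Fin n → Sph d, 1 / (n : ℝ) ∂(sphPi d n) = 1 / n := by
    simp
  rw [← this]
  exact integral_mono (integrable_const _) (integrable_of_continuous (by fun_prop)) fun u =>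
    le_sum_softWeight_sq _

theorem predErr_zero (τ : ℝ) (q : Vec d) (v : Sph d) (u : Fin n → Sph d) :
    predErr τ 0 q v u = (∑ i, ramp τ ⟪(v : Vec d), (u i : Vec d)⟫_ℝ) / n
      - ramp τ ⟪(v : Vec d), q⟫_ℝ := by
  have : ∀ i : Fin n, softWeight (fun _ : Fin n => (0 : ℝ)) i = 1 / n := fun i => by
    simp [softWeight]
  simp only [predErr, inner_zero_right, this, Finset.sum_div, one_div]
  congr 1
  exact Finset.sum_congr rfl fun i _ => by ring

/-- The derivative of the prediction in the inverse temperature, at zero. -/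
def predSlope (τ : ℝ) (q : Vec d) (v : Sph d) (u : Fin n → Sph d) : ℝ :=
  (∑ i, (⟪(u i : Vec d), q⟫_ℝ - (∑ j, ⟪(u j : Vec d), q⟫_ℝ) / n)
    * ramp τ ⟪(v : Vec d), (u i : Vec d)⟫_ℝ) / n

@[fun_prop] theorem Continuous.predSlope {X : Type*} [TopologicalSpace X] (τ : ℝ)
    (q : Vec d) {v : X → Sph d} {u : X → Fin n → Sph d} (hv : Continuous v) (hu : Continuous u) :
    Continuous fun x => predSlope τ q (v x) (u x) := by
  unfold SoftmaxICL.predSlope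
  fun_prop

theorem abs_ramp_inner_le {τ : ℝ} (h0 : 0 ≤ τ) (h1 : τ ≤ 1) (v u : Sph d) :
    |ramp τ ⟪(v : Vec d), (u : Vec d)⟫_ℝ| ≤ 1 :=
  (abs_ramp_le h0 h1 _).trans (abs_inner_sph_le v u)

theorem abs_predErr_sub_zero_le {τ : ℝ} (h0 : 0 ≤ τ) (h1 : τ ≤ 1) {δ : ℝ} (hδ0 : 0 ≤ δ)
    (hδ : δ ≤ 1) (q v : Sph d) (u : Fin n → Sph d) :
    |predErr τ (δ • (q : Vec d)) q v u - predErr τ 0 q v u| ≤ 20 * δ := by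
  have hn : (n : ℝ) ≠ 0 := by exact_mod_cast NeZero.ne n
  have e : predErr τ (δ • (q : Vec d)) q v u - predErr τ 0 q v u
      = (∑ i, (n * softWeight (fun j => ⟪(u j : Vec d), δ • (q : Vec d)⟫_ℝ) i - 1)
        * ramp τ ⟪(v : Vec d), (u i : Vec d)⟫_ℝ) / n := by
    rw [predErr_zero, predErr, sub_sub_sub_cancel_right, eq_div_iff hn, sub_mul,
      div_mul_cancel₀ _ hn, Finset.sum_mul, ← Finset.sum_sub_distrib]
    exact Finset.sum_congr rfl fun i _ => by ring
  rw [e]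
  refine abs_sum_div_le fun i => ?_
  rw [abs_mul]
  exact (mul_le_of_le_one_right (abs_nonneg _) (abs_ramp_inner_le h0 h1 v (u i))).trans
    (abs_mul_softWeight_sub_one_le hδ0 hδ (fun i => abs_inner_smul_le hδ0 q (u i)) i)

theorem abs_predErr_sub_slope_le {τ : ℝ} (h0 : 0 ≤ τ) (h1 : τ ≤ 1) {δ : ℝ} (hδ0 : 0 ≤ δ)
    (hδ : δ ≤ 1) (q v : Sph d) (u : Fin n → Sph d) :
    |predErr τ (δ • (q : Vec d)) q v u - predErr τ 0 q v u - δ * predSlope τ q v u|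
      ≤ 18 * δ ^ 2 := by
  have hn : (n : ℝ) ≠ 0 := by exact_mod_cast NeZero.ne n
  have e : predErr τ (δ • (q : Vec d)) q v u - predErr τ 0 q v u - δ * predSlope τ q v u
      = (∑ i, (n * softWeight (fun j => ⟪(u j : Vec d), δ • (q : Vec d)⟫_ℝ) i - 1
        - (⟪(u i : Vec d), δ • (q : Vec d)⟫_ℝ - (∑ j, ⟪(u j : Vec d), δ • (q : Vec d)⟫_ℝ) / n))
        * ramp τ ⟪(v : Vec d), (u i : Vec d)⟫_ℝ) / n := by
    rw [predErr_zero, predErr, predSlope, sub_sub_sub_cancel_right, eq_div_iff hn, sub_mul, sub_mul,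
      div_mul_cancel₀ _ hn, mul_assoc, div_mul_cancel₀ _ hn, Finset.sum_mul, Finset.mul_sum,
      ← Finset.sum_sub_distrib, ← Finset.sum_sub_distrib]
    simp only [real_inner_smul_right, ← Finset.mul_sum]
    exact Finset.sum_congr rfl fun i _ => by ring
  rw [e]
  refine abs_sum_div_le fun i => ?_
  rw [abs_mul]
  exact (mul_le_of_le_one_right (abs_nonneg _) (abs_ramp_inner_le h0 h1 v (u i))).trans
    (abs_mul_softWeight_sub_le hδ0 hδ (fun i => abs_inner_smul_le hδ0 q (u i)) i)

theorem abs_predSlope_le {τ : ℝ} (h0 : 0 ≤ τ) (h1 : τ ≤ 1) (q v : Sph d) (u : Fin n → Sph d) :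
    |predSlope τ q v u| ≤ 2 := by
  refine abs_sum_div_le fun i => ?_
  rw [abs_mul]
  refine (mul_le_of_le_one_right (abs_nonneg _) (abs_ramp_inner_le h0 h1 v (u i))).trans ?_
  refine (abs_sub _ _).trans ?_
  have := abs_sum_div_le fun i => abs_inner_sph_le (u i) q
  linarith [abs_inner_sph_le (u i) q]

/-- A difference of squares: the errors differ by at most `20 * w` and are bounded by two. -/
theorem le_biasAt_small {τ : ℝ} (h0 : 0 ≤ τ) (h1 : τ ≤ 1) {w : ℝ} (hw0 : 0 ≤ w)
    (hw : w ≤ 1) (q : Sph d) :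
    biasAt τ n 0 (q : Vec d) - 80 * w ≤ biasAt τ n (w • (q : Vec d)) q := by
  have h : biasAt τ n 0 (q : Vec d) ≤ ∫ p : Sph d × (Fin n → Sph d),
      (predErr τ (w • (q : Vec d)) q p.1 p.2 ^ 2 + 80 * w)
        ∂((sphMeasure d).prod (sphPi d n)) := by
    refine integral_mono (integrable_of_continuous (by fun_prop))
      (integrable_of_continuous (by fun_prop)) fun p => ?_
    have h2 := abs_le.1 (abs_predErr_sub_zero_le h0 h1 hw0 hw q p.1 p.2)
    have h3 := abs_le.1 (abs_predErr_le_two h0 h1 (w • (q : Vec d)) q p.1 p.2)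
    have h4 := abs_le.1 (abs_predErr_le_two h0 h1 0 q p.1 p.2)
    beta_reduce
    generalize predErr τ (w • (q : Vec d)) q p.1 p.2 = x at *
    generalize predErr τ 0 q p.1 p.2 = y at *
    rcases le_total 0 (x + y) with h | h <;> nlinarith
  rw [integral_add (integrable_of_continuous (by fun_prop)) (integrable_const _), integral_const,
    probReal_univ, one_smul] at h
  unfold biasAt at *
  linarith

/-- The constant is `4 + 144 + 324`: the squared slope, the cross term with the Taylor remainder,
and the squared remainder. -/
theorem biasAt_small_le_slope {τ : ℝ} (h0 : 0 ≤ τ) (h1 : τ ≤ 1) {δ : ℝ} (hδ0 : 0 ≤ δ)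
    (hδ : δ ≤ 1) (q : Sph d) :
    biasAt τ n (δ • (q : Vec d)) q ≤ biasAt τ n 0 (q : Vec d) + 2 * δ * (∫ p : Sph d × (Fin n → Sph d),
      predErr τ 0 q p.1 p.2 * predSlope τ q p.1 p.2 ∂((sphMeasure d).prod (sphPi d n)))
        + 472 * δ ^ 2 := by
  have h : biasAt τ n (δ • (q : Vec d)) q ≤ ∫ p : Sph d × (Fin n → Sph d),
      (predErr τ 0 q p.1 p.2 ^ 2 + 2 * δ * (predErr τ 0 q p.1 p.2 * predSlope τ q p.1 p.2)
        + 472 * δ ^ 2) ∂((sphMeasure d).prod (sphPi d n)) := by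
    refine integral_mono (integrable_of_continuous (by fun_prop))
      (integrable_of_continuous (by fun_prop)) fun p => ?_
    have h2 := abs_le.1 (abs_predErr_sub_slope_le h0 h1 hδ0 hδ q p.1 p.2)
    have h3 := abs_le.1 (abs_predSlope_le h0 h1 q p.1 p.2)
    have h4 := abs_le.1 (abs_predErr_le_two h0 h1 0 q p.1 p.2)
    beta_reduce
    generalize predErr τ (δ • (q : Vec d)) q p.1 p.2 = x at *
    generalize predErr τ 0 q p.1 p.2 = y at *
    generalize predSlope τ (q : Vec d) p.1 p.2 = z at *
    obtain ⟨r, hr⟩ : ∃ r, r = x - y - δ * z := ⟨_, rfl⟩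
    rw [← hr] at h2
    have ex : x = y + δ * z + r := by linarith
    have hr2 : r ^ 2 ≤ (18 * δ ^ 2) ^ 2 := sq_le_sq' h2.1 h2.2
    have hδ2 : (18 * δ ^ 2) ^ 2 ≤ 324 * δ ^ 2 := by
      have : δ ^ 2 ≤ 1 := pow_le_one₀ hδ0 hδ
      nlinarith [sq_nonneg δ]
    have hz2 : (δ * z) ^ 2 ≤ 4 * δ ^ 2 := by
      have : z ^ 2 ≤ 2 ^ 2 := sq_le_sq' (by linarith) h3.2
      nlinarith [sq_nonneg δ]
    have hdz : |y + δ * z| ≤ 4 := abs_le.2 ⟨by nlinarith, by nlinarith⟩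
    have hcr : (y + δ * z) * r ≤ 4 * (18 * δ ^ 2) := by
      refine (le_abs_self _).trans ?_
      rw [abs_mul]
      exact mul_le_mul hdz (abs_le.2 h2) (abs_nonneg _) (by norm_num)
    rw [ex]
    nlinarith
  rw [integral_add (integrable_of_continuous (by fun_prop)) (integrable_const _), integral_const,
    probReal_univ, one_smul, integral_add (integrable_of_continuous (by fun_prop))
    (integrable_of_continuous (by fun_prop)), integral_const_mul] at h
  exact h

/-- By antipodal symmetry only the odd part of the ramp counts, and that part is linear with slope
`(1+τ)/2`. -/
theorem integral_inner_mul_ramp (τ : ℝ) (y z : Vec d) :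
    ∫ u : Sph d, ⟪(u : Vec d), y⟫_ℝ * ramp τ ⟪(u : Vec d), z⟫_ℝ ∂(sphMeasure d)
      = (1 + τ) / 2 * secondMoment d * ⟪y, z⟫_ℝ := by
  have h := integral_rot (f := fun u : Sph d => ⟪(u : Vec d), y⟫_ℝ * ramp τ ⟪(u : Vec d), z⟫_ℝ)
    (by fun_prop) (LinearIsometryEquiv.neg ℝ)
  simp only [coe_rot, LinearIsometryEquiv.coe_neg, inner_neg_left, neg_mul] at h
  have e : ∀ u : Sph d, ⟪(u : Vec d), y⟫_ℝ * ramp τ ⟪(u : Vec d), z⟫_ℝ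
      = (1 + τ) * (⟪(u : Vec d), y⟫_ℝ * ⟪(u : Vec d), z⟫_ℝ)
        - -(⟪(u : Vec d), y⟫_ℝ * ramp τ (-⟪(u : Vec d), z⟫_ℝ)) := fun u => by
    linear_combination ⟪(u : Vec d), y⟫_ℝ * ramp_sub_ramp_neg τ ⟪(u : Vec d), z⟫_ℝ
  have h2 := integral_congr_ae (μ := sphMeasure d) (Filter.Eventually.of_forall e)
  rw [integral_sub (integrable_of_continuous (by fun_prop))
    (integrable_of_continuous (by fun_prop)), integral_const_mul, integral_inner_mul_inner, h] at h2
  linarith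

theorem integral_predSlope (τ : ℝ) (q : Vec d) (v : Sph d) :
    ∫ u : Fin n → Sph d, predSlope τ q v u ∂(sphPi d n)
      = (1 - 1 / n) * ((1 + τ) / 2 * secondMoment d * ⟪(v : Vec d), q⟫_ℝ) := by
  have hn : (n : ℝ) ≠ 0 := by exact_mod_cast NeZero.ne n
  set G := (1 + τ) / 2 * secondMoment d * ⟪(v : Vec d), q⟫_ℝ with hG
  have hf : Continuous fun u : Sph d => ⟪(u : Vec d), q⟫_ℝ := by fun_prop
  have hg : Continuous fun u : Sph d => ramp τ ⟪(v : Vec d), (u : Vec d)⟫_ℝ := by fun_prop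
  have hd : ∀ i : Fin n, ∫ u : Fin n → Sph d,
      ⟪(u i : Vec d), q⟫_ℝ * ramp τ ⟪(v : Vec d), (u i : Vec d)⟫_ℝ ∂(sphPi d n) = G := fun i => by
    rw [integral_sphPi_eval (f := fun u : Sph d => ⟪(u : Vec d), q⟫_ℝ
      * ramp τ ⟪(v : Vec d), (u : Vec d)⟫_ℝ) (by fun_prop) i, hG, real_inner_comm,
      ← integral_inner_mul_ramp]
    simp only [real_inner_comm (v : Vec d)]
  have ho : ∀ i j : Fin n, ∫ u : Fin n → Sph d,
      ⟪(u j : Vec d), q⟫_ℝ * ramp τ ⟪(v : Vec d), (u i : Vec d)⟫_ℝ ∂(sphPi d n)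
        = if j = i then G else 0 := fun i j => by
    split_ifs with h
    · rw [h]; exact hd i
    · rw [integral_sphPi_mul hf hg h]
      have h0 : ∫ u : Sph d, ⟪(u : Vec d), q⟫_ℝ ∂(sphMeasure d) = 0 := by
        have := integral_rot hf (LinearIsometryEquiv.neg ℝ)
        simp only [coe_rot, LinearIsometryEquiv.coe_neg, inner_neg_left, integral_neg] at this
        linarith
      rw [h0, zero_mul]
  simp only [predSlope, sub_mul, Finset.sum_sub_distrib, div_mul_eq_mul_div, Finset.sum_mul]
  rw [integral_div, integral_sub (integrable_of_continuous (by fun_prop))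
    (integrable_of_continuous (by fun_prop)),
    integral_finsetSum _ fun i _ => integrable_of_continuous (by fun_prop),
    integral_finsetSum _ fun i _ => integrable_of_continuous (by fun_prop)]
  have h1 : ∀ i : Fin n, ∫ u : Fin n → Sph d, (∑ j, ⟪(u j : Vec d), q⟫_ℝ
      * ramp τ ⟪(v : Vec d), (u i : Vec d)⟫_ℝ) / n ∂(sphPi d n) = G / n := fun i => by
    rw [integral_div, integral_finsetSum _ fun i _ => integrable_of_continuous (by fun_prop)]
    simp [ho]
  simp only [hd, h1, Finset.sum_const, Finset.card_univ, Fintype.card_fin, nsmul_eq_mul]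
  field_simp

/-- Negating the direction and all context points fixes the averaged labels and negates the slope,
so only the query's own label correlates with the slope. This makes half the derivative of the bias
at zero negative, uniformly for `n ≥ 2`. -/
theorem integral_predErr_mul_slope (τ : ℝ) (q : Sph d) :
    ∫ p : Sph d × (Fin n → Sph d), predErr τ 0 q p.1 p.2 * predSlope τ q p.1 p.2
        ∂((sphMeasure d).prod (sphPi d n))
      = -((1 - 1 / n) * ((1 + τ) / 2 * secondMoment d) ^ 2) := by
  have h1 : ∫ p : Sph d × (Fin n → Sph d), (∑ i, ramp τ ⟪(p.1 : Vec d), (p.2 i : Vec d)⟫_ℝ) / n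
      * predSlope τ q p.1 p.2 ∂((sphMeasure d).prod (sphPi d n)) = 0 := by
    have h := integral_comp_of_continuous
      ((measurePreserving_rot (d := d) (LinearIsometryEquiv.neg ℝ)).prod
        (measurePreserving_sphPi fun _ : Fin n => measurePreserving_rot (LinearIsometryEquiv.neg ℝ)))
      (f := fun p : Sph d × (Fin n → Sph d) => (∑ i, ramp τ ⟪(p.1 : Vec d), (p.2 i : Vec d)⟫_ℝ) / n
        * predSlope τ q p.1 p.2) (by fun_prop)
    have e : ∀ p : Sph d × (Fin n → Sph d), predSlope τ q (rot (LinearIsometryEquiv.neg ℝ) p.1)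
        (fun i => rot (LinearIsometryEquiv.neg ℝ) (p.2 i)) = -predSlope τ q p.1 p.2 := fun p => by
      simp only [predSlope, coe_rot, LinearIsometryEquiv.coe_neg, inner_neg_left, inner_neg_right,
        neg_neg, Finset.sum_neg_distrib]
      rw [← neg_div]
      refine congrArg (· / (n : ℝ)) ?_
      refine Eq.trans (Finset.sum_congr rfl fun i _ => ?_) (Finset.sum_neg_distrib _)
      ring
    simp only [Prod.map, e, coe_rot, LinearIsometryEquiv.coe_neg, inner_neg_left, inner_neg_right,
        neg_neg, mul_neg, integral_neg] at h
    linarith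
  have h2 : ∫ p : Sph d × (Fin n → Sph d), ramp τ ⟪(p.1 : Vec d), (q : Vec d)⟫_ℝ
      * predSlope τ q p.1 p.2 ∂((sphMeasure d).prod (sphPi d n))
      = (1 - 1 / n) * ((1 + τ) / 2 * secondMoment d) ^ 2 := by
    rw [integral_prod _ (integrable_of_continuous (by fun_prop))]
    simp only [integral_const_mul, integral_predSlope]
    have e : ∀ v : Sph d, ramp τ ⟪(v : Vec d), (q : Vec d)⟫_ℝ
        * ((1 - 1 / n) * ((1 + τ) / 2 * secondMoment d * ⟪(v : Vec d), (q : Vec d)⟫_ℝ))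
        = (1 - 1 / n) * ((1 + τ) / 2 * secondMoment d)
          * (⟪(v : Vec d), (q : Vec d)⟫_ℝ * ramp τ ⟪(v : Vec d), (q : Vec d)⟫_ℝ) := fun v => by ring
    simp only [e]
    rw [integral_const_mul, integral_inner_mul_ramp, inner_sph_self]
    ring
  have e : ∀ p : Sph d × (Fin n → Sph d), predErr τ 0 q p.1 p.2 * predSlope τ q p.1 p.2
      = (∑ i, ramp τ ⟪(p.1 : Vec d), (p.2 i : Vec d)⟫_ℝ) / n * predSlope τ q p.1 p.2
        - ramp τ ⟪(p.1 : Vec d), (q : Vec d)⟫_ℝ * predSlope τ q p.1 p.2 := fun p => by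
    rw [predErr_zero, sub_mul]
  simp only [e]
  rw [integral_sub (integrable_of_continuous (by fun_prop))
    (integrable_of_continuous (by fun_prop)), h1, h2, zero_sub]

theorem biasAt_small_le {τ : ℝ} (h0 : 0 ≤ τ) (h1 : τ ≤ 1) (hn : 2 ≤ n) {δ : ℝ} (hδ0 : 0 ≤ δ)
    (hδ : δ ≤ 1) (q : Sph d) :
    biasAt τ n (δ • (q : Vec d)) q
      ≤ biasAt τ n 0 (q : Vec d) - secondMoment d ^ 2 / 4 * δ + 472 * δ ^ 2 := by
  have h := biasAt_small_le_slope (n := n) h0 h1 hδ0 hδ q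
  rw [integral_predErr_mul_slope] at h
  have hn' : (1 : ℝ) / n ≤ 1 / 2 := by
    have : (2 : ℝ) ≤ n := by exact_mod_cast hn
    gcongr
  have h2 : secondMoment d ^ 2 / 4 ≤ ((1 + τ) / 2 * secondMoment d) ^ 2 := by
    have : (1 / 2 * secondMoment d) ^ 2 ≤ ((1 + τ) / 2 * secondMoment d) ^ 2 := by
      have := (secondMoment_pos (d := d)).le
      gcongr
      linarith
    nlinarith
  have h3 : secondMoment d ^ 2 / 8 ≤ (1 - 1 / n) * ((1 + τ) / 2 * secondMoment d) ^ 2 := by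
    nlinarith [sq_nonneg (secondMoment d)]
  nlinarith

end

/-! ### Power-law bounds, and why the minimizer stays away from zero. -/

section
variable [NeZero d]

theorem exists_noiseAt_le (d : ℕ) [NeZero d] : ∃ C : ℝ, 0 < C ∧
    ∀ (n : ℕ) [NeZero n] (q : Sph d) (w : ℝ), 1 ≤ w →
      noiseAt n (w • (q : Vec d)) ≤ C * w ^ (((d : ℝ) - 1) / 2) / n := by
  obtain ⟨c, hc, H⟩ := exists_le_gibbsMass d
  refine ⟨20 / c, by positivity, fun n _ q w hw => ?_⟩
  have hn : (0 : ℝ) < n := Nat.cast_pos.2 (NeZero.pos n)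
  have hw0 : 0 < w := by linarith
  have h1 := H q w hw
  rw [Real.rpow_neg hw0.le] at h1
  refine (noiseAt_le hw0.le q).trans ?_
  have hX := Real.rpow_pos_of_pos hw0 (((d : ℝ) - 1) / 2)
  generalize w ^ (((d : ℝ) - 1) / 2) = X at *
  calc 20 / (n * gibbsMass w q) ≤ 20 / (n * (c * X⁻¹)) := by gcongr
    _ = _ := by field_simp

/-- The condition `w^k ≤ n` keeps the effective number of attended points bounded below, so the `1`
in the denominator of `le_noiseAt` is absorbed. -/
theorem exists_le_noiseAt (d : ℕ) [NeZero d] : ∃ c : ℝ, 0 < c ∧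
    ∀ (n : ℕ) [NeZero n] (q : Sph d) (w : ℝ), 1 ≤ w → w ^ (((d : ℝ) - 1) / 2) ≤ n →
      c * w ^ (((d : ℝ) - 1) / 2) / n ≤ noiseAt n (w • (q : Vec d)) := by
  obtain ⟨c, hc, H⟩ := exists_le_gibbsMass d
  obtain ⟨C, hC, H'⟩ := exists_gibbsMass_le d
  refine ⟨c * 2 ^ (-(((d : ℝ) - 1) / 2)) / (1 + C) ^ 2, by positivity, fun n _ q w hw hwn => ?_⟩
  have hn : (0 : ℝ) < n := Nat.cast_pos.2 (NeZero.pos n)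
  have hw0 : 0 < w := by linarith
  have h1 := H q (2 * w) (by linarith)
  have h2 := H' q w hw0
  rw [Real.mul_rpow zero_le_two hw0.le] at h1
  refine le_trans ?_ (le_noiseAt hw0.le q n)
  rw [Real.rpow_neg hw0.le] at h1 h2
  have hX := Real.rpow_pos_of_pos hw0 (((d : ℝ) - 1) / 2)
  have hm := gibbsMass_pos w q
  have hm2 := (gibbsMass_pos (2 * w) q).le
  have h2k : (0 : ℝ) < 2 ^ (-(((d : ℝ) - 1) / 2)) := by positivity
  generalize w ^ (((d : ℝ) - 1) / 2) = X at *
  generalize (2 : ℝ) ^ (-(((d : ℝ) - 1) / 2)) = b at *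
  have h3 : 1 + n * gibbsMass w q ≤ (1 + C) * (n * X⁻¹) := by
    have e1 : 1 ≤ n * X⁻¹ := by rw [← div_eq_mul_inv]; exact (one_le_div hX).2 hwn
    have e2 : n * gibbsMass w q ≤ n * (C * X⁻¹) := by gcongr
    nlinarith
  calc c * b / (1 + C) ^ 2 * X / n = n * (c * (b * X⁻¹)) / ((1 + C) * (n * X⁻¹)) ^ 2 := by
        field_simp
    _ ≤ n * gibbsMass (2 * w) q / (1 + n * gibbsMass w q) ^ 2 := by gcongr

theorem exp_neg_le_div_pow_four {y : ℝ} (hy : 0 < y) : Real.exp (-y) ≤ 24 / y ^ 4 := by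
  have h := Real.pow_div_factorial_le_exp y hy.le 4
  rw [Real.exp_neg, ← one_div, div_le_div_iff₀ (Real.exp_pos _) (by positivity)]
  rw [div_le_iff₀ (by positivity)] at h
  norm_num [Nat.factorial] at h
  linarith

/-- The condition on `n` says exactly that the sampling term `w^(k-1)/n` is at most of order
`w^(-γ)`. It also makes `n` times the mass at least of order `w^(γ-1)`, which controls the
exponential term. -/
theorem exists_biasAt_le {τ γ : ℝ} (h0 : 0 ≤ τ) (h1 : τ ≤ 1) (hγ : 4 / 3 ≤ γ) {C₃ : ℝ}
    (hC₃ : 0 < C₃) (hW : ∀ (q : Sph d) (w : ℝ), 1 ≤ w →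
      ∫ v, (∫ u, wdev τ w q v u ∂(sphMeasure d)) ^ 2 ∂(sphMeasure d)
        ≤ C₃ * w ^ (-γ - 2 * (((d : ℝ) - 1) / 2))) {C₁ : ℝ} (hC₁ : 0 < C₁) :
    ∃ C : ℝ, 0 < C ∧ ∀ (n : ℕ) [NeZero n] (q : Sph d) (w : ℝ), 1 ≤ w →
      w ^ (((d : ℝ) - 1) / 2 + γ - 1) ≤ C₁ * n →
      biasAt τ n (w • (q : Vec d)) q ≤ C * w ^ (-γ) := by
  obtain ⟨c, hc, H⟩ := exists_le_gibbsMass d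
  obtain ⟨C₂, hC₂, H₂⟩ := exists_gibbs_moment_le d
  refine ⟨96 / (c / (16 * C₁)) ^ 4 + 8 * C₂ * C₁ / c ^ 2 + 4 * C₃ / c ^ 2, by positivity,
    fun n _ q w hw hwn => ?_⟩
  have hn : (0 : ℝ) < n := Nat.cast_pos.2 (NeZero.pos n)
  have hw0 : 0 < w := by linarith
  have hm := H q w hw
  have hI := H₂ q 1 w zero_le_one one_le_two hw0
  have hV := hW q w hw
  simp only [Real.rpow_one] at hI
  refine (biasAt_le h0 h1 hw0.le q).trans ?_
  set k : ℝ := ((d : ℝ) - 1) / 2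
  have hX : 0 < w ^ (-k) := by positivity
  have hP : 0 < w ^ (γ - 1) := by positivity
  have e1 : w ^ (k + γ - 1) = w ^ (γ - 1) / w ^ (-k) := by
    rw [← Real.rpow_sub hw0]; congr 1; ring
  have e2 : w ^ (-1 - k) = w ^ (-k) / w := by
    rw [sub_eq_add_neg, Real.rpow_add hw0, Real.rpow_neg_one]; field_simp
  have e3 : w ^ (-γ - 2 * k) = w ^ (-γ) * (w ^ (-k)) ^ 2 := by
    rw [← Real.rpow_mul_natCast hw0.le, ← Real.rpow_add hw0]; congr 1; push_cast; ring
  have e4 : w ^ (-γ) = 1 / (w ^ (γ - 1) * w) := by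
    rw [Real.rpow_neg hw0.le, ← one_div]; congr 1
    nth_rewrite 3 [← Real.rpow_one w]
    rw [← Real.rpow_add hw0]; congr 1; ring
  -- This is `γ ≤ 4(γ - 1)`, the only use of `γ ≥ 4/3`; it turns the bound `exp (-y) ≤ 24/y⁴` into
  -- order `w^(-γ)`.
  have e5 : w ^ (γ - 1) * w ≤ (w ^ (γ - 1)) ^ 4 := by
    rw [← Real.rpow_mul_natCast hw0.le]
    nth_rewrite 2 [← Real.rpow_one w]
    rw [← Real.rpow_add hw0]
    exact Real.rpow_le_rpow_of_exponent_le hw (by push_cast; linarith)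
  have hγ0 : 0 < w ^ (-γ) := by positivity
  rw [e1] at hwn
  rw [e2] at hI
  rw [e3] at hV
  have hmp := gibbsMass_pos w q
  generalize w ^ (-k) = X at *
  generalize w ^ (γ - 1) = P at *
  generalize gibbsMass w q = m at *
  generalize w ^ (-γ) = Γ at *
  rw [div_le_iff₀ hX] at hwn
  have t1 : 4 * Real.exp (-(n * m / 16)) ≤ 96 / (c / (16 * C₁)) ^ 4 * Γ := by
    have hy : c / (16 * C₁) * P ≤ n * m / 16 := by
      rw [div_mul_eq_mul_div, div_le_div_iff₀ (by positivity) (by norm_num)]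
      calc c * P * 16 ≤ c * (C₁ * n * X) * 16 := by gcongr
        _ = n * (c * X) * (16 * C₁) := by ring
        _ ≤ n * m * (16 * C₁) := by gcongr
    have hy0 : 0 < c / (16 * C₁) * P := by positivity
    calc 4 * Real.exp (-(n * m / 16)) ≤ 4 * Real.exp (-(c / (16 * C₁) * P)) := by gcongr
      _ ≤ 4 * (24 / (c / (16 * C₁) * P) ^ 4) := by
          gcongr; exact exp_neg_le_div_pow_four hy0
      _ = 96 / (c / (16 * C₁)) ^ 4 * (1 / P ^ 4) := by rw [mul_pow]; field_simp; norm_num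
      _ ≤ 96 / (c / (16 * C₁)) ^ 4 * Γ := by rw [e4]; gcongr
  have t2 : 8 * (∫ u, gibbs w q u * gap q u ∂(sphMeasure d)) / (n * m ^ 2)
      ≤ 8 * C₂ * C₁ / c ^ 2 * Γ := by
    calc _ ≤ 8 * (C₂ * (X / w)) / (n * (c * X) ^ 2) := by gcongr
      _ = 8 * C₂ / c ^ 2 * (1 / (n * X * w)) := by field_simp
      _ ≤ 8 * C₂ / c ^ 2 * (1 / (P / C₁ * w)) := by
          gcongr
          rw [div_le_iff₀ hC₁]; linarith
      _ = 8 * C₂ * C₁ / c ^ 2 * Γ := by rw [e4]; field_simp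
  have t3 : 4 * (∫ v, (∫ u, wdev τ w q v u ∂(sphMeasure d)) ^ 2 ∂(sphMeasure d)) / m ^ 2
      ≤ 4 * C₃ / c ^ 2 * Γ := by
    calc _ ≤ 4 * (C₃ * (Γ * X ^ 2)) / (c * X) ^ 2 := by gcongr
      _ = _ := by field_simp
  linarith

theorem exists_le_biasAt (d : ℕ) [NeZero d] (hd : 2 ≤ d) : ∃ c : ℝ, 0 < c ∧
    ∀ (τ : ℝ), 0 ≤ τ → ∀ (n : ℕ) [NeZero n] (q : Sph d) (w : ℝ), 0 ≤ w →
      c / (1 + w) ^ 2 ≤ biasAt τ n (w • (q : Vec d)) q := by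
  obtain ⟨c, hc, H⟩ := exists_le_attendedGap d hd
  have hm := secondMoment_pos (d := d)
  refine ⟨secondMoment d * c ^ 2 / 4, by positivity, fun τ hτ n _ q w hw => ?_⟩
  have h1 := biasAt_one_le hτ n (w • (q : Vec d)) q
  have h2 := le_biasAt_one (n := n) w q
  have h3 : secondMoment d * (c / (1 + w)) ^ 2 ≤ secondMoment d * attendedGap n w q ^ 2 := by
    have := H n q w hw
    have : 0 ≤ c / (1 + w) := by positivity
    gcongr
  calc secondMoment d * c ^ 2 / 4 / (1 + w) ^ 2 = secondMoment d * (c / (1 + w)) ^ 2 / 4 := by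
        rw [div_pow]; ring
    _ ≤ _ := by linarith

/-- A minimizing inverse temperature is bounded away from zero. -/
theorem exists_le_of_isMin (d : ℕ) [NeZero d] {K : ℝ} (hK : 0 < K) : ∃ c : ℝ, 0 < c ∧
    ∀ (τ : ℝ), 0 ≤ τ → τ ≤ 1 → ∀ (n : ℕ) [NeZero n], 2 ≤ n → ∀ (a s : ℝ), 0 < a → 0 < s →
      s ≤ K * (n * a) → ∀ (q : Sph d) (w : ℝ), 0 ≤ w →
      (∀ w' : ℝ, 0 ≤ w' → pointLoss τ a s n (w • (q : Vec d)) q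
        ≤ pointLoss τ a s n (w' • (q : Vec d)) q) → c ≤ w := by
  have hm := secondMoment_pos (d := d)
  set e := secondMoment d ^ 2 / 4 with he
  have he0 : 0 < e := by positivity
  -- At the competitor `δ` the linear gain `e * δ` is at least twice the quadratic losses of bias
  -- (472) and noise (`400 * K`). If `w` were below `e * δ / 160`, its bias gain `80 * w` could not
  -- make up the other half.
  set δ := min 1 (e / (2 * (472 + 400 * K))) with hδ
  have hδ0 : 0 < δ := lt_min one_pos (by positivity)
  have hδ1 : δ ≤ 1 := min_le_left _ _
  have hδ2 : (472 + 400 * K) * δ ≤ e / 2 := by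
    have : δ ≤ e / (2 * (472 + 400 * K)) := min_le_right _ _
    rw [le_div_iff₀ (by positivity)] at this
    linarith
  refine ⟨min 1 (e * δ / 160), lt_min one_pos (by positivity),
    fun τ h0 h1 n _ hn a s ha hs hsK q w hw hmin => ?_⟩
  have hn0 : (0 : ℝ) < n := Nat.cast_pos.2 (NeZero.pos n)
  by_contra! hlt
  have hw1 : w ≤ 1 := (hlt.trans_le (min_le_left _ _)).le
  have hw2 : w < e * δ / 160 := hlt.trans_le (min_le_right _ _)
  have hc := hmin δ hδ0.le
  simp only [pointLoss] at hc
  have b1 := le_biasAt_small (n := n) h0 h1 hw hw1 q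
  have b2 := biasAt_small_le h0 h1 hn hδ0.le hδ1 q
  have n1 := inv_le_noiseAt (n := n) (w • (q : Vec d))
  have n2 := noiseAt_small_le (n := n) hδ0.le hδ1 q
  rw [← he] at b2
  generalize biasAt τ n (w • (q : Vec d)) q = B at *
  generalize biasAt τ n (δ • (q : Vec d)) q = B' at *
  generalize biasAt τ n 0 (q : Vec d) = B₀ at *
  generalize noiseAt n (w • (q : Vec d)) = N at *
  generalize noiseAt n (δ • (q : Vec d)) = N' at *
  have hsn : s / n ≤ K * a := by
    rw [div_le_iff₀ hn0]; linarith
  have c1 : s * N' - s * N ≤ K * a * (400 * δ ^ 2) := by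
    have : s * N' - s * N ≤ s * ((1 + 400 * δ ^ 2) / n - 1 / n) := by
      rw [← mul_sub]; gcongr
    calc _ ≤ _ := this
      _ = s / n * (400 * δ ^ 2) := by ring
      _ ≤ _ := by gcongr
  have c2 : a * B - a * B' ≤ K * a * (400 * δ ^ 2) := by linarith
  have c3 : B - B' ≤ 400 * K * δ ^ 2 := by
    refine le_of_mul_le_mul_left ?_ ha
    linarith
  have c4 : e * δ ≤ 80 * w + (472 + 400 * K) * δ * δ := by nlinarith
  nlinarith

end

/-! ### Location of the minimizing inverse temperature. -/

theorem exists_forall_rpow_mul_le {θ : ℝ} (hθ : θ < 1) (C D : ℝ) (hC : 0 ≤ C) :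
    ∃ n₀ : ℕ, ∀ n : ℕ, n₀ ≤ n → D * (C * n) ^ θ ≤ n := by
  have h := (tendsto_rpow_atTop (sub_pos.2 hθ)).comp tendsto_natCast_atTop_atTop
  obtain ⟨N, hN⟩ := Filter.eventually_atTop.1 (h.eventually_ge_atTop (D * C ^ θ))
  refine ⟨max N 1, fun n hn => ?_⟩
  have hn1 : (0 : ℝ) < n := by exact_mod_cast lt_of_lt_of_le one_pos ((le_max_right N 1).trans hn)
  have h1 : D * C ^ θ ≤ (n : ℝ) ^ (1 - θ) := hN n ((le_max_left N 1).trans hn)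
  calc D * (C * n) ^ θ = D * C ^ θ * (n : ℝ) ^ θ := by
        rw [Real.mul_rpow hC hn1.le]; ring
    _ ≤ (n : ℝ) ^ (1 - θ) * (n : ℝ) ^ θ := by gcongr
    _ = n := by rw [← Real.rpow_add hn1]; simp

set_option maxHeartbeats 1000000 in
/-- Location of the minimizing inverse temperature. -/
theorem exists_bounds_of_isMin [NeZero d] (hd : 2 ≤ d) {τ γ : ℝ} (h0 : 0 ≤ τ) (h1 : τ ≤ 1)
    (hγ : 4 / 3 ≤ γ) {C₃ : ℝ} (hC₃ : 0 < C₃) (hW : ∀ (q : Sph d) (w : ℝ), 1 ≤ w →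
      ∫ v, (∫ u, wdev τ w q v u ∂(sphMeasure d)) ^ 2 ∂(sphMeasure d)
        ≤ C₃ * w ^ (-γ - 2 * (((d : ℝ) - 1) / 2)))
    {κ K η : ℝ} (hκ : 0 < κ) (hK : 0 < K)
    (hη : (1 + η) * (((d : ℝ) - 1) / 2 + γ - 1) ≤ ((d : ℝ) - 1) / 2 + γ) :
    ∃ (n₀ : ℕ) (c C : ℝ), 0 < c ∧ 0 < C ∧ ∀ (n : ℕ) [NeZero n], 2 ≤ n → n₀ ≤ n →
      ∀ (a s : ℝ), 0 < a → 0 < s → s ≤ K * (n * a) → κ * (a * (n : ℝ) ^ (-η)) ≤ s →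
      ∀ (q : Sph d) (w : ℝ), 0 ≤ w →
      (∀ w' : ℝ, 0 ≤ w' → pointLoss τ a s n (w • (q : Vec d)) q
        ≤ pointLoss τ a s n (w' • (q : Vec d)) q) →
      c * (K * (n * a) / s) ^ (γ / (2 * (((d : ℝ) - 1) / 2 + γ))) ≤ w ∧
        w ≤ C * (K * (n * a) / s) ^ (1 / (((d : ℝ) - 1) / 2 + γ)) := by
  have hd' : (2 : ℝ) ≤ d := by exact_mod_cast hd
  obtain ⟨Cu, hCu, Hu⟩ := exists_noiseAt_le d
  obtain ⟨cl, hcl, Hl⟩ := exists_le_noiseAt d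
  obtain ⟨cb, hcb, Hb⟩ := exists_le_biasAt d hd
  obtain ⟨cs, hcs, Hs⟩ := exists_le_of_isMin d hK
  set k : ℝ := ((d : ℝ) - 1) / 2 with hk
  have hk0 : 0 < k := by rw [hk]; linarith
  have hkγ : 0 < k + γ := by linarith
  set p : ℝ := (k + γ - 1) / (k + γ) with hp
  have hp0 : 0 < p := div_pos (by linarith) hkγ
  set C₁ : ℝ := (K / κ) ^ p with hC₁
  have hC₁0 : 0 < C₁ := by positivity
  obtain ⟨Cv, hCv, Hv⟩ := exists_biasAt_le h0 h1 hγ hC₃ hW hC₁0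
  rw [← hk] at Hv
  set C₂ : ℝ := Cv + Cu * K with hC₂
  have hC₂0 : 0 < C₂ := by positivity
  -- Chosen so that the noise at `D * w₀` alone exceeds the total loss allowed at the minimizer.
  set D : ℝ := ((C₂ / K + 1) / cl) ^ (1 / k) + 1 with hD
  have hD1 : 1 ≤ D := le_add_of_nonneg_left (by positivity)
  have hDk : C₂ / K < cl * D ^ k := by
    have : (C₂ / K + 1) / cl ≤ D ^ k := by
      calc (C₂ / K + 1) / cl = (((C₂ / K + 1) / cl) ^ (1 / k)) ^ k := by
            rw [← Real.rpow_mul (by positivity), one_div_mul_cancel hk0.ne', Real.rpow_one]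
        _ ≤ D ^ k := Real.rpow_le_rpow (by positivity) (by rw [hD]; linarith) hk0.le
    rw [div_le_iff₀ hcl] at this
    linarith
  -- Since `γ > 1`, the bound `w₀^(k+γ-1) ≲ n` gives `w₀^k = o(n)`; so for large `n` the noise lower
  -- bound applies at `D * w₀`.
  obtain ⟨n₀, hn₀⟩ := exists_forall_rpow_mul_le (θ := k / (k + γ - 1))
    ((div_lt_one (by linarith)).2 (by linarith)) C₁ (D ^ k) hC₁0.le
  refine ⟨n₀, Real.sqrt (cb / C₂) / (1 + 1 / cs), D, by positivity, by linarith,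
    fun n _ hn2 hn a s ha hs hsK hκs q w hw hmin => ?_⟩
  have hn0 : (0 : ℝ) < n := Nat.cast_pos.2 (NeZero.pos n)
  have hn1 : (1 : ℝ) ≤ n := by exact_mod_cast NeZero.one_le
  set x : ℝ := K * (n * a) / s with hx
  have hx1 : 1 ≤ x := (one_le_div hs).2 hsK
  have hx0 : 0 < x := by linarith
  set w₀ : ℝ := x ^ (1 / (k + γ)) with hw₀
  have hw₀1 : 1 ≤ w₀ := Real.one_le_rpow hx1 (by positivity)
  have hw₀0 : 0 < w₀ := by linarith
  have hpow : ∀ e : ℝ, w₀ ^ e = x ^ (e / (k + γ)) := fun e => by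
    rw [hw₀, ← Real.rpow_mul hx0.le]; congr 1; ring
  have hxle : x ≤ K / κ * (n : ℝ) ^ (1 + η) := by
    rw [hx, div_le_iff₀ hs]
    calc K * (n * a) = K / κ * (n : ℝ) ^ (1 + η) * (κ * (a * (n : ℝ) ^ (-η))) := by
          rw [Real.rpow_add hn0, Real.rpow_one, Real.rpow_neg hn0.le]; field_simp
      _ ≤ _ := by gcongr
  -- The lower bound on `s` gives `x ≲ n^(1+η)`, and `hη` says that the resulting power of `n` is at
  -- most one.
  have hw₀n : w₀ ^ (k + γ - 1) ≤ C₁ * n := by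
    rw [hpow]
    calc x ^ p ≤ (K / κ * (n : ℝ) ^ (1 + η)) ^ p := Real.rpow_le_rpow hx0.le hxle hp0.le
      _ = C₁ * (n : ℝ) ^ ((1 + η) * p) := by
          rw [Real.mul_rpow (by positivity) (by positivity), ← Real.rpow_mul hn0.le]
      _ ≤ C₁ * (n : ℝ) ^ (1 : ℝ) := by
          gcongr
          rw [hp, ← mul_div_assoc, div_le_one hkγ]; exact hη
      _ = C₁ * n := by rw [Real.rpow_one]
  have hw₀k : D ^ k * w₀ ^ k ≤ n := by
    refine le_trans ?_ (hn₀ n hn)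
    gcongr
    have e : w₀ ^ k = (w₀ ^ (k + γ - 1)) ^ (k / (k + γ - 1)) := by
      rw [← Real.rpow_mul hw₀0.le, mul_div_cancel₀ _ (by linarith : k + γ - 1 ≠ 0)]
    rw [e]
    exact Real.rpow_le_rpow (by positivity) hw₀n (div_nonneg hk0.le (by linarith))
  -- The defining balance of `w₀`: the noise and bias bounds agree up to a constant.
  have hrel : s * (w₀ ^ k / n) = K * a * w₀ ^ (-γ) := by
    have e : w₀ ^ k = x * w₀ ^ (-γ) := by
      have : x = w₀ ^ (k + γ) := by rw [hpow, div_self hkγ.ne', Real.rpow_one]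
      rw [this, ← Real.rpow_add hw₀0]; congr 1; ring
    rw [e, hx]; field_simp
  have hnoise : 0 ≤ noiseAt n (w • (q : Vec d)) := le_trans (by positivity) (inv_le_noiseAt _)
  have hbias : 0 ≤ biasAt τ n (w • (q : Vec d)) q :=
    integral_nonneg fun _ => sq_nonneg _
  have hup : pointLoss τ a s n (w • (q : Vec d)) q ≤ C₂ * a * w₀ ^ (-γ) := by
    refine (hmin w₀ hw₀0.le).trans ?_
    have b1 := Hv n q w₀ hw₀1 hw₀n
    have b2 := Hu n q w₀ hw₀1
    calc a * biasAt τ n (w₀ • (q : Vec d)) q + s * noiseAt n (w₀ • (q : Vec d))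
        ≤ a * (Cv * w₀ ^ (-γ)) + s * (Cu * w₀ ^ k / n) := by gcongr
      _ = a * (Cv * w₀ ^ (-γ)) + Cu * (s * (w₀ ^ k / n)) := by ring
      _ = _ := by rw [hrel, hC₂]; ring
  rw [pointLoss] at hup
  constructor
  · have b1 := Hb τ h0 n q w hw
    have b2 : a * (cb / (1 + w) ^ 2) ≤ a * (C₂ * w₀ ^ (-γ)) := by
      have : a * (cb / (1 + w) ^ 2) ≤ a * biasAt τ n (w • (q : Vec d)) q := by gcongr
      nlinarith [mul_nonneg hs.le hnoise]
    have b3 := le_of_mul_le_mul_left b2 ha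
    have b4 : cb / C₂ * w₀ ^ γ ≤ (1 + w) ^ 2 := by
      rw [Real.rpow_neg hw₀0.le, ← div_eq_mul_inv,
        div_le_div_iff₀ (by positivity) (by positivity)] at b3
      rw [div_mul_eq_mul_div, div_le_iff₀ hC₂0]
      linarith
    have b5 : Real.sqrt (cb / C₂) * w₀ ^ (γ / 2) ≤ 1 + w := by
      refine (sq_le_sq₀ (by positivity) (by linarith)).1 ?_
      have e : (w₀ ^ (γ / 2)) ^ 2 = w₀ ^ γ := by
        rw [← Real.rpow_mul_natCast hw₀0.le, Nat.cast_ofNat, div_mul_cancel₀ _ two_ne_zero]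
      rw [mul_pow, Real.sq_sqrt (by positivity), e]
      exact b4
    -- The bias bound controls only `1 + w`; the uniform positive lower bound on `w` converts it.
    have b6 : 1 + w ≤ (1 + 1 / cs) * w := by
      have : cs ≤ w := Hs τ h0 h1 n hn2 a s ha hs hsK q w hw hmin
      have : 1 ≤ 1 / cs * w := by rw [one_div_mul_eq_div]; exact (one_le_div hcs).2 this
      linarith
    have b7 : x ^ (γ / (2 * (k + γ))) = w₀ ^ (γ / 2) := by
      rw [hpow, div_div]
    rw [b7, div_mul_eq_mul_div, div_le_iff₀ (by positivity)]
    linarith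
  -- Beyond `D * w₀` monotonicity keeps the noise above its value there, which contradicts the bound
  -- from the competitor `w₀`.
  · by_contra! hlt
    have hDw : 1 ≤ D * w₀ := one_le_mul_of_one_le_of_one_le hD1 hw₀1
    have b1 := noiseAt_mono (zero_le_one.trans hDw) hlt.le q n
    have b2 := Hl n q (D * w₀) hDw (by
      rw [Real.mul_rpow (zero_le_one.trans hD1) hw₀0.le]; exact hw₀k)
    rw [Real.mul_rpow (zero_le_one.trans hD1) hw₀0.le] at b2
    have b3 : s * noiseAt n (w • (q : Vec d)) ≤ s * (C₂ / K * (w₀ ^ k / n)) := by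
      calc _ ≤ C₂ * a * w₀ ^ (-γ) := by nlinarith [mul_nonneg ha.le hbias]
        _ = C₂ / K * (K * a * w₀ ^ (-γ)) := by field_simp
        _ = _ := by rw [← hrel]; ring
    have b4 := le_of_mul_le_mul_left b3 hs
    have b5 : 0 < w₀ ^ k / n := by positivity
    have b6 : cl * D ^ k * (w₀ ^ k / n) ≤ C₂ / K * (w₀ ^ k / n) := by
      calc _ = cl * (D ^ k * w₀ ^ k) / n := by ring
        _ ≤ _ := by linarith
    exact absurd (le_of_mul_le_mul_right b6 b5) (not_le.2 hDk)

/-! ### Back to the original matrix, and the two cases. -/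

theorem isMin_pointLoss [NeZero d] {τ a s : ℝ} {n : ℕ} {w : ℝ}
    (h : ∀ B : Vec d →ₗ[ℝ] Vec d, whiteLoss τ a s n (w • (LinearMap.id : Vec d →ₗ[ℝ] Vec d))
      ≤ whiteLoss τ a s n B) (q : Sph d) (w' : ℝ) :
    pointLoss τ a s n (w • (q : Vec d)) q ≤ pointLoss τ a s n (w' • (q : Vec d)) q := by
  have := h (w' • LinearMap.id)
  rwa [whiteLoss_smul_id τ a s n w q, whiteLoss_smul_id τ a s n w' q] at this

/-- A minimizer in whitened coordinates gives a minimizer proportional to the matrix `S`. -/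
theorem exists_eq_smul_of_isMinOn [NeZero d] {n : ℕ} (hn : 2 ≤ n)
    {S : Matrix (Fin d) (Fin d) ℝ} (hS : S.PosDef) {τ a s : ℝ} (hτ : 0 ≤ τ) (ha : 0 < a)
    {loss : Matrix (Fin d) (Fin d) ℝ → ℝ}
    (hloss : ∀ M, loss M = whiteLoss τ a s n (Matrix.toEuclideanLin (whiten S M)))
    {M : Matrix (Fin d) (Fin d) ℝ} (hM : IsMinOn loss Set.univ M) :
    ∃ w : ℝ, 0 ≤ w ∧ M = w • S ∧ ∀ (q : Sph d) (w' : ℝ),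
      pointLoss τ a s n (w • (q : Vec d)) q ≤ pointLoss τ a s n (w' • (q : Vec d)) q := by
  have hmin : ∀ B : Vec d →ₗ[ℝ] Vec d,
      whiteLoss τ a s n (Matrix.toEuclideanLin (whiten S M)) ≤ whiteLoss τ a s n B := by
    intro B
    have h := isMinOn_univ_iff.1 hM
      (CFC.sqrt S * Matrix.toEuclideanLin.symm B * CFC.sqrt S)
    rwa [hloss, hloss, whiten_sqrt_mul_mul_sqrt hS, LinearEquiv.apply_symm_apply] at h
  obtain ⟨w, hw, hA⟩ := exists_smul_id_of_isMin hτ ha s hn hmin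
  refine ⟨w, hw, ?_, fun q w' => isMin_pointLoss (hA ▸ hmin) q w'⟩
  have h1 : whiten S M = w • 1 := by
    apply Matrix.toEuclideanLin.injective
    rw [hA, map_smul]
    congr 1
    ext x
    simp
  rw [← sqrt_mul_whiten_mul_sqrt hS M, h1, Matrix.mul_smul, Matrix.smul_mul, Matrix.mul_one,
    sqrt_mul_sqrt hS]

/-- Since `K * Λ ≥ 1`, lowering the lower exponent or raising the upper one only weakens the bounds.
-/
theorem rpow_bounds_mono {K Λ c C w e₁ e₂ e₁' e₂' : ℝ} (hK : 0 < K) (hΛ : 0 < Λ)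
    (hc : 0 < c) (hC : 0 < C) (h1 : 1 ≤ K * Λ) (he₁ : e₁' ≤ e₁) (he₂ : e₂ ≤ e₂')
    (hw : c * (K * Λ) ^ e₁ ≤ w) (hw' : w ≤ C * (K * Λ) ^ e₂) :
    c * K ^ e₁' * Λ ^ e₁' ≤ w ∧ w ≤ C * K ^ e₂' * Λ ^ e₂' := by
  rw [mul_assoc, mul_assoc, ← Real.mul_rpow hK.le hΛ.le, ← Real.mul_rpow hK.le hΛ.le]
  refine ⟨le_trans ?_ hw, hw'.trans ?_⟩
  · gcongr
  · gcongr

end SoftmaxICL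

end
theorem theorem1 (d : ℕ) (hd : 2 ≤ d) (κ K : ℝ) (hκ : 0 < κ) (hK : 0 < K) :
    ∃ (n₀ : ℕ) (c C : ℝ), 0 < c ∧ 0 < C ∧
      ∀ (n : ℕ) (L σ : ℝ) (S : Matrix (Fin d) (Fin d) ℝ)
        (Dε : MeasureTheory.Measure ℝ) [MeasureTheory.IsProbabilityMeasure Dε],
        n₀ ≤ n → 0 < L → 0 < σ → S.PosDef →
        MeasureTheory.MemLp id 2 Dε →
        ∫ e, e ∂Dε = 0 →
        ProbabilityTheory.variance id Dε = σ ^ 2 →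
        σ ^ 2 ≤ K * (n * L ^ 2) →
        -- Case 1: affine tasks
        (κ * (L ^ 2 * (n : ℝ) ^ (-(2 / ((d : ℝ) + 2)))) ≤ σ ^ 2 →
          ∀ M : Matrix (Fin d) (Fin d) ℝ,
            IsMinOn (SoftmaxICL.iclLoss (SoftmaxICL.affineLaw S L) SoftmaxICL.affineTask
              (SoftmaxICL.covariateLaw S) Dε n) Set.univ M →
            ∃ w : ℝ, M = w • S ∧
              c * (n * L ^ 2 / σ ^ 2) ^ (1 / ((d : ℝ) + 4)) ≤ |w| ∧
              |w| ≤ C * (n * L ^ 2 / σ ^ 2) ^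
                (2 * (1 / ((d : ℝ) + 4)) / (1 - 1 / ((d : ℝ) + 2)))) ∧
        -- Case 2: two-piece ReLU tasks
        (κ * (L ^ 2 * (n : ℝ) ^ (-(2 / (d : ℝ)))) ≤ σ ^ 2 →
          ∀ M : Matrix (Fin d) (Fin d) ℝ,
            IsMinOn (SoftmaxICL.iclLoss (SoftmaxICL.reluLaw S L) SoftmaxICL.reluTask
              (SoftmaxICL.covariateLaw S) Dε n) Set.univ M →
            ∃ w : ℝ, M = w • S ∧
              c * (n * L ^ 2 / σ ^ 2) ^ (1 / ((d : ℝ) + 2)) ≤ |w| ∧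
              |w| ≤ C * (n * L ^ 2 / σ ^ 2) ^ (2 * (1 / ((d : ℝ) + 2)))) := by
  have : NeZero d := ⟨by omega⟩
  have hd' : (2 : ℝ) ≤ d := by exact_mod_cast hd
  obtain ⟨C₁, hC₁, H₁⟩ := SoftmaxICL.exists_mean_wdev_one_le d
  obtain ⟨C₀, hC₀, H₀⟩ := SoftmaxICL.exists_mean_wdev_zero_le d
  -- The factor three compensates `a = L²/3`. The condition on `η` reads `(d+4)(d+1) ≤ (d+2)(d+3)`.
  obtain ⟨n₁, c₁, C₁', hc₁, hC₁', B₁⟩ := SoftmaxICL.exists_bounds_of_isMin (d := d) hd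
    (τ := 1) (γ := 2) (κ := κ) (K := 3 * K) (η := 2 / ((d : ℝ) + 2)) zero_le_one le_rfl
    (by norm_num) hC₁ (fun q w hw => H₁ q w (by linarith)) hκ (by positivity) (by
      have e : 1 + 2 / ((d : ℝ) + 2) = (d + 4) / (d + 2) := by field_simp; ring
      rw [e, div_mul_eq_mul_div, div_le_iff₀ (by positivity)]
      nlinarith)
  -- Here `3/2` compensates `a = 2L²/3`, and the condition on `η` is an equality.
  obtain ⟨n₂, c₂, C₂', hc₂, hC₂', B₂⟩ := SoftmaxICL.exists_bounds_of_isMin (d := d) hd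
    (τ := 0) (γ := 3 / 2) (κ := κ) (K := 3 / 2 * K) (η := 2 / (d : ℝ)) le_rfl zero_le_one
    (by norm_num) hC₀ H₀ hκ (by positivity) (by
      have e : 1 + 2 / (d : ℝ) = (d + 2) / d := by field_simp
      rw [e, div_mul_eq_mul_div, div_le_iff₀ (by positivity)]
      nlinarith)
  refine ⟨max 2 (max n₁ n₂), min (c₁ * K ^ (1 / ((d : ℝ) + 4))) (c₂ * K ^ (1 / ((d : ℝ) + 2))),
    max (C₁' * K ^ (2 * (1 / ((d : ℝ) + 4)) / (1 - 1 / ((d : ℝ) + 2))))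
      (C₂' * K ^ (2 * (1 / ((d : ℝ) + 2)))), by positivity, by positivity, ?_⟩
  intro n L σ S Dε _ hn hL hσ hS h2 h0 hv hσK
  have hn2 : 2 ≤ n := (le_max_left _ _).trans hn
  have hn₁ : n₁ ≤ n := (le_max_left _ _).trans ((le_max_right _ _).trans hn)
  have hn₂ : n₂ ≤ n := (le_max_right _ _).trans ((le_max_right _ _).trans hn)
  have : NeZero n := ⟨by omega⟩
  have hn0 : (0 : ℝ) < n := Nat.cast_pos.2 (NeZero.pos n)
  have hΛ : 0 < n * L ^ 2 / σ ^ 2 := by positivity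
  have hKΛ : 1 ≤ K * (n * L ^ 2 / σ ^ 2) := by
    rw [← mul_div_assoc]; exact (one_le_div (by positivity)).2 hσK
  obtain ⟨q⟩ : Nonempty (SoftmaxICL.Sph d) := ⟨SoftmaxICL.sphPole d⟩
  have hpos : ∀ {e : ℝ}, 0 < (n * L ^ 2 / σ ^ 2) ^ e := fun {e} => Real.rpow_pos_of_pos hΛ e
  constructor
  · intro hκσ M hM
    obtain ⟨w, hw, rfl, hmin⟩ := SoftmaxICL.exists_eq_smul_of_isMinOn hn2 hS (τ := 1)
      (a := L ^ 2 / 3) (s := σ ^ 2) zero_le_one (by positivity)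
      (SoftmaxICL.iclLoss_affine hS hL h2 h0 hv) hM
    have ex : 3 * K * (n * (L ^ 2 / 3)) / σ ^ 2 = K * (n * L ^ 2 / σ ^ 2) := by ring
    obtain ⟨b1, b2⟩ := B₁ n hn2 hn₁ (L ^ 2 / 3) (σ ^ 2) (by positivity) (by positivity)
      (by linarith) (le_trans (by
        have : 0 < κ * (L ^ 2 * (n : ℝ) ^ (-(2 / ((d : ℝ) + 2)))) := by positivity
        linarith) hκσ) q w hw fun w' _ => hmin q w'
    rw [ex] at b1 b2
    -- Both exponents obtained are `2/(d+3)`, which lies between the two claimed ones.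
    obtain ⟨r1, r2⟩ := SoftmaxICL.rpow_bounds_mono (e₁' := 1 / ((d : ℝ) + 4))
      (e₂' := 2 * (1 / ((d : ℝ) + 4)) / (1 - 1 / ((d : ℝ) + 2))) hK hΛ hc₁ hC₁' hKΛ (by
        rw [div_le_div_iff₀ (by positivity) (by linarith)]; linarith) (by
        have e : 2 * (1 / ((d : ℝ) + 4)) / (1 - 1 / ((d : ℝ) + 2))
            = 2 * (d + 2) / ((d + 4) * (d + 1)) := by
          have : 1 - 1 / ((d : ℝ) + 2) = (d + 1) / (d + 2) := by field_simp; ring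
          rw [this]; field_simp
        rw [e, div_le_div_iff₀ (by linarith) (by positivity)]
        nlinarith) b1 b2
    refine ⟨w, rfl, ?_, ?_⟩
    · rw [abs_of_nonneg hw]
      exact (mul_le_mul_of_nonneg_right (min_le_left _ _) hpos.le).trans r1
    · rw [abs_of_nonneg hw]
      exact r2.trans (mul_le_mul_of_nonneg_right (le_max_left _ _) hpos.le)
  · intro hκσ M hM
    obtain ⟨w, hw, rfl, hmin⟩ := SoftmaxICL.exists_eq_smul_of_isMinOn hn2 hS (τ := 0)
      (a := 2 * L ^ 2 / 3) (s := σ ^ 2) le_rfl (by positivity)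
      (SoftmaxICL.iclLoss_relu hS hL h2 h0 hv) hM
    have ex : 3 / 2 * K * (n * (2 * L ^ 2 / 3)) / σ ^ 2 = K * (n * L ^ 2 / σ ^ 2) := by ring
    obtain ⟨b1, b2⟩ := B₂ n hn2 hn₂ (2 * L ^ 2 / 3) (σ ^ 2) (by positivity) (by positivity)
      (by linarith) (le_trans (by
        have : 0 < κ * (L ^ 2 * (n : ℝ) ^ (-(2 / (d : ℝ)))) := by positivity
        linarith) hκσ) q w hw fun w' _ => hmin q w'
    rw [ex] at b1 b2
    -- The exponents obtained are `3/(2(d+2))` and `2/(d+2)`; the upper one is exactly as claimed.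
    obtain ⟨r1, r2⟩ := SoftmaxICL.rpow_bounds_mono (e₁' := 1 / ((d : ℝ) + 2))
      (e₂' := 2 * (1 / ((d : ℝ) + 2))) hK hΛ hc₂ hC₂' hKΛ (by
        rw [div_le_div_iff₀ (by positivity) (by linarith)]; linarith) (by
        rw [mul_one_div, div_le_div_iff₀ (by linarith) (by positivity)]; linarith) b1 b2
    refine ⟨w, rfl, ?_, ?_⟩
    · rw [abs_of_nonneg hw]
      exact (mul_le_mul_of_nonneg_right (min_le_right _ _) hpos.le).trans r1
    · rw [abs_of_nonneg hw]
      exact r2.trans (mul_le_mul_of_nonneg_right (le_max_right _ _) hpos.le)
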